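/- **Setting.** A simple polygon with $n\ge 3$ edges is given by distinct points $S_1,\dots,S_n$ (cyclic indices) such that two different edges $\overline{S_iS_{i+1}}$ meet only in common vertices. Its region $\mathcal S$ is the union of the edges together with all points of the plane off the edges whose connected component in the complement of the edges is bounded. In the planar case the interior of $\mathcal S$ is to the left when one travels from $S_i$ to $S_{i+1}$. For $d\ge 0$, $\mathcal D(P,d)$ is the closed disk of center $P$ and radius $d$, and $F_D(d)=\mathbb P(\|X-P\|\le d)$ with $X$ uniformly distributed in $\mathcal S$. Time is the number of steps of a real random access machine: reading a number, each of $+,-,\times,/,\sqrt{\cdot},\arccos$, a comparison of reals, storing an element, advancing a loop, and drawing a random index each cost one step. **Algorithms.** Put $\mathcal I_{\overline{AB}}=x_Ay_B-y_Ax_B$. *Algorithm 1* finds the points of a segment $\overline{AB}$ on the circle $\mathcal C(P,d)$ by solving the quadratic equation for $A+t\overrightarrow{AB}$ and keeping the solutions $I$ with $\langle\overrightarrow{IA},\overrightarrow{IB}\rangle\le 0$. *Algorithm 2* computes $\mathcal L=\frac12\sum_i\mathcal I_{\overline{S_iS_{i+1}}}$; the crossing number, i.e. the number of $i$ with $y_{S_i}<y_P\le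 y_{S_{i+1}}$ or $y_{S_{i+1}}<y_P\le y_{S_i}$ for which the point of the edge of ordinate $y_P$ has abscissa $>x_P$; and $d_{\min},d_{\max}$, as the minimum over the edges of the distance from $P$ to the edge and the maximum over the vertices of the distance from $P$. *Algorithm 3*, for a vertex $S_{i+1}$ on the circle, answers whether it is relevant: let $H$ be the closed half-plane bounded by the tangent at $S_{i+1}$ not containing $P$. If $\overline{S_iS_{i+1}}$ reaches $S_{i+1}$ from inside the disk, it is relevant iff $S_{i+2}\in H$ (an arc of $\mathcal S\cap\mathcal C(P,d)$ starts there); otherwise, iff $S_{i+2}\notin H$ (an arc ends there). *Algorithm 4* goes once through the edges, adds $\frac12\mathcal I$ of the part of each edge in $\mathcal D(P,d)$ to $\ell$ (initially $0$), and stores the intersections with $\mathcal C(P,d)$ with the entry $1$ where the boundary leaves the disk (an arc starts) and $0$ where it enters (an arc ends); tangency points and irrelevant vertices are not stored. If nothing is stored, it returns area $\ell$ and value $1$ if $\ell=\mathcal L$; otherwise area $\pi d^2$ and value $\pi d^2/\mathcal L$ if the crossing number is odd, and $0$ and $0$ if it is even. If something is stored, it sorts the stored points by their polar angle about $P$ in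 $[0,2\pi)$, adds to $\ell$, for each point $A$ with entry $1$ and its cyclic successor $B$, the quantity $\frac12\bigl(d^2\theta(A,B)+x_P(y_B-y_A)-y_P(x_B-x_A)\bigr)$, $\theta(A,B)$ being the counterclockwise angle from $A$ to $B$, and returns area $\ell$ and value $\ell/\mathcal L$. **Statement.** There is an absolute constant $C$ such that the following holds. (1) *Planar case.* Let $S$ be a simple polygon in $\mathbb R^2$ with $n$ edges and $P\in\mathbb R^2$. Algorithm 2 returns $\mathcal L=\operatorname{area}(\mathcal S)>0$ and the exact least and greatest distances $d_{\min},d_{\max}$ from $P$ to the boundary $\partial\mathcal S$. Moreover $P\in\partial\mathcal S$ iff $d_{\min}=0$; if $P\notin\partial\mathcal S$, then $P$ is in the interior of $\mathcal S$ iff the crossing number is odd; and $P\in\mathcal S$ iff the crossing number is odd or $d_{\min}=0$. For every $d\ge0$, Algorithm 2 followed by Algorithm 4 returns exactly $\operatorname{area}(\mathcal S\cap\mathcal D(P,d))$ and $F_D(d)=\operatorname{area}(\mathcal S\cap\mathcal D(P,d))/\operatorname{area}(\mathcal S)$. The number of steps is at most $C\,n\log n$ in the worst case if the points are sorted by merge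 sort; with Quicksort with uniformly random pivots the result is correct for every choice of the pivots and the expected number of steps is at most $C\,n\log n$. (2) *Point off the plane.* Let $\mathcal P\subset\mathbb R^3$ be a plane, $V_1,\dots,V_n\in\mathcal P$ the vertices of a simple polygon with region $\mathcal S\subset\mathcal P$ (run through in either sense), with $\overrightarrow{V_2V_1},\overrightarrow{V_2V_3}$ linearly independent, and let $P\in\mathbb R^3$ have the orthogonal projection $P_0$ on $\mathcal P$. Let $d\ge0$, let $\mathcal B$ denote closed balls, and let area be the two-dimensional Euclidean (Hausdorff) area. If $d\ge\|PP_0\|$, then $\mathcal S\cap\mathcal B(P,d)=\mathcal S\cap\mathcal B(P_0,\sqrt{d^2-\|PP_0\|^2})$; if $d<\|PP_0\|$, then $\mathcal S\cap\mathcal B(P,d)=\emptyset$. Consider the algorithm that computes coordinates of the $V_i$ and of $P_0$ in the orthonormal frame of $\mathcal P$ with origin $V_2$ obtained from $\overrightarrow{V_2V_1},\overrightarrow{V_2V_3}$ by Gram–Schmidt, reverses the second axis if the signed area $\mathcal L$ in these coordinates is negative, and runs Algorithms 2 and 4 with $P_0$ and radius $\sqrt{d^2-\|PP_0\|^2}$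 (returning $0$ and $0$ if $d<\|PP_0\|$). Then $\operatorname{area}(\mathcal S)>0$, the algorithm returns exactly $\operatorname{area}(\mathcal S\cap\mathcal B(P,d))$ and $F_D(d)=\operatorname{area}(\mathcal S\cap\mathcal B(P,d))/\operatorname{area}(\mathcal S)$, with the same $C\,n\log n$ bounds (worst case with merge sort; expected, and correct for every choice of the pivots, with random Quicksort). -/

import Mathlib

open MeasureTheory Filter Topology
open scoped ENNReal

noncomputable section

namespace PolygonDistance

/-- The Euclidean plane. -/
abbrev Plane : Type := EuclideanSpace ℝ (Fin 2)

/-- Euclidean three-space. -/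
abbrev Space : Type := EuclideanSpace ℝ (Fin 3)

/-! ### Simple polygons -/

section Polygons

variable {E : Type*} [NormedAddCommGroup E] [NormedSpace ℝ E]

/-- The union of the edges `[S i, S (i+1)]`, indices being cyclic. -/
def boundary {n : ℕ} [NeZero n] (S : Fin n → E) : Set E :=
  ⋃ i, segment ℝ (S i) (S (i + 1))

/-- A non-self-intersecting closed polygonal line with `n` edges: there are at least three
vertices, they are distinct, and two different edges can meet only in a vertex of both. -/
structure IsSimplePolygon {n : ℕ} [NeZero n] (S : Fin n → E) : Prop where
  three_le : 3 ≤ n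
  injective : Function.Injective S
  inter_subset : ∀ i j, i ≠ j →
    segment ℝ (S i) (S (i + 1)) ∩ segment ℝ (S j) (S (j + 1)) ⊆
      {S i, S (i + 1)} ∩ {S j, S (j + 1)}

/-- The closed polygonal region bounded by the polygonal line `S` in the flat `F` (which contains
it): the boundary, together with the points of `F` off the boundary that lie in a bounded
connected component of the complement of the boundary in `F`. -/
def region {n : ℕ} [NeZero n] (F : Set E) (S : Fin n → E) : Set E :=
  boundary S ∪ {Q | Q ∈ F \ boundary S ∧
    Bornology.IsBounded (connectedComponentIn (F \ boundary S) Q)}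

end Polygons

/-- The closed region bounded by a polygonal line of the plane. -/
def planeRegion {n : ℕ} [NeZero n] (S : Fin n → Plane) : Set Plane :=
  region Set.univ S

/-- The vector `v` rotated by a quarter turn counterclockwise. -/
def leftNormal (v : Plane) : Plane := !₂[-(v 1), v 0]

/-- Travelling along each edge from `S i` to `S (i+1)`, one has the interior of the region to the
left. -/
def InteriorOnLeft {n : ℕ} [NeZero n] (S : Fin n → Plane) : Prop :=
  ∀ i, ∀ Q ∈ openSegment ℝ (S i) (S (i + 1)),
    ∀ᶠ t in 𝓝[>] (0 : ℝ), Q + t • leftNormal (S (i + 1) - S i) ∈ interior (planeRegion S)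

/-- `F_D(d)`: the cumulative distribution function at `d` of `D = ‖X - P‖`, where `X` is uniformly
distributed on `A` with respect to `μ`. -/
def distanceCDF {E : Type*} [NormedAddCommGroup E] [MeasurableSpace E]
    (μ : Measure E) (A : Set E) (P : E) (d : ℝ) : ℝ :=
  ProbabilityTheory.cdf ((ProbabilityTheory.cond μ A).map fun X => dist X P) d

/-! ### Real-number computations with a step count

The machine is a real random access machine: reading a stored number or a constant, one of the
operations `+`, `-`, `*`, `/`, square root and arccosine on real numbers, a comparison of two real
numbers, storing an element in a list or an array, and advancing a loop each take one step. -/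

/-- The result of a computation, with the number of steps that it took. -/
structure Timed (α : Type) : Type where
  val : α
  cost : ℕ

instance : Monad Timed where
  pure a := ⟨a, 0⟩
  bind a f := ⟨(f a.val).val, a.cost + (f a.val).cost⟩

/-- Spend `k` steps. -/
def tick (k : ℕ) : Timed Unit := ⟨(), k⟩

/-- Arithmetic expressions over stored real numbers. -/
inductive RExpr : Type
  | lit (x : ℝ)
  | neg (a : RExpr)
  | add (a b : RExpr)
  | sub (a b : RExpr)
  | mul (a b : RExpr)
  | div (a b : RExpr)
  | sqrt (a : RExpr)
  | arccos (a : RExpr)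

namespace RExpr

instance : Zero RExpr := ⟨lit 0⟩
instance : Neg RExpr := ⟨neg⟩
instance : Add RExpr := ⟨add⟩
instance : Sub RExpr := ⟨sub⟩
instance : Mul RExpr := ⟨mul⟩
instance : Div RExpr := ⟨div⟩

/-- The value of an expression. -/
def eval : RExpr → ℝ
  | lit x => x
  | neg a => -a.eval
  | add a b => a.eval + b.eval
  | sub a b => a.eval - b.eval
  | mul a b => a.eval * b.eval
  | div a b => a.eval / b.eval
  | sqrt a => Real.sqrt a.eval
  | arccos a => Real.arccos a.eval

/-- The number of steps needed to evaluate an expression: one for each number read and one for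
each operation. -/
def ops : RExpr → ℕ
  | lit _ => 1
  | neg a => a.ops + 1
  | add a b => a.ops + b.ops + 1
  | sub a b => a.ops + b.ops + 1
  | mul a b => a.ops + b.ops + 1
  | div a b => a.ops + b.ops + 1
  | sqrt a => a.ops + 1
  | arccos a => a.ops + 1

/-- Evaluate an expression. -/
def run (e : RExpr) : Timed ℝ := ⟨e.eval, e.ops⟩

end RExpr

open RExpr (lit)

/-- The test `a < b`. -/
def testLt (a b : RExpr) : Timed Bool := ⟨decide (a.eval < b.eval), a.ops + b.ops + 1⟩

/-- The test `a ≤ b`. -/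
def testLe (a b : RExpr) : Timed Bool := ⟨decide (a.eval ≤ b.eval), a.ops + b.ops + 1⟩

/-- The test `a = b`. -/
def testEq (a b : RExpr) : Timed Bool := ⟨decide (a.eval = b.eval), a.ops + b.ops + 1⟩

/-- The loop `for i in l`, with loop state `s`. -/
def forLoop {ι σ : Type} (body : σ → ι → Timed σ) : List ι → σ → Timed σ
  | [], s => pure s
  | i :: l, s => do
    tick 1
    let s' ← body s i
    forLoop body l s'

/-- Compute an array of `n` entries. -/
def tabulate {α : Type} {n : ℕ} (f : Fin n → Timed α) : Timed (Fin n → α) :=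
  ⟨fun i => (f i).val, ∑ i, ((f i).cost + 1)⟩

/-- A randomized computation with a step count. -/
def RandTimed (α : Type) : Type := PMF (Timed α)

instance : Monad RandTimed where
  pure a := PMF.pure (pure a : Timed _)
  bind p f := PMF.bind p fun a =>
    PMF.map (fun b => ⟨b.val, a.cost + b.cost⟩) (f a.val)

/-- A deterministic computation as a randomized one. -/
def RandTimed.lift {α : Type} (t : Timed α) : RandTimed α := PMF.pure t

instance : MonadLift Timed RandTimed := ⟨RandTimed.lift⟩

/-- The possible runs (result and step count) of a randomized computation. -/
def RandTimed.runs {α : Type} (p : RandTimed α) : Set (Timed α) := PMF.support p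

/-- The expected number of steps of a randomized computation. -/
def RandTimed.expectedCost {α : Type} (p : RandTimed α) : ℝ≥0∞ :=
  ∑' r : Timed α, (show PMF (Timed α) from p) r * (r.cost : ℝ≥0∞)

/-- Draw an index uniformly at random, in one step. -/
def randomIndex (m : ℕ) : RandTimed (Fin (m + 1)) :=
  PMF.map (fun i => ⟨i, 1⟩) (PMF.uniformOfFintype (Fin (m + 1)))

/-! ### Formulas of plane geometry -/

/-- The abscissa of a point. -/
def xOf (A : Plane) : RExpr := lit (A 0)

/-- The ordinate of a point. -/
def yOf (A : Plane) : RExpr := lit (A 1)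

/-- The scalar product of the vectors `AB` and `CD`. -/
def dot (A B C D : Plane) : RExpr :=
  (xOf B - xOf A) * (xOf D - xOf C) + (yOf B - yOf A) * (yOf D - yOf C)

/-- The length of the vector `AB`. -/
def len (A B : Plane) : RExpr := RExpr.sqrt (dot A B A B)

/-- The point `A + t AB`. -/
def pointAt (A B : Plane) (t : ℝ) : Timed Plane := do
  let x ← (xOf A + lit t * (xOf B - xOf A)).run
  let y ← (yOf A + lit t * (yOf B - yOf A)).run
  pure !₂[x, y]

/-- The test `A = B`. -/
def samePoint (A B : Plane) : Timed Bool := do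
  let bx ← testEq (xOf A) (xOf B)
  let b_y ← testEq (yOf A) (yOf B)
  pure (bx && b_y)

/-- The line integral of `x dy - y dx` over the segment from `A` to `B`. -/
def segmentIntegral (A B : Plane) : RExpr := yOf B * xOf A - yOf A * xOf B

/-! ### Algorithm 1: the intersections of a segment and a circle -/

/-- The list of the points of `[A, B]` on the circle of center `P` and radius `d`, for `A ≠ B`. -/
def algorithm1 (A B P : Plane) (d : ℝ) : Timed (List Plane) := do
  let Δ ← (dot P A A B * dot P A A B - dot A B A B * (dot P A P A - lit d * lit d)).run
  if ← testLt (lit Δ) 0 then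
    pure []
  else if ← testEq (lit Δ) 0 then
    let t ← (-(dot P A A B) / dot A B A B).run
    let I ← pointAt A B t
    if ← testLe (dot I A I B) 0 then pure [I] else pure []
  else
    let t₁ ← ((-(dot P A A B) + RExpr.sqrt (lit Δ)) / dot A B A B).run
    let t₂ ← ((-(dot P A A B) - RExpr.sqrt (lit Δ)) / dot A B A B).run
    let I₁ ← pointAt A B t₁
    let I₂ ← pointAt A B t₂
    if ← testLe (dot I₁ A I₁ B) 0 then
      if ← testLe (dot I₂ A I₂ B) 0 then pure [I₁, I₂] else pure [I₁]
    else
      if ← testLe (dot I₂ A I₂ B) 0 then pure [I₂] else pure []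

/-- The first point of the list that differs from `A`, if any. -/
def firstOther (A : Plane) : List Plane → Timed (Option Plane)
  | [] => pure none
  | I :: l => do
    tick 1
    if ← samePoint I A then firstOther A l else pure (some I)

/-! ### Algorithm 2: area, crossing number, least and greatest distance to the boundary -/

/-- The outputs of Algorithm 2. -/
structure PolygonData : Type where
  crossingNumber : ℕ
  area : ℝ
  dMin : EReal
  dMax : ℝ

/-- The update of the outputs for the edge from `A` to `B`. -/
def algorithm2Step (P A B : Plane) (s : PolygonData) : Timed PolygonData := do
  let area ← (lit s.area + lit (1 / 2) * segmentIntegral A B).run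
  let up₁ ← testLt (yOf A) (yOf P)
  let up₂ ← testLe (yOf P) (yOf B)
  let down₁ ← testLt (yOf B) (yOf P)
  let down₂ ← testLe (yOf P) (yOf A)
  let crossingNumber ←
    if (up₁ && up₂) || (down₁ && down₂) then do
      let xI ← (xOf A + (xOf B - xOf A) / (yOf B - yOf A) * (yOf P - yOf A)).run
      if ← testLt (xOf P) (lit xI) then
        tick 1
        pure (s.crossingNumber + 1)
      else
        pure s.crossingNumber
    else pure s.crossingNumber
  let dA ← (len P A).run
  let dB ← (len P B).run
  tick 1
  let dMax := max s.dMax dA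
  let t ← (dot A P A B / dot A B A B).run
  let P₀ ← pointAt A B t
  if ← testLe (dot P₀ A P₀ B) 0 then
    let d₀ ← (len P P₀).run
    tick 1
    pure ⟨crossingNumber, area, min s.dMin (d₀ : EReal), dMax⟩
  else
    tick 2
    pure ⟨crossingNumber, area, min s.dMin (min (dA : EReal) (dB : EReal)), dMax⟩

/-- Algorithm 2 for the point `P` and the polygon with vertices `S`. -/
def algorithm2 {n : ℕ} [NeZero n] (P : Plane) (S : Fin n → Plane) : Timed PolygonData :=
  forLoop (fun s i => algorithm2Step P (S i) (S (i + 1)) s) (List.finRange n) ⟨0, 0, ⊤, 0⟩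

/-! ### Algorithm 3: the type of a vertex that lies on the circle -/

/-- The ordinate, at the abscissa `x`, of the tangent at `Q` to the circle of center `P` through
`Q` (when this tangent is not vertical). -/
def tangentAt (P Q : Plane) (x : RExpr) : RExpr :=
  yOf Q + (xOf P - xOf Q) / (yOf Q - yOf P) * (x - xOf Q)

/-- Algorithm 3: `B` is a vertex on the circle of center `P`, `C` is the next vertex, and `isIn`
tells whether the edge that ends at `B` reaches it from the interior of the disk. The answer is
`true` if an arc of the boundary of the intersection of region and disk starts or ends at `B`. -/
def algorithm3 (P B C : Plane) (isIn : Bool) : Timed Bool := do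
  if ← testEq (yOf P) (yOf B) then
    let right ← testLt (xOf P) (xOf B)
    let left ← testLt (xOf B) (xOf P)
    if isIn then
      let ge ← testLe (xOf B) (xOf C)
      let le ← testLe (xOf C) (xOf B)
      pure ((right && ge) || (left && le))
    else
      let lt ← testLt (xOf C) (xOf B)
      let gt ← testLt (xOf B) (xOf C)
      pure ((right && lt) || (left && gt))
  else
    let above ← testLt (tangentAt P B (xOf P)) (yOf P)
    let below ← testLt (yOf P) (tangentAt P B (xOf P))
    if isIn then
      let le ← testLe (yOf C) (tangentAt P B (xOf C))
      let ge ← testLe (tangentAt P B (xOf C)) (yOf C)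
      pure ((above && le) || (below && ge))
    else
      let gt ← testLt (tangentAt P B (xOf C)) (yOf C)
      let lt ← testLt (yOf C) (tangentAt P B (xOf C))
      pure ((above && gt) || (below && lt))

/-! ### Algorithm 4, first loop: line integrals over the edge pieces, classified intersections -/

/-- The variables of the first loop: the line integral `ℓ` and the stored intersections, each with
its entry of the list `Arcs` (`true` for 1: an arc starts there, `false` for 0: an arc ends
there). -/
structure Scan : Type where
  integral : ℝ
  marks : List (Plane × Bool)

/-- Add half of the line integral over the segment from `A` to `B`. -/
def addSegment (A B : Plane) (s : Scan) : Timed Scan := do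
  let ℓ ← (lit s.integral + lit (1 / 2) * segmentIntegral A B).run
  pure { s with integral := ℓ }

/-- Store an intersection and its entry of the list `Arcs`. -/
def addMark (I : Plane) (arc : Bool) (s : Scan) : Timed Scan := do
  tick 2
  pure { s with marks := (I, arc) :: s.marks }

/-- Store the vertex `B` with the given entry of `Arcs`, if Algorithm 3 says that it is relevant. -/
def addVertex (P B C : Plane) (isIn arc : Bool) (s : Scan) : Timed Scan := do
  if ← algorithm3 P B C isIn then addMark B arc s else pure s

/-- The position of the point `I` on the way from `A` to `B`. -/
def position (A B I : Plane) : Timed ℝ := do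
  if ← testEq (xOf A) (xOf B) then
    ((yOf I - yOf A) / (yOf B - yOf A)).run
  else
    ((xOf I - xOf A) / (xOf B - xOf A)).run

/-- The body of the first loop, for the edge from `A` to `B` followed by the vertex `C`. -/
def scanEdge (P : Plane) (d : ℝ) (A B C : Plane) (s : Scan) : Timed Scan := do
  if ← testLe (len A P) (lit d) then
    if ← testLt (len B P) (lit d) then
      addSegment A B s
    else if ← testLt (lit d) (len B P) then
      let l ← algorithm1 A B P d
      match ← firstOther A l with
      | some I =>
        let s₁ ← addSegment A I s
        addMark I true s₁
      | none => pure s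
    else
      let s₁ ← addSegment A B s
      addVertex P B C true true s₁
  else
    let l ← algorithm1 A B P d
    if ← testLt (len B P) (lit d) then
      match l with
      | I :: _ =>
        let s₁ ← addSegment I B s
        addMark I false s₁
      | [] => pure s
    else if ← testLt (lit d) (len B P) then
      match l with
      | [I, J] =>
        let a ← position A B I
        let b ← position A B J
        let inOrder ← testLe (lit a) (lit b)
        let I₁ := if inOrder then I else J
        let I₂ := if inOrder then J else I
        let s₁ ← addSegment I₁ I₂ s
        let s₂ ← addMark I₁ false s₁
        addMark I₂ true s₂
      | _ => pure s
    else
      match l with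
      | [_] => addVertex P B C false false s
      | [I, J] =>
        let first ← samePoint I B
        let K := if first then J else I
        let s₁ ← addSegment K B s
        let s₂ ← addMark K false s₁
        addVertex P B C true true s₂
      | _ => pure s

/-- The first loop. -/
def scan {n : ℕ} [NeZero n] (P : Plane) (S : Fin n → Plane) (d : ℝ) : Timed Scan :=
  forLoop (fun s i => scanEdge P d (S i) (S (i + 1)) (S (i + 1 + 1)) s) (List.finRange n) ⟨0, []⟩

/-! ### Sorting by angle -/

/-- A stored intersection with its angle. -/
structure Mark : Type where
  angle : ℝ
  point : Plane
  arc : Bool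

/-- The angle in `[0, 2π)` of a point of the circle of center `P` and radius `d`. -/
def angleOf (P : Plane) (d : ℝ) (I : Plane) : Timed ℝ := do
  if ← testLe (yOf P) (yOf I) then
    (RExpr.arccos ((xOf I - xOf P) / lit d)).run
  else
    (lit (2 * Real.pi) - RExpr.arccos ((xOf I - xOf P) / lit d)).run

/-- Compute the angles of all stored intersections. -/
def computeAngles (P : Plane) (d : ℝ) : List (Plane × Bool) → Timed (List Mark)
  | [] => pure []
  | m :: l => do
    let a ← angleOf P d m.1
    let l' ← computeAngles P d l
    tick 1
    pure (⟨a, m.1, m.2⟩ :: l')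

/-- Merge two sorted lists. -/
def merge : List Mark → List Mark → Timed (List Mark)
  | [], m => do
    tick 1
    pure m
  | l, [] => do
    tick 1
    pure l
  | a :: l, b :: m => do
    if ← testLe (lit a.angle) (lit b.angle) then
      let r ← merge l (b :: m)
      tick 1
      pure (a :: r)
    else
      let r ← merge (a :: l) m
      tick 1
      pure (b :: r)
termination_by l m => l.length + m.length

/-- Merge sort by ascending angle. -/
def mergeSort (l : List Mark) : Timed (List Mark) :=
  if 2 ≤ l.length then do
    tick l.length
    let a ← mergeSort (l.take (l.length / 2))
    let b ← mergeSort (l.drop (l.length / 2))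
    merge a b
  else do
    tick 1
    pure l
termination_by l.length
decreasing_by all_goals (simp; omega)

/-- Split a list into the elements whose angle is less than, equal to, and greater than `p`. -/
def partition (p : ℝ) : List Mark → Timed (List Mark × List Mark × List Mark)
  | [] => pure ([], [], [])
  | m :: l => do
    let r ← partition p l
    tick 1
    if ← testLt (lit m.angle) (lit p) then pure (m :: r.1, r.2.1, r.2.2)
    else if ← testLt (lit p) (lit m.angle) then pure (r.1, r.2.1, m :: r.2.2)
    else pure (r.1, m :: r.2.1, r.2.2)

/-- Quicksort by ascending angle with uniformly random pivots. The first argument bounds the depth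
of the recursion; the length of the list is always enough. -/
def quickSortAux : ℕ → List Mark → RandTimed (List Mark)
  | 0, l => pure l
  | _ + 1, [] => do
    tick 1
    pure []
  | k + 1, m :: l => do
    let i ← randomIndex l.length
    let p := ((m :: l).get i).angle
    let r ← partition p (m :: l)
    let a ← quickSortAux k r.1
    let b ← quickSortAux k r.2.2
    tick (l.length + 1)
    pure (a ++ r.2.1 ++ b)

/-- Quicksort with uniformly random pivots, by ascending angle. -/
def quickSort (l : List Mark) : RandTimed (List Mark) := quickSortAux l.length l

/-! ### Algorithm 4 -/

/-- The line integral of `x dy - y dx` over the counterclockwise arc from `A` to `B` of the circle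
of center `P` and radius `d`. -/
def arcIntegral (P : Plane) (d : ℝ) (A B : Mark) : Timed ℝ := do
  let θ ←
    if ← testLe (lit A.angle) (lit B.angle) then
      (lit B.angle - lit A.angle).run
    else
      (lit (2 * Real.pi) + lit B.angle - lit A.angle).run
  (lit d * lit d * lit θ + xOf P * (yOf B.point - yOf A.point)
    - yOf P * (xOf B.point - xOf A.point)).run

/-- Add half of the arc integral from `A` to `B`, if an arc starts at `A`. -/
def addArc (P : Plane) (d : ℝ) (A B : Mark) (ℓ : ℝ) : Timed ℝ := do
  tick 1
  if A.arc then
    let I ← arcIntegral P d A B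
    (lit ℓ + lit (1 / 2) * lit I).run
  else pure ℓ

/-- The second loop; the element after the last one is `first`. -/
def addArcs (P : Plane) (d : ℝ) (first : Mark) : List Mark → ℝ → Timed ℝ
  | [], ℓ => pure ℓ
  | [A], ℓ => addArc P d A first ℓ
  | A :: B :: l, ℓ => do
    let ℓ' ← addArc P d A B ℓ
    addArcs P d first (B :: l) ℓ'

/-- The outputs of Algorithm 4: the area of the intersection of region and disk, and `F_D(d)`. -/
structure Output : Type where
  area : ℝ
  cdf : ℝ

/-- Algorithm 4 for the sorting procedure `sort`, the point `P`, the vertices `S`, the crossing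
number and the area `L` that Algorithm 2 returns, and the radius `d`. -/
def algorithm4 (sort : List Mark → RandTimed (List Mark)) {n : ℕ} [NeZero n]
    (P : Plane) (S : Fin n → Plane) (crossingNumber : ℕ) (L d : ℝ) : RandTimed Output := do
  let s ← scan P S d
  tick 1
  match s.marks with
  | [] =>
    if ← testEq (lit s.integral) (lit L) then
      pure ⟨s.integral, 1⟩
    else if crossingNumber % 2 = 1 then
      tick 1
      let a ← (lit Real.pi * (lit d * lit d)).run
      let F ← (lit a / lit L).run
      pure ⟨a, F⟩
    else
      tick 1
      pure ⟨0, 0⟩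
  | marks =>
    let keyed ← computeAngles P d marks
    let sorted ← sort keyed
    let ℓ ←
      match sorted with
      | [] => (pure s.integral : Timed ℝ)
      | first :: _ => addArcs P d first sorted s.integral
    let F ← (lit ℓ / lit L).run
    pure ⟨ℓ, F⟩

/-- Algorithm 2 followed by Algorithm 4. -/
def planeAlgorithm (sort : List Mark → RandTimed (List Mark)) {n : ℕ} [NeZero n]
    (P : Plane) (S : Fin n → Plane) (d : ℝ) : RandTimed Output := do
  let D ← algorithm2 P S
  algorithm4 sort P S D.crossingNumber D.area d

/-! ### A polygon in a plane of three-space and a point off this plane -/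

/-- The scalar product of two vectors of three-space. -/
def dot3 (a b : Space) : RExpr :=
  lit (a 0) * lit (b 0) + lit (a 1) * lit (b 1) + lit (a 2) * lit (b 2)

/-- The vector `a - t b`. -/
def subSmul (a : Space) (t : ℝ) (b : Space) : Timed Space := do
  let x ← (lit (a 0) - lit t * lit (b 0)).run
  let y ← (lit (a 1) - lit t * lit (b 1)).run
  let z ← (lit (a 2) - lit t * lit (b 2)).run
  pure !₂[x, y, z]

/-- The vector `a / ‖a‖`. -/
def normalize (a : Space) : Timed Space := do
  let r ← (RExpr.sqrt (dot3 a a)).run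
  let x ← (lit (a 0) / lit r).run
  let y ← (lit (a 1) / lit r).run
  let z ← (lit (a 2) / lit r).run
  pure !₂[x, y, z]

/-- The coordinates of `Q - O` along `u` and `v`, that is, the coordinates of the orthogonal
projection of `Q` in the frame `(O, u, v)`, for orthonormal `u` and `v`. -/
def frameCoords (O u v Q : Space) : Timed Plane := do
  let q ← subSmul Q 1 O
  let x ← (dot3 q u).run
  let y ← (dot3 q v).run
  pure !₂[x, y]

/-- The reflection of a point of the plane in the axis of abscissas. -/
def reflect (Q : Plane) : Timed Plane := do
  let x ← (xOf Q).run
  let y ← (-(yOf Q)).run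
  pure !₂[x, y]

/-- The algorithm for a polygon with vertices `V` contained in a plane of three-space and an
arbitrary point `P`. The frame obtained from the first three vertices by Gram-Schmidt gives plane
coordinates of the vertices and of the projection of `P`; if the polygon runs clockwise in
these coordinates (its signed area is negative), the second axis is reversed. Then
Algorithms 2 and 4 are called with the radius `√(d² - h²)`, where `h` is the distance from `P` to
its projection; if `d < h`, then the ball does not meet the plane. -/
def spaceAlgorithm (sort : List Mark → RandTimed (List Mark)) {n : ℕ} [NeZero n]
    (P : Space) (V : Fin n → Space) (d : ℝ) : RandTimed Output := do
  let a ← subSmul (V 0) 1 (V 1)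
  let b ← subSmul (V 2) 1 (V 1)
  let u ← normalize a
  let c ← (dot3 b u).run
  let w ← subSmul b c u
  let v ← normalize w
  let S ← tabulate fun i => frameCoords (V 1) u v (V i)
  let p ← frameCoords (V 1) u v P
  let q ← subSmul P 1 (V 1)
  let q₁ ← subSmul q (p 0) u
  let q₂ ← subSmul q₁ (p 1) v
  let h2 ← (dot3 q₂ q₂).run
  if ← testLt (lit d * lit d) (lit h2) then
    pure ⟨0, 0⟩
  else
    let R ← (RExpr.sqrt (lit d * lit d - lit h2)).run
    let D ← algorithm2 p S
    if ← testLt (lit D.area) 0 then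
      let S' ← tabulate fun i => reflect (S i)
      let p' ← reflect p
      planeAlgorithm sort p' S' R
    else
      algorithm4 sort p S D.crossingNumber D.area R

end PolygonDistance

end

/-! The area is obtained as the integral of a winding number. The signed number `winding S Q` of
crossings of the boundary with the ray from `Q` to the right is locally constant off the boundary,
jumps by one across an edge and vanishes far away. Every point off the boundary can be joined to one
of the two sides of the closed line, so there are only two values, `0` and some `ε = ±1`, and the
bounded components are those with value `ε`: this is the Jordan curve theorem in the form
`IsSimplePolygon.exists_orientation`. With the interior on the left, `ε = 1`, and the area of the
region inside a disk is the integral of `winding S` over the disk.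

All invariance comes from one exact identity for two disjoint segments, `rayCross_sub_rayCross`:
moving `Q` along one segment changes its crossing number with the other by a term at the two ends of
the other. Complementary half-open conventions for rays to the right and to the left make it valid
in every position, so that nothing has to be put in general position.

To integrate over a disk, each edge is split into an inner part, from `X i` to `Y i`, and outer
parts (`IsSplit`). The outer parts contribute at a point of the disk a number that depends on its
ordinate alone, namely a constant `c` plus a sum over the end points `X i`, `Y i`. Integration over
horizontal chords gives `integral_winding`: `c` times the area of the disk, plus half the line
integrals over the inner parts, plus the differences of an explicit function `endPotential` at `Y i`
and `X i`. On the circle this function is, up to a constant and a jump at the lowest point, minus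
the primitive of the line integral along arcs (`endPotential_eq`). Together this replaces Green's
formula.

The stored intersections are not compared with the arcs of the actual intersection. They satisfy a
flux identity: for every function `g` on the plane, the signed sum of `g` over the marks is the sum
of `g (Y i) - g (X i)` (`ScanResult.flux`). It holds for a single edge up to a term at its two
vertices, and these terms cancel around the polygon; tangencies and irrelevant vertices thus
disappear by themselves. It remains to see that the sorted marks alternate between starts and ends.
The number of open arcs at an angle is a winding number just inside the circle, hence `0` or `1`
(`arc_depth`), and this evaluates the second loop (`addArcs_val`, `addArcs_eq_area`). If there are
no marks, the flux identity shows that the inner parts are all trivial or all whole edges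
(`area_of_marks_eq_nil`).

The loops have bodies of bounded cost and there are at most `2 * n` marks, so sorting dominates:
merge sort is bounded through `Nat.clog`, random Quicksort through the harmonic recurrence
`quickSortBound_rec`. For a plane of three-space, the orthonormal frame is an isometry that carries
region, disk and area over; a negative signed area means `ε = -1`, and reversing the second axis
repairs it. -/

noncomputable section
namespace PolygonDistance

/-! ### Crossing numbers and the Jordan curve theorem for polygons -/

/-- The determinant of the vectors `AB` and `AQ`: positive iff `Q` lies to the left of `AB`. -/
def cross (A B Q : Plane) : ℝ := (B 0 - A 0) * (Q 1 - A 1) - (B 1 - A 1) * (Q 0 - A 0)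

/-- The signed number of crossings of the segment from `A` to `B` with the ray from `Q` to the
right. -/
def rayCross (A B Q : Plane) : ℤ :=
  if A 1 < Q 1 ∧ Q 1 ≤ B 1 ∧ 0 < cross A B Q then 1
  else if B 1 < Q 1 ∧ Q 1 ≤ A 1 ∧ cross A B Q < 0 then -1 else 0

/-- The signed number of crossings of the segment from `P` to `Q` with the ray from `R` to the
left. -/
def leftCross (P Q R : Plane) : ℤ :=
  if P 1 ≤ R 1 ∧ R 1 < Q 1 ∧ cross P Q R < 0 then 1
  else if Q 1 ≤ R 1 ∧ R 1 < P 1 ∧ 0 < cross P Q R then -1 else 0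

/-- The winding number of the polygonal line `S` around `Q`, counted on the ray to the right. -/
def winding {n : ℕ} [NeZero n] (S : Fin n → Plane) (Q : Plane) : ℤ :=
  ∑ i, rayCross (S i) (S (i + 1)) Q

lemma cross_swap (A B Q : Plane) : cross B A Q = -cross A B Q := by
  unfold cross; ring

lemma rayCross_swap (A B Q : Plane) : rayCross B A Q = -rayCross A B Q := by
  unfold rayCross
  rw [cross_swap]
  split_ifs <;> grind

lemma leftCross_swap (P Q R : Plane) : leftCross Q P R = -leftCross P Q R := by
  unfold leftCross
  rw [cross_swap]
  split_ifs <;> grind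

/-- The abscissa at which the line `AB` has the ordinate `y`. -/
def xAt (A B : Plane) (y : ℝ) : ℝ := A 0 + (y - A 1) / (B 1 - A 1) * (B 0 - A 0)

lemma continuous_xAt (A B : Plane) : Continuous (xAt A B) := by
  unfold xAt; fun_prop

lemma xAt_left (A B : Plane) : xAt A B (A 1) = A 0 := by simp [xAt]

lemma xAt_right {A B : Plane} (h : A 1 ≠ B 1) : xAt A B (B 1) = B 0 := by
  have : B 1 - A 1 ≠ 0 := sub_ne_zero.2 h.symm
  simp [xAt, this]

lemma cross_eq_xAt {A B : Plane} (h : A 1 ≠ B 1) (Q : Plane) :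
    cross A B Q = (B 1 - A 1) * (xAt A B (Q 1) - Q 0) := by
  have : B 1 - A 1 ≠ 0 := sub_ne_zero.2 h.symm
  unfold cross xAt
  field_simp
  ring

lemma plane_ext {A B : Plane} (h0 : A 0 = B 0) (h1 : A 1 = B 1) : A = B := by
  ext i; fin_cases i
  · exact h0
  · exact h1

lemma mem_segment_iff_exists {A B Q : Plane} : Q ∈ segment ℝ A B ↔
    ∃ t : ℝ, 0 ≤ t ∧ t ≤ 1 ∧ Q 0 = A 0 + t * (B 0 - A 0) ∧ Q 1 = A 1 + t * (B 1 - A 1) := by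
  rw [segment_eq_image']
  constructor
  · rintro ⟨t, ⟨h0, h1⟩, rfl⟩
    exact ⟨t, h0, h1, by simp, by simp⟩
  · rintro ⟨t, h0, h1, hx, hy⟩
    exact ⟨t, ⟨h0, h1⟩, plane_ext (by simp [hx]) (by simp [hy])⟩

lemma mem_openSegment_iff_exists {A B Q : Plane} : Q ∈ openSegment ℝ A B ↔
    ∃ t : ℝ, 0 < t ∧ t < 1 ∧ Q 0 = A 0 + t * (B 0 - A 0) ∧ Q 1 = A 1 + t * (B 1 - A 1) := by
  rw [openSegment_eq_image']
  constructor
  · rintro ⟨t, ⟨h0, h1⟩, rfl⟩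
    exact ⟨t, h0, h1, by simp, by simp⟩
  · rintro ⟨t, h0, h1, hx, hy⟩
    exact ⟨t, ⟨h0, h1⟩, plane_ext (by simp [hx]) (by simp [hy])⟩

lemma xAt_mem_segment {A B : Plane} (h : A 1 < B 1) {y : ℝ} (h1 : A 1 ≤ y) (h2 : y ≤ B 1) :
    (!₂[xAt A B y, y] : Plane) ∈ segment ℝ A B := by
  have h' : 0 < B 1 - A 1 := sub_pos.2 h
  refine mem_segment_iff_exists.2 ⟨(y - A 1) / (B 1 - A 1), by
    apply div_nonneg <;> linarith, by rw [div_le_one h']; linarith, by simp [xAt], ?_⟩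
  simp only [Matrix.cons_val_one, Matrix.cons_val_fin_one]
  field_simp
  ring

lemma horizontal_mem_segment {A B : Plane} (h : A 1 = B 1) {x : ℝ} (hx : x ∈ Set.uIcc (A 0) (B 0)) :
    (!₂[x, A 1] : Plane) ∈ segment ℝ A B := by
  rw [← segment_eq_uIcc, segment_eq_image'] at hx
  obtain ⟨t, ⟨h0, h1⟩, rfl⟩ := hx
  exact mem_segment_iff_exists.2 ⟨t, h0, h1, by simp, by simp [h]⟩

/-- Two disjoint segments that are not horizontal do not change sides. -/
lemma xAt_lt_iff_of_disjoint {A B P Q : Plane} (hAB : A 1 < B 1) (hPQ : P 1 < Q 1)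
    (hd : Disjoint (segment ℝ A B) (segment ℝ P Q)) {y z : ℝ}
    (hy : A 1 ≤ y ∧ y ≤ B 1 ∧ P 1 ≤ y ∧ y ≤ Q 1) (hz : A 1 ≤ z ∧ z ≤ B 1 ∧ P 1 ≤ z ∧ z ≤ Q 1) :
    xAt P Q y < xAt A B y ↔ xAt P Q z < xAt A B z := by
  have key : ∀ y z : ℝ, (A 1 ≤ y ∧ y ≤ B 1 ∧ P 1 ≤ y ∧ y ≤ Q 1) →
      (A 1 ≤ z ∧ z ≤ B 1 ∧ P 1 ≤ z ∧ z ≤ Q 1) → xAt P Q y < xAt A B y →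
      xAt P Q z < xAt A B z := by
    intro y z hy hz h
    by_contra! h'
    have hc : ContinuousOn (fun t => xAt A B t - xAt P Q t) (Set.uIcc z y) :=
      ((continuous_xAt A B).sub (continuous_xAt P Q)).continuousOn
    have h0 : (0 : ℝ) ∈ Set.uIcc (xAt A B z - xAt P Q z) (xAt A B y - xAt P Q y) := by
      rw [Set.mem_uIcc]; left; constructor <;> linarith
    obtain ⟨t, ht, ht0⟩ := intermediate_value_uIcc hc h0
    have ht0 : xAt A B t = xAt P Q t := by simpa [sub_eq_zero] using ht0
    have hb : A 1 ≤ t ∧ t ≤ B 1 ∧ P 1 ≤ t ∧ t ≤ Q 1 := by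
      rw [Set.mem_uIcc] at ht
      rcases ht with ht | ht <;> refine ⟨?_, ?_, ?_, ?_⟩ <;> linarith [ht.1, ht.2, hy.1, hy.2.1,
        hy.2.2.1, hy.2.2.2, hz.1, hz.2.1, hz.2.2.1, hz.2.2.2]
    refine Set.disjoint_left.1 hd (xAt_mem_segment hAB hb.1 hb.2.1) ?_
    rw [ht0]
    exact xAt_mem_segment hPQ hb.2.2.1 hb.2.2.2
  exact ⟨key y z hy hz, key z y hz hy⟩

lemma cross_pos_iff_of_disjoint_horizontal {A B P Q : Plane} (hAB : A 1 < B 1) (hPQ : P 1 = Q 1)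
    (hd : Disjoint (segment ℝ A B) (segment ℝ P Q)) (h1 : A 1 ≤ P 1) (h2 : P 1 ≤ B 1) :
    P 0 < xAt A B (P 1) ↔ Q 0 < xAt A B (P 1) := by
  have h : xAt A B (P 1) ∉ Set.uIcc (P 0) (Q 0) := fun h =>
    Set.disjoint_left.1 hd (xAt_mem_segment hAB h1 h2) (horizontal_mem_segment hPQ h)
  rw [Set.mem_uIcc] at h
  push Not at h
  constructor
  · intro h3; exact h.1 h3.le
  · intro h3; exact h.2 h3.le

lemma rayCross_of_le {A B : Plane} (hAB : A 1 ≤ B 1) (Q : Plane) :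
    rayCross A B Q = if A 1 < Q 1 ∧ Q 1 ≤ B 1 ∧ 0 < cross A B Q then 1 else 0 := by
  unfold rayCross
  have : ¬ (B 1 < Q 1 ∧ Q 1 ≤ A 1 ∧ cross A B Q < 0) := fun h => by linarith [h.1, h.2.1]
  simp only [this, if_false]

lemma leftCross_of_le {P Q : Plane} (hPQ : P 1 ≤ Q 1) (R : Plane) :
    leftCross P Q R = if P 1 ≤ R 1 ∧ R 1 < Q 1 ∧ cross P Q R < 0 then 1 else 0 := by
  unfold leftCross
  have : ¬ (Q 1 ≤ R 1 ∧ R 1 < P 1 ∧ 0 < cross P Q R) := fun h => by linarith [h.1, h.2.1]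
  simp only [this, if_false]

lemma cross_pos_iff {A B : Plane} (hAB : A 1 < B 1) (Q : Plane) :
    0 < cross A B Q ↔ Q 0 < xAt A B (Q 1) := by
  rw [cross_eq_xAt hAB.ne, mul_pos_iff_of_pos_left (by linarith), sub_pos]

lemma cross_neg_iff {A B : Plane} (hAB : A 1 < B 1) (Q : Plane) :
    cross A B Q < 0 ↔ xAt A B (Q 1) < Q 0 := by
  rw [cross_eq_xAt hAB.ne, ← neg_pos, ← mul_neg, mul_pos_iff_of_pos_left (by linarith), neg_sub,
    sub_pos]

/-- Where `f` holds on the overlap of `[a, b]` and `[p, q]`, the conditions `a < p ≤ b` and `p ≤ a <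
q` say that its lower end is `p` or `a`, while `p ≤ b < q` and `a < q ≤ b` say that its upper end is
`b` or `q`. Either pair holds for exactly one member when `p ≤ b` and `a < q`, and for none
otherwise. The two half-open conventions are complementary, so coinciding end points need no
exception. -/
lemma ite_sub_ite_overlap {a b p q : ℝ} (hab : a < b) (hpq : p < q) (f : ℝ → Prop)
    [DecidablePred f]
    (h : ∀ y z, (a ≤ y ∧ y ≤ b ∧ p ≤ y ∧ y ≤ q) → (a ≤ z ∧ z ≤ b ∧ p ≤ z ∧ z ≤ q) → (f y ↔ f z)) :
    (if a < p ∧ p ≤ b ∧ f p then (1 : ℤ) else 0) - (if a < q ∧ q ≤ b ∧ f q then 1 else 0) =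
    (if p ≤ b ∧ b < q ∧ f b then 1 else 0) - (if p ≤ a ∧ a < q ∧ f a then 1 else 0) := by
  rcases lt_or_ge b p with e3 | e3
  · simp [e3.not_ge, (e3.trans hpq).not_ge, (hab.trans e3).not_ge]
  rcases lt_or_ge a q with e4 | e4
  swap
  · simp [e4.not_gt, (hpq.trans_le e4).not_gt, (e4.trans_lt hab).not_gt]
  rcases lt_or_ge a p with e1 | e1 <;> rcases lt_or_ge b q with e2 | e2
  · have := h p b ⟨e1.le, e3, le_rfl, hpq.le⟩ ⟨hab.le, le_rfl, e3, e2.le⟩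
    simp [e1, e2, e3, e1.not_ge, e2.not_ge, this]
  · have := h p q ⟨e1.le, e3, le_rfl, hpq.le⟩ ⟨e4.le, e2, hpq.le, le_rfl⟩
    simp [e1, e2, e3, e4, e1.not_ge, e2.not_gt, this]
  · have := h a b ⟨le_rfl, hab.le, e1, e4.le⟩ ⟨hab.le, le_rfl, e3, e2.le⟩
    simp [e1, e2, e3, e4, e1.not_gt, e2.not_ge, this]
  · have := h a q ⟨le_rfl, hab.le, e1, e4.le⟩ ⟨e4.le, e2, hpq.le, le_rfl⟩
    simp [e1, e2, e4, e1.not_gt, e2.not_gt, this]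

/-- If both segments rise, every condition compares the abscissas of the two segments at a common
ordinate, and disjoint segments never change their order. A horizontal segment has no crossings of
its own and lies entirely on one side of the other segment. -/
lemma rayCross_sub_rayCross_aux {A B P Q : Plane} (hAB : A 1 ≤ B 1) (hPQ : P 1 ≤ Q 1)
    (hd : Disjoint (segment ℝ A B) (segment ℝ P Q)) :
    rayCross A B P - rayCross A B Q = leftCross P Q B - leftCross P Q A := by
  rw [rayCross_of_le hAB, rayCross_of_le hAB, leftCross_of_le hPQ, leftCross_of_le hPQ]
  rcases hAB.eq_or_lt with hAB | hAB <;> rcases hPQ.eq_or_lt with hPQ | hPQ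
  · rw [if_neg (fun h => by linarith [h.1, h.2.1]), if_neg (fun h => by linarith [h.1, h.2.1]),
      if_neg (fun h => by linarith [h.1, h.2.1]), if_neg (fun h => by linarith [h.1, h.2.1])]
  · rw [if_neg (fun h => by linarith [h.1, h.2.1]), if_neg (fun h => by linarith [h.1, h.2.1]),
      sub_self, eq_comm, sub_eq_zero]
    refine if_congr ?_ rfl rfl
    rw [cross_neg_iff hPQ, cross_neg_iff hPQ, ← hAB]
    refine and_congr_right fun h1 => and_congr_right fun h2 => ?_
    have hne : xAt P Q (A 1) ∉ Set.uIcc (A 0) (B 0) := fun h =>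
      Set.disjoint_left.1 hd (horizontal_mem_segment hAB h) (xAt_mem_segment hPQ h1 h2.le)
    rw [Set.mem_uIcc] at hne
    push Not at hne
    constructor
    · intro h3; by_contra! h4; exact absurd (hne.1 h4) (by linarith)
    · intro h3; by_contra! h4; exact absurd (hne.2 h4) (by linarith)
  · rw [if_neg (c := P 1 ≤ B 1 ∧ _) (fun h => by linarith [h.1, h.2.1]),
      if_neg (c := P 1 ≤ A 1 ∧ _) (fun h => by linarith [h.1, h.2.1]), sub_self, sub_eq_zero]
    refine if_congr ?_ rfl rfl
    rw [cross_pos_iff hAB, cross_pos_iff hAB, ← hPQ]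
    exact and_congr_right fun h1 => and_congr_right fun h2 =>
      cross_pos_iff_of_disjoint_horizontal hAB hPQ hd h1.le h2
  · have := ite_sub_ite_overlap hAB hPQ (fun y => xAt P Q y < xAt A B y)
      fun y z => xAt_lt_iff_of_disjoint hAB hPQ hd
    simp only [cross_pos_iff hAB, cross_neg_iff hPQ]
    simpa only [xAt_left, xAt_right hAB.ne, xAt_right hPQ.ne] using this

/-- Disjoint segments: the change of the crossing number along the second is the boundary term of
the first. -/
theorem rayCross_sub_rayCross {A B P Q : Plane}
    (hd : Disjoint (segment ℝ A B) (segment ℝ P Q)) :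
    rayCross A B P - rayCross A B Q = leftCross P Q B - leftCross P Q A := by
  rcases le_total (A 1) (B 1) with h1 | h1 <;> rcases le_total (P 1) (Q 1) with h2 | h2
  · exact rayCross_sub_rayCross_aux h1 h2 hd
  · have := rayCross_sub_rayCross_aux h1 h2 (by rwa [segment_symm ℝ Q P])
    rw [leftCross_swap P Q, leftCross_swap P Q] at this
    linarith
  · have := rayCross_sub_rayCross_aux h1 h2 (by rwa [segment_symm ℝ B A])
    rw [rayCross_swap A B, rayCross_swap A B] at this
    linarith
  · have := rayCross_sub_rayCross_aux h1 h2 (by rwa [segment_symm ℝ B A, segment_symm ℝ Q P])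
    rw [leftCross_swap P Q, leftCross_swap P Q, rayCross_swap A B, rayCross_swap A B] at this
    linarith

/-- Every term that depends on a vertex alone cancels around the closed line; all telescoping below
uses this. -/
lemma sum_succ_sub {n : ℕ} [NeZero n] {M : Type*} [AddCommGroup M] (f : Fin n → M) :
    ∑ i, (f (i + 1) - f i) = 0 := by
  rw [Finset.sum_sub_distrib, sub_eq_zero]
  exact Equiv.sum_comp (Equiv.addRight (1 : Fin n)) f

section
variable {n : ℕ} [NeZero n] {S : Fin n → Plane}

lemma segment_subset_boundary (S : Fin n → Plane) (i : Fin n) :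
    segment ℝ (S i) (S (i + 1)) ⊆ boundary S :=
  Set.subset_iUnion (fun i => segment ℝ (S i) (S (i + 1))) i

/-- The end terms of `rayCross_sub_rayCross` telescope around the polygon. -/
lemma winding_eq_of_segment {P Q : Plane} (h : segment ℝ P Q ⊆ (boundary S)ᶜ) :
    winding S P = winding S Q := by
  rw [← sub_eq_zero, winding, winding, ← Finset.sum_sub_distrib]
  refine (Finset.sum_congr rfl fun i _ => rayCross_sub_rayCross ?_).trans
    (sum_succ_sub fun i => leftCross P Q (S i))
  exact Set.disjoint_left.2 fun R hR hR' => h hR' (segment_subset_boundary S i hR)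

end

end PolygonDistance
end

/-! ### Local constancy of the winding number, and its value far away -/

noncomputable section
namespace PolygonDistance

section
variable {n : ℕ} [NeZero n] {S : Fin n → Plane}

lemma isCompact_segment (A B : Plane) : IsCompact (segment ℝ A B) := by
  rw [segment_eq_image']
  exact isCompact_Icc.image (by fun_prop)

lemma isCompact_boundary (S : Fin n → Plane) : IsCompact (boundary S) :=
  isCompact_iUnion fun _ => isCompact_segment _ _

lemma isOpen_boundary_compl (S : Fin n → Plane) : IsOpen (boundary S)ᶜ :=
  (isCompact_boundary S).isClosed.isOpen_compl

lemma continuousOn_winding (S : Fin n → Plane) : ContinuousOn (winding S) (boundary S)ᶜ := by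
  intro Q hQ
  obtain ⟨δ, hδ, hb⟩ := Metric.isOpen_iff.1 (isOpen_boundary_compl S) Q hQ
  refine ContinuousAt.continuousWithinAt ?_
  refine (continuousAt_const (y := winding S Q)).congr ?_
  filter_upwards [Metric.ball_mem_nhds Q hδ] with R hR
  exact winding_eq_of_segment (((convex_ball Q δ).segment_subset (Metric.mem_ball_self hδ) hR).trans
    hb)

lemma winding_eq_of_isPreconnected {s : Set Plane} (hs : IsPreconnected s)
    (h : s ⊆ (boundary S)ᶜ) {P Q : Plane} (hP : P ∈ s) (hQ : Q ∈ s) :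
    winding S P = winding S Q :=
  hs.constant ((continuousOn_winding S).mono h) hP hQ

lemma mem_connectedComponentIn_of_joinedIn {s : Set Plane} {P Q : Plane} (h : JoinedIn s P Q) :
    Q ∈ connectedComponentIn s P := by
  obtain ⟨γ, hγ⟩ := h
  have : IsPreconnected (Set.range γ) := isPreconnected_range γ.continuous
  exact this.subset_connectedComponentIn ⟨0, by simp⟩ (by rintro _ ⟨t, rfl⟩; exact hγ t)
    ⟨1, by simp⟩

lemma winding_eq_of_joinedIn {P Q : Plane} (h : JoinedIn (boundary S)ᶜ P Q) :
    winding S P = winding S Q :=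
  winding_eq_of_isPreconnected isPreconnected_connectedComponentIn
    (connectedComponentIn_subset _ P) (mem_connectedComponentIn h.source_mem)
    (mem_connectedComponentIn_of_joinedIn h)

/-- To the left of both end points the ray meets the segment whenever its level separates them. The
crossing number is then a difference of vertex terms, which telescopes in `winding_of_lt`. -/
lemma rayCross_of_lt {A B Q : Plane} (hA : Q 0 < A 0) (hB : Q 0 < B 0) :
    rayCross A B Q = (if A 1 < Q 1 then 1 else 0) - (if B 1 < Q 1 then 1 else 0) := by
  have e : cross A B Q = (A 0 - Q 0) * (B 1 - Q 1) + (Q 1 - A 1) * (B 0 - Q 0) := by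
    unfold cross; ring
  unfold rayCross
  rcases lt_or_ge (A 1) (Q 1) with h1 | h1 <;> rcases lt_or_ge (B 1) (Q 1) with h2 | h2
  · simp [h1, h2, h1.not_ge, h2.not_ge]
  · have : 0 < cross A B Q := by
      rw [e]
      have := mul_pos (sub_pos.2 h1) (sub_pos.2 hB)
      have := mul_nonneg (sub_pos.2 hA).le (sub_nonneg.2 h2)
      linarith
    simp [h1, h2, h2.not_gt, this]
  · have : cross A B Q < 0 := by
      rw [e]
      have := mul_pos (sub_pos.2 h2) (sub_pos.2 hA)
      have := mul_nonneg (sub_pos.2 hB).le (sub_nonneg.2 h1)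
      linarith
    simp [h1, h2, h1.not_gt, this]
  · simp [h1.not_gt, h2.not_gt]

lemma rayCross_of_ge {A B Q : Plane} (hA : A 0 ≤ Q 0) (hB : B 0 ≤ Q 0) :
    rayCross A B Q = 0 := by
  have e : cross A B Q = -((Q 0 - A 0) * (B 1 - Q 1) + (Q 1 - A 1) * (Q 0 - B 0)) := by
    unfold cross; ring
  unfold rayCross
  rw [if_neg, if_neg]
  · rintro ⟨h1, h2, h3⟩
    rw [e] at h3
    have := mul_nonneg (sub_nonneg.2 hB) (sub_nonneg.2 h2)
    have := mul_nonneg (sub_nonneg.2 hA) (sub_nonneg.2 h1.le)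
    linarith
  · rintro ⟨h1, h2, h3⟩
    rw [e] at h3
    have := mul_nonneg (sub_nonneg.2 hA) (sub_nonneg.2 h2)
    have := mul_nonneg (sub_nonneg.2 hB) (sub_nonneg.2 h1.le)
    linarith

lemma rayCross_of_level {A B Q : Plane}
    (h : (A 1 < Q 1 ∧ B 1 < Q 1) ∨ (Q 1 ≤ A 1 ∧ Q 1 ≤ B 1)) : rayCross A B Q = 0 := by
  unfold rayCross
  rw [if_neg, if_neg]
  · rintro ⟨h1, h2, -⟩; rcases h with h | h <;> linarith [h.1, h.2]
  · rintro ⟨h1, h2, -⟩; rcases h with h | h <;> linarith [h.1, h.2]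

lemma winding_of_lt {Q : Plane} (h : ∀ i, Q 0 < S i 0) : winding S Q = 0 := by
  rw [winding, ← neg_inj, neg_zero, ← sum_succ_sub fun i => if S i 1 < Q 1 then (1 : ℤ) else 0,
    ← Finset.sum_neg_distrib]
  exact Finset.sum_congr rfl fun i _ => by rw [rayCross_of_lt (h _) (h _)]; ring

lemma exists_winding_eq_zero (S : Fin n → Plane) :
    ∃ M : ℝ, ∀ Q : Plane, M < ‖Q‖ → Q ∉ boundary S ∧ winding S Q = 0 := by
  obtain ⟨M, hM⟩ := (isCompact_boundary S).isBounded.exists_norm_le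
  have hSi : ∀ i, ‖S i‖ ≤ M := fun i =>
    hM _ (segment_subset_boundary S i (left_mem_segment ℝ _ _))
  have h0 : ∀ i k, |S i k| ≤ M := fun i k => (PiLp.norm_apply_le (S i) k).trans (hSi i)
  have hM0 : 0 ≤ M := (norm_nonneg _).trans (hSi 0)
  -- Beyond norm `2 * M` some coordinate exceeds `M` in absolute value, so that `Q` is to the left
  -- of, to the right of, above or below all vertices.
  refine ⟨2 * M, fun Q hQ => ⟨fun h => by linarith [hM Q h], ?_⟩⟩
  have hQ2 : M < |Q 0| ∨ M < |Q 1| := by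
    by_contra! h
    have : ‖Q‖ ^ 2 ≤ (2 * M) ^ 2 := by
      rw [EuclideanSpace.norm_sq_eq, Fin.sum_univ_two, Real.norm_eq_abs, Real.norm_eq_abs]
      nlinarith [h.1, h.2, abs_nonneg (Q 0), abs_nonneg (Q 1)]
    nlinarith [norm_nonneg Q]
  have hb : ∀ i k, -M ≤ S i k ∧ S i k ≤ M := fun i k => abs_le.1 (h0 i k)
  rcases hQ2 with h | h
  · rcases lt_abs.1 h with h | h
    · exact Finset.sum_eq_zero fun i _ =>
        rayCross_of_ge ((hb i 0).2.trans h.le) ((hb (i + 1) 0).2.trans h.le)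
    · exact winding_of_lt fun i => by linarith [(hb i 0).1]
  · refine Finset.sum_eq_zero fun i _ => rayCross_of_level ?_
    rcases lt_abs.1 h with h | h
    · left; constructor <;> linarith [(hb i 1).2, (hb (i + 1) 1).2]
    · right; constructor <;> linarith [(hb i 1).1, (hb (i + 1) 1).1]

end

/-! ### The two sides of a simple polygonal line -/

section
variable {n : ℕ} [NeZero n] {S : Fin n → Plane}

lemma fin_add_one_ne (hn : 3 ≤ n) (i : Fin n) : i + 1 ≠ i := by
  intro h
  have h : 1 % n = 0 := congrArg Fin.val (add_eq_left.1 h)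
  rw [Nat.mod_eq_of_lt (by omega)] at h
  omega

lemma fin_add_two_ne (hn : 3 ≤ n) (i : Fin n) : i + 1 + 1 ≠ i := by
  intro h
  rw [add_assoc] at h
  have h : (1 % n + 1 % n) % n = 0 := congrArg Fin.val (add_eq_left.1 h)
  rw [Nat.mod_eq_of_lt (show 1 < n by omega), Nat.mod_eq_of_lt (by omega)] at h
  omega

lemma IsSimplePolygon.ne_succ (hS : IsSimplePolygon S) (i : Fin n) : S i ≠ S (i + 1) :=
  fun h => fin_add_one_ne hS.three_le i (hS.injective h).symm

lemma IsSimplePolygon.ne_succ_succ (hS : IsSimplePolygon S) (i : Fin n) : S i ≠ S (i + 1 + 1) :=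
  fun h => fin_add_two_ne hS.three_le i (hS.injective h).symm

lemma IsSimplePolygon.notMem_segment (hS : IsSimplePolygon S) {i j : Fin n} (hij : j ≠ i)
    {Q : Plane} (hQ : Q ∈ openSegment ℝ (S i) (S (i + 1))) : Q ∉ segment ℝ (S j) (S (j + 1)) := by
  intro h
  have := (hS.inter_subset i j hij.symm ⟨openSegment_subset_segment ℝ _ _ hQ, h⟩).1
  rcases this with rfl | rfl
  · exact hS.ne_succ i (left_mem_openSegment_iff.1 hQ)
  · exact hS.ne_succ i (right_mem_openSegment_iff.1 hQ)

lemma cross_of_mem_segment {A B C D Q : Plane} {t : ℝ} (h0 : Q 0 = A 0 + t * (B 0 - A 0))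
    (h1 : Q 1 = A 1 + t * (B 1 - A 1)) :
    cross C D Q = (1 - t) * cross C D A + t * cross C D B := by
  unfold cross; rw [h0, h1]; ring

lemma cross_self_left (A B : Plane) : cross A B A = 0 := by unfold cross; ring

lemma cross_self_right (A B : Plane) : cross A B B = 0 := by unfold cross; ring

lemma cross_eq_zero_of_mem_segment {A B Q : Plane} (h : Q ∈ segment ℝ A B) : cross A B Q = 0 := by
  obtain ⟨t, -, -, h0, h1⟩ := mem_segment_iff_exists.1 h
  rw [cross_of_mem_segment h0 h1, cross_self_left, cross_self_right]; ring

lemma continuous_cross (A B : Plane) : Continuous (cross A B) := by unfold cross; fun_prop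

/-- A half-plane bounded by the line `AB`. -/
lemma convex_side (A B : Plane) (ε : ℝ) : Convex ℝ {Q | 0 < ε * cross A B Q} := by
  intro P hP Q hQ a b ha hb hab
  have : cross A B (a • P + b • Q) = a * cross A B P + b * cross A B Q := by
    unfold cross
    simp only [PiLp.add_apply, PiLp.smul_apply, smul_eq_mul]
    have : b = 1 - a := by linarith
    subst this; ring
  simp only [Set.mem_ofPred_eq] at *
  rw [this]
  rcases ha.eq_or_lt with rfl | ha
  · have : b = 1 := by linarith
    simpa [this] using hQ
  · have := mul_pos ha hP
    have := mul_nonneg hb hQ.le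
    nlinarith

/-- The other edges form a closed set that misses the open edge, hence keeps a positive distance
from each compact part of it. -/
lemma exists_thickening_disjoint (hS : IsSimplePolygon S) (i : Fin n) {K : Set Plane}
    (hK : IsCompact K) (hKi : K ⊆ openSegment ℝ (S i) (S (i + 1))) :
    ∃ δ > 0, ∀ Q ∈ Metric.thickening δ K, ∀ j ≠ i, Q ∉ segment ℝ (S j) (S (j + 1)) := by
  have hc : IsClosed (⋃ j : {j // j ≠ i}, segment ℝ (S j) (S (j + 1))) :=
    isClosed_iUnion_of_finite fun j => (isCompact_segment _ _).isClosed
  obtain ⟨δ, hδ, h⟩ := hK.exists_thickening_subset_open hc.isOpen_compl (fun Q hQ hQ' => by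
    obtain ⟨⟨j, hj⟩, hQ'⟩ := Set.mem_iUnion.1 hQ'
    exact hS.notMem_segment hj (hKi hQ) hQ')
  exact ⟨δ, hδ, fun Q hQ j hj hQ' => h hQ (Set.mem_iUnion.2 ⟨⟨j, hj⟩, hQ'⟩)⟩

lemma exists_ball_vertex (hS : IsSimplePolygon S) (i : Fin n) :
    ∃ ρ > 0, ∀ Q ∈ Metric.ball (S (i + 1)) ρ, Q ∈ boundary S →
      Q ∈ segment ℝ (S i) (S (i + 1)) ∨ Q ∈ segment ℝ (S (i + 1)) (S (i + 1 + 1)) := by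
  have hc : IsClosed (⋃ j : {j // j ≠ i ∧ j ≠ i + 1}, segment ℝ (S j) (S (j + 1))) :=
    isClosed_iUnion_of_finite fun j => (isCompact_segment _ _).isClosed
  have hm : S (i + 1) ∈ (⋃ j : {j // j ≠ i ∧ j ≠ i + 1}, segment ℝ (S j) (S (j + 1)))ᶜ := by
    intro h
    obtain ⟨⟨j, hj, hj'⟩, h⟩ := Set.mem_iUnion.1 h
    rcases (hS.inter_subset i j hj.symm ⟨right_mem_segment ℝ _ _, h⟩).2 with h | h
    · exact hj' (hS.injective h).symm
    · exact hj (add_right_cancel (hS.injective h)).symm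
  obtain ⟨ρ, hρ, h⟩ := Metric.isOpen_iff.1 hc.isOpen_compl _ hm
  refine ⟨ρ, hρ, fun Q hQ hQ' => ?_⟩
  obtain ⟨j, hj⟩ := Set.mem_iUnion.1 hQ'
  by_contra! hh
  refine h hQ (Set.mem_iUnion.2 ⟨⟨j, ?_, ?_⟩, hj⟩)
  · rintro rfl; exact hh.1 hj
  · rintro rfl; exact hh.2 hj

/-- `z` can be joined, off the boundary, to all points close to the edge `i` on the side `ε`. -/
def IsSide (S : Fin n → Plane) (ε : ℝ) (i : Fin n) (z : Plane) : Prop :=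
  ∀ M ∈ openSegment ℝ (S i) (S (i + 1)), ∃ δ > 0, ∀ Q ∈ Metric.ball M δ,
    0 < ε * cross (S i) (S (i + 1)) Q → JoinedIn (boundary S)ᶜ z Q

lemma notMem_boundary_of_side {ε : ℝ} {i : Fin n} {Q : Plane}
    (h : ∀ j ≠ i, Q ∉ segment ℝ (S j) (S (j + 1))) (hQ : 0 < ε * cross (S i) (S (i + 1)) Q) :
    Q ∈ (boundary S)ᶜ := by
  intro hb
  obtain ⟨j, hj⟩ := Set.mem_iUnion.1 hb
  by_cases hji : j = i
  · subst hji
    rw [cross_eq_zero_of_mem_segment hj] at hQ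
    simp at hQ
  · exact h j hji hj

/-- Access to a side at one point `M` spreads along the whole open edge: a thickening of the segment
from `M` to `M'`, cut off by the half-plane of that side, is convex and avoids the boundary. -/
lemma isSide_of_frequently (hS : IsSimplePolygon S) {ε : ℝ} {i : Fin n} {z M : Plane}
    (hM : M ∈ openSegment ℝ (S i) (S (i + 1)))
    (h : ∀ δ > 0, ∃ Q ∈ Metric.ball M δ, 0 < ε * cross (S i) (S (i + 1)) Q ∧
      JoinedIn (boundary S)ᶜ z Q) : IsSide S ε i z := by
  intro M' hM'
  obtain ⟨δ, hδ, hd⟩ := exists_thickening_disjoint hS i (isCompact_segment M M')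
    ((convex_openSegment _ _).segment_subset hM hM')
  obtain ⟨Q, hQ, hQ1, hQ2⟩ := h δ hδ
  refine ⟨δ, hδ, fun R hR hR1 => hQ2.trans (JoinedIn.of_segment_subset ?_)⟩
  have hc : Convex ℝ (Metric.thickening δ (segment ℝ M M') ∩
      {Q | 0 < ε * cross (S i) (S (i + 1)) Q}) :=
    ((convex_segment M M').thickening δ).inter (convex_side _ _ _)
  have hQ3 : Q ∈ Metric.thickening δ (segment ℝ M M') :=
    Metric.mem_thickening_iff.2 ⟨M, left_mem_segment ℝ _ _, hQ⟩
  have hR3 : R ∈ Metric.thickening δ (segment ℝ M M') :=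
    Metric.mem_thickening_iff.2 ⟨M', right_mem_segment ℝ _ _, hR⟩
  exact (hc.segment_subset ⟨hQ3, hQ1⟩ ⟨hR3, hR1⟩).trans fun T hT =>
    notMem_boundary_of_side (hd T hT.1) hT.2

lemma cross_add_smul_leftNormal (A B M : Plane) (τ : ℝ) :
    cross A B (M + τ • leftNormal (B - A)) =
      cross A B M + τ * ((B 0 - A 0) ^ 2 + (B 1 - A 1) ^ 2) := by
  simp [cross, leftNormal]; ring

lemma sq_add_sq_pos_of_ne {A B : Plane} (h : A ≠ B) :
    0 < (B 0 - A 0) ^ 2 + (B 1 - A 1) ^ 2 := by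
  by_contra! h'
  have h0 : B 0 - A 0 = 0 := by nlinarith [sq_nonneg (B 0 - A 0), sq_nonneg (B 1 - A 1)]
  have h1 : B 1 - A 1 = 0 := by nlinarith [sq_nonneg (B 0 - A 0), sq_nonneg (B 1 - A 1)]
  exact h (plane_ext (by linarith) (by linarith))

/-- Close to a point of the line `AB` there are points on both sides. -/
lemma exists_mem_side {A B M : Plane} (h : A ≠ B) (hM : cross A B M = 0) {ε : ℝ} (hε : ε ≠ 0)
    {U : Set Plane} (hU : U ∈ 𝓝 M) : ∃ Q ∈ U, 0 < ε * cross A B Q := by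
  have hc : ContinuousAt (fun τ : ℝ => M + (τ * ε) • leftNormal (B - A)) 0 := by fun_prop
  have h1 : ∀ᶠ τ in 𝓝[>] (0 : ℝ), M + (τ * ε) • leftNormal (B - A) ∈ U :=
    nhdsWithin_le_nhds (hc (by simpa using hU))
  obtain ⟨τ, hτ, hτ0⟩ := (h1.and self_mem_nhdsWithin).exists
  refine ⟨_, hτ, ?_⟩
  rw [cross_add_smul_leftNormal, hM]
  have := sq_add_sq_pos_of_ne h
  have h2 : (0 : ℝ) < τ := hτ0
  have := mul_pos (mul_pos h2 (mul_self_pos.2 hε)) this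
  linarith

lemma exists_isSide (hS : IsSimplePolygon S) {ε : ℝ} (hε : ε ≠ 0) (i : Fin n) :
    ∃ z, IsSide S ε i z := by
  have hM := midpoint_mem_openSegment (𝕜 := ℝ) (S i) (S (i + 1))
  set M := midpoint ℝ (S i) (S (i + 1))
  obtain ⟨δ, hδ, hd⟩ := exists_thickening_disjoint hS i (isCompact_singleton (x := M))
    (Set.singleton_subset_iff.2 hM)
  rw [Metric.thickening_singleton] at hd
  have hM0 := cross_eq_zero_of_mem_segment (openSegment_subset_segment ℝ _ _ hM)
  obtain ⟨z, hz, hz0⟩ := exists_mem_side (hS.ne_succ i) hM0 hε (Metric.ball_mem_nhds M hδ)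
  refine ⟨z, isSide_of_frequently hS hM fun δ' hδ' => ?_⟩
  obtain ⟨Q, hQ, hQ0⟩ := exists_mem_side (hS.ne_succ i) hM0 hε
    (Filter.inter_mem (Metric.ball_mem_nhds M hδ) (Metric.ball_mem_nhds M hδ'))
  refine ⟨Q, hQ.2, hQ0, JoinedIn.of_segment_subset ?_⟩
  exact (((convex_ball M δ).inter (convex_side (S i) (S (i + 1)) ε)).segment_subset ⟨hz, hz0⟩
    ⟨hQ.1, hQ0⟩).trans fun T hT => notMem_boundary_of_side (hd T hT.1) hT.2

lemma cross_rotate (A B C : Plane) : cross B C A = cross A B C := by unfold cross; ring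

/-- At a straight angle the next edge continues in the same direction. -/
lemma IsSimplePolygon.exists_pos_of_cross_eq_zero (hS : IsSimplePolygon S) (i : Fin n)
    (h : cross (S i) (S (i + 1)) (S (i + 1 + 1)) = 0) :
    ∃ k > 0, ∀ Q, cross (S (i + 1)) (S (i + 1 + 1)) Q = k * cross (S i) (S (i + 1)) Q := by
  set A := S i with hA
  set B := S (i + 1) with hB
  set C := S (i + 1 + 1) with hC
  have hAB : A ≠ B := hS.ne_succ i
  have hBC : B ≠ C := hS.ne_succ (i + 1)
  have hAC : A ≠ C := hS.ne_succ_succ i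
  have hp := sq_add_sq_pos_of_ne hAB
  set D := (B 0 - A 0) ^ 2 + (B 1 - A 1) ^ 2 with hD
  set k := ((C 0 - B 0) * (B 0 - A 0) + (C 1 - B 1) * (B 1 - A 1)) / D with hk
  have hkD : k * D = (C 0 - B 0) * (B 0 - A 0) + (C 1 - B 1) * (B 1 - A 1) := by
    rw [hk]; field_simp
  have e : (B 0 - A 0) * (C 1 - B 1) = (B 1 - A 1) * (C 0 - B 0) := by
    unfold cross at h; linarith
  have h0 : C 0 - B 0 = k * (B 0 - A 0) := by
    apply mul_right_cancel₀ hp.ne'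
    rw [mul_right_comm, hkD, hD]
    linear_combination (-(B 1 - A 1)) * e
  have h1 : C 1 - B 1 = k * (B 1 - A 1) := by
    apply mul_right_cancel₀ hp.ne'
    rw [mul_right_comm, hkD, hD]
    linear_combination (B 0 - A 0) * e
  refine ⟨k, ?_, fun Q => ?_⟩
  -- For `k ≤ 0` the next edge would fold back onto this one: then `C` lies on `AB` or `A` lies on
  -- `BC`, against simplicity.
  · by_contra! hk0
    have hne : i ≠ i + 1 := (fin_add_one_ne hS.three_le i).symm
    have hint := hS.inter_subset i (i + 1) hne
    rw [← hA, ← hB, ← hC] at hint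
    rcases le_or_gt (-1) k with hk1 | hk1
    · have hm : C ∈ segment ℝ A B := mem_segment_iff_exists.2
        ⟨1 + k, by linarith, by linarith, by linear_combination h0, by linear_combination h1⟩
      rcases (hint ⟨hm, right_mem_segment ℝ _ _⟩).1 with h | h
      · exact hAC h.symm
      · exact hBC h.symm
    · have hk2 : k ≠ 0 := by linarith
      have hm : A ∈ segment ℝ B C := mem_segment_iff_exists.2
        ⟨-k⁻¹, by rw [neg_nonneg, inv_nonpos]; exact hk0,
          by rw [neg_le, ← one_div, le_div_iff_of_neg (by linarith)]; linarith,
          by rw [h0]; field_simp; ring, by rw [h1]; field_simp; ring⟩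
      rcases (hint ⟨left_mem_segment ℝ _ _, hm⟩).2 with h | h
      · exact hAB h
      · exact hAC h
  · unfold cross
    linear_combination (-(Q 0 - B 0)) * h1 + (Q 1 - B 1) * h0

lemma exists_mem_openSegment_ball {A B : Plane} {ρ : ℝ} (hρ : 0 < ρ) :
    ∃ M ∈ openSegment ℝ A B, M ∈ Metric.ball B ρ := by
  have hc : ContinuousAt (fun τ : ℝ => B + τ • (A - B)) 0 := by fun_prop
  have h1 : ∀ᶠ τ in 𝓝[>] (0 : ℝ), B + τ • (A - B) ∈ Metric.ball B ρ :=
    nhdsWithin_le_nhds (hc (by simpa using Metric.ball_mem_nhds B hρ))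
  obtain ⟨τ, hτ, hτ0⟩ := (h1.and (Ioo_mem_nhdsGT (zero_lt_one' ℝ))).exists
  refine ⟨_, ?_, hτ⟩
  rw [openSegment_symm, openSegment_eq_image']
  exact ⟨τ, hτ0, rfl⟩

/-- The path turns around the vertex inside a ball that meets only the two adjacent edges. If the
angle on the side `ε` is convex, its sector is the intersection of two half-planes and a segment
suffices; otherwise it is their union, and the path changes from one half-plane to the other at a
common point. -/
lemma IsSide.succ (hS : IsSimplePolygon S) {ε : ℝ} (hε : ε ≠ 0) {i : Fin n} {z : Plane}
    (h : IsSide S ε i z) : IsSide S ε (i + 1) z := by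
  obtain ⟨ρ, hρ, hb⟩ := exists_ball_vertex hS i
  obtain ⟨M₁, hM₁, hM₁b⟩ := exists_mem_openSegment_ball (A := S i) (B := S (i + 1)) hρ
  obtain ⟨M₂, hM₂, hM₂b⟩ := exists_mem_openSegment_ball (A := S (i + 1 + 1)) (B := S (i + 1)) hρ
  rw [openSegment_symm] at hM₂
  refine isSide_of_frequently hS hM₂ fun δ hδ => ?_
  obtain ⟨δ₁, hδ₁, h₁⟩ := h M₁ hM₁
  have hAB := hS.ne_succ i
  have hBC := hS.ne_succ (i + 1)
  have hz := fun k => hS.exists_pos_of_cross_eq_zero i k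
  set A := S i
  set B := S (i + 1)
  set C := S (i + 1 + 1)
  have hM₁0 := cross_eq_zero_of_mem_segment (openSegment_subset_segment ℝ _ _ hM₁)
  have hM₂0 := cross_eq_zero_of_mem_segment (openSegment_subset_segment ℝ _ _ hM₂)
  have hU₁ : Metric.ball M₁ δ₁ ∩ Metric.ball B ρ ∈ 𝓝 M₁ :=
    Filter.inter_mem (Metric.ball_mem_nhds _ hδ₁) (Metric.isOpen_ball.mem_nhds hM₁b)
  have hU₂ : Metric.ball M₂ δ ∩ Metric.ball B ρ ∈ 𝓝 M₂ :=
    Filter.inter_mem (Metric.ball_mem_nhds _ hδ) (Metric.isOpen_ball.mem_nhds hM₂b)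
  -- the values of the two determinants on the two edges
  have on₁ : ∀ Q ∈ segment ℝ A B, cross A B Q = 0 ∧ ∃ t : ℝ, 0 ≤ t ∧
      cross B C Q = t * cross A B C := fun Q hQ => by
    refine ⟨cross_eq_zero_of_mem_segment hQ, ?_⟩
    obtain ⟨t, h0, h1, hx, hy⟩ := mem_segment_iff_exists.1 hQ
    exact ⟨1 - t, by linarith, by
      rw [cross_of_mem_segment hx hy, cross_self_left, cross_rotate]; ring⟩
  have on₂ : ∀ Q ∈ segment ℝ B C, cross B C Q = 0 ∧ ∃ t : ℝ, 0 ≤ t ∧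
      cross A B Q = t * cross A B C := fun Q hQ => by
    refine ⟨cross_eq_zero_of_mem_segment hQ, ?_⟩
    obtain ⟨t, h0, h1, hx, hy⟩ := mem_segment_iff_exists.1 hQ
    exact ⟨t, h0, by rw [cross_of_mem_segment hx hy, cross_self_right]; ring⟩
  rcases lt_or_ge 0 (ε * cross A B C) with hc | hc
  · have hM₁1 : 0 < ε * cross B C M₁ := by
      obtain ⟨t, h0, h1, hx, hy⟩ := mem_openSegment_iff_exists.1 hM₁
      rw [cross_of_mem_segment hx hy, cross_self_left, cross_rotate]
      nlinarith
    have hM₂1 : 0 < ε * cross A B M₂ := by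
      obtain ⟨t, h0, h1, hx, hy⟩ := mem_openSegment_iff_exists.1 hM₂
      rw [cross_of_mem_segment hx hy, cross_self_right]
      nlinarith
    obtain ⟨Q₁, ⟨hQ₁, hQ₁'⟩, hQ₁0⟩ := exists_mem_side hAB hM₁0 hε (Filter.inter_mem hU₁
      (((continuous_cross B C).const_mul ε).continuousAt (Ioi_mem_nhds hM₁1)))
    obtain ⟨Q₂, ⟨hQ₂, hQ₂'⟩, hQ₂0⟩ := exists_mem_side hBC hM₂0 hε (Filter.inter_mem hU₂
      (((continuous_cross A B).const_mul ε).continuousAt (Ioi_mem_nhds hM₂1)))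
    refine ⟨Q₂, hQ₂.1, hQ₂0, (h₁ Q₁ hQ₁.1 hQ₁0).trans (JoinedIn.of_segment_subset ?_)⟩
    refine ((((convex_ball B ρ).inter (convex_side A B ε)).inter
      (convex_side B C ε)).segment_subset ⟨⟨hQ₁.2, hQ₁0⟩, hQ₁'⟩ ⟨⟨hQ₂.2, hQ₂'⟩, hQ₂0⟩).trans ?_
    rintro T ⟨⟨hT, hT1⟩, hT2⟩ hTb
    rcases hb T hT hTb with hh | hh
    · rw [Set.mem_ofPred_eq, (on₁ T hh).1] at hT1; simp at hT1
    · rw [Set.mem_ofPred_eq, (on₂ T hh).1] at hT2; simp at hT2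
  -- At a straight or reflex angle each half-plane by itself avoids both edges near `B`: on the
  -- other edge its determinant is a nonnegative multiple of `cross A B C`, which has the wrong
  -- sign.
  · have j₁ : ∀ P ∈ Metric.ball B ρ, ∀ Q ∈ Metric.ball B ρ, 0 < ε * cross A B P →
        0 < ε * cross A B Q → JoinedIn (boundary S)ᶜ P Q := by
      intro P hP Q hQ hP0 hQ0
      refine JoinedIn.of_segment_subset ((((convex_ball B ρ).inter
        (convex_side A B ε)).segment_subset ⟨hP, hP0⟩ ⟨hQ, hQ0⟩).trans ?_)
      rintro T ⟨hT, hT1⟩ hTb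
      rw [Set.mem_ofPred_eq] at hT1
      rcases hb T hT hTb with hh | hh
      · rw [(on₁ T hh).1] at hT1; simp at hT1
      · obtain ⟨t, ht, e⟩ := (on₂ T hh).2
        rw [e] at hT1; nlinarith
    have j₂ : ∀ P ∈ Metric.ball B ρ, ∀ Q ∈ Metric.ball B ρ, 0 < ε * cross B C P →
        0 < ε * cross B C Q → JoinedIn (boundary S)ᶜ P Q := by
      intro P hP Q hQ hP0 hQ0
      refine JoinedIn.of_segment_subset ((((convex_ball B ρ).inter
        (convex_side B C ε)).segment_subset ⟨hP, hP0⟩ ⟨hQ, hQ0⟩).trans ?_)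
      rintro T ⟨hT, hT1⟩ hTb
      rw [Set.mem_ofPred_eq] at hT1
      rcases hb T hT hTb with hh | hh
      · obtain ⟨t, ht, e⟩ := (on₁ T hh).2
        rw [e] at hT1; nlinarith
      · rw [(on₂ T hh).1] at hT1; simp at hT1
    obtain ⟨Q₁, hQ₁, hQ₁0⟩ := exists_mem_side hAB hM₁0 hε hU₁
    obtain ⟨Q₂, hQ₂, hQ₂0⟩ := exists_mem_side hBC hM₂0 hε hU₂
    -- A common point of both half-planes. At a straight angle they coincide; at a reflex angle one
    -- steps from `B` against the sum of the two edge vectors that issue from `B`.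
    have hQ₀ : ∃ Q₀ ∈ Metric.ball B ρ, 0 < ε * cross A B Q₀ ∧ 0 < ε * cross B C Q₀ := by
      rcases hc.eq_or_lt with hc | hc
      · obtain ⟨k, hk, e⟩ := hz ((mul_eq_zero.1 hc).resolve_left hε)
        refine ⟨Q₁, hQ₁.2, hQ₁0, ?_⟩
        rw [e]
        have := mul_pos hk hQ₁0
        linarith
      · have hcont : ContinuousAt (fun τ : ℝ => B - τ • ((A - B) + (C - B))) 0 := by fun_prop
        have h1 : ∀ᶠ τ in 𝓝[>] (0 : ℝ), B - τ • ((A - B) + (C - B)) ∈ Metric.ball B ρ :=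
          nhdsWithin_le_nhds (hcont (by simpa using Metric.ball_mem_nhds B hρ))
        obtain ⟨τ, hτ, hτ0⟩ := (h1.and self_mem_nhdsWithin).exists
        have hτ0 : 0 < τ := hτ0
        refine ⟨_, hτ, ?_, ?_⟩
        · have : cross A B (B - τ • ((A - B) + (C - B))) = -τ * cross A B C := by
            simp [cross]; ring
          rw [this]; nlinarith
        · have : cross B C (B - τ • ((A - B) + (C - B))) = -τ * cross A B C := by
            simp [cross]; ring
          rw [this]; nlinarith
    obtain ⟨Q₀, hQ₀, h01, h02⟩ := hQ₀
    exact ⟨Q₂, hQ₂.1, hQ₂0, (h₁ Q₁ hQ₁.1 hQ₁0).trans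
      ((j₁ Q₁ hQ₁.2 Q₀ hQ₀ hQ₁0 h01).trans (j₂ Q₀ hQ₀ Q₂ hQ₂.2 h02 hQ₂0))⟩

lemma IsSide.all (hS : IsSimplePolygon S) {ε : ℝ} (hε : ε ≠ 0) {z : Plane}
    (h : IsSide S ε 0 z) (i : Fin n) : IsSide S ε i z := by
  have : ∀ k : ℕ, IsSide S ε (Fin.ofNat n k) z := by
    intro k
    induction k with
    | zero => exact h
    | succ k ih =>
      have e : Fin.ofNat n (k + 1) = Fin.ofNat n k + 1 := by
        apply Fin.ext
        change (k + 1) % n = (k % n + 1 % n) % n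
        exact Nat.add_mod _ _ _
      rw [e]; exact ih.succ hS hε
  have e : Fin.ofNat n i = i := Fin.ext (Nat.mod_eq_of_lt i.2)
  rw [← e]; exact this i

end

end PolygonDistance
end

/-! ### The Jordan curve theorem for polygons -/

noncomputable section
namespace PolygonDistance

section
variable {n : ℕ} [NeZero n] {S : Fin n → Plane}

/-- Points of the line `AB` close to an interior point of the segment lie on the segment. -/
lemma eventually_mem_segment_of_cross {A B M : Plane} (h : A ≠ B) (hM : M ∈ openSegment ℝ A B) :
    ∀ᶠ Q in 𝓝 M, cross A B Q = 0 → Q ∈ segment ℝ A B := by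
  obtain ⟨t, h0, h1, hx, hy⟩ := mem_openSegment_iff_exists.1 hM
  have hp := sq_add_sq_pos_of_ne h
  set D := (B 0 - A 0) ^ 2 + (B 1 - A 1) ^ 2 with hD
  let f : Plane → ℝ := fun Q => ((Q 0 - A 0) * (B 0 - A 0) + (Q 1 - A 1) * (B 1 - A 1)) / D
  have hf : Continuous f := by unfold f; fun_prop
  have hfM : f M = t := by
    simp only [f, hx, hy]
    rw [div_eq_iff hp.ne', hD]; ring
  have : ∀ᶠ Q in 𝓝 M, f Q ∈ Set.Ioo 0 1 :=
    hf.continuousAt (by rw [hfM]; exact Ioo_mem_nhds h0 h1)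
  filter_upwards [this] with Q hQ hc
  have hfD : f Q * D = (Q 0 - A 0) * (B 0 - A 0) + (Q 1 - A 1) * (B 1 - A 1) := by
    simp only [f]; field_simp
  unfold cross at hc
  refine mem_segment_iff_exists.2 ⟨f Q, hQ.1.le, hQ.2.le, ?_, ?_⟩
  · apply mul_right_cancel₀ hp.ne'
    rw [add_mul, mul_right_comm, hfD, hD]
    linear_combination (-(B 1 - A 1)) * hc
  · apply mul_right_cancel₀ hp.ne'
    rw [add_mul, mul_right_comm, hfD, hD]
    linear_combination (B 0 - A 0) * hc

lemma joinedIn_of_mem_ball {Q : Plane} (hQ : Q ∉ boundary S) :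
    ∃ δ > 0, ∀ R ∈ Metric.ball Q δ, JoinedIn (boundary S)ᶜ Q R := by
  obtain ⟨δ, hδ, hb⟩ := Metric.isOpen_iff.1 (isOpen_boundary_compl S) Q hQ
  exact ⟨δ, hδ, fun R hR => JoinedIn.of_segment_subset
    (((convex_ball Q δ).segment_subset (Metric.mem_ball_self hδ) hR).trans hb)⟩

/-- Each point off the boundary can be joined to one of the two sides. -/
lemma joinedIn_or_joinedIn (hS : IsSimplePolygon S) {zL zR : Plane} (hL : IsSide S 1 0 zL)
    (hR : IsSide S (-1) 0 zR) {Q : Plane} (hQ : Q ∉ boundary S) :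
    JoinedIn (boundary S)ᶜ zL Q ∨ JoinedIn (boundary S)ᶜ zR Q := by
  by_contra hcon
  -- The points that reach neither side form an open set that is also closed relative to the plane
  -- without the vertices. The complement of finitely many points is connected and contains `zL`,
  -- which is not in `V`; so `V` would have to be empty.
  let V : Set Plane := {Q | Q ∉ boundary S ∧
    ¬ (JoinedIn (boundary S)ᶜ zL Q ∨ JoinedIn (boundary S)ᶜ zR Q)}
  have hVo : IsOpen V := by
    rw [Metric.isOpen_iff]
    rintro P ⟨hP, hP'⟩
    obtain ⟨δ, hδ, hj⟩ := joinedIn_of_mem_ball hP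
    refine ⟨δ, hδ, fun R hRb => ⟨(hj R hRb).target_mem, fun h => hP' ?_⟩⟩
    exact h.imp (fun h => h.trans (hj R hRb).symm) (fun h => h.trans (hj R hRb).symm)
  have hrank : 1 < Module.rank ℝ Plane := by
    rw [← Module.finrank_eq_rank, finrank_euclideanSpace_fin]; norm_num
  have hconn : IsPreconnected (Set.range S)ᶜ :=
    ((Set.finite_range S).countable.isPathConnected_compl_of_one_lt_rank
      hrank).isConnected.isPreconnected
  have hVs : V ⊆ (Set.range S)ᶜ := by
    rintro P ⟨hP, -⟩ ⟨i, rfl⟩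
    exact hP (segment_subset_boundary S i (left_mem_segment ℝ _ _))
  have hcl : closure V ∩ (Set.range S)ᶜ ⊆ V := by
    rintro P ⟨hP, hPv⟩
    by_cases hPb : P ∈ boundary S
    -- Close to a point of an open edge, every point is on that edge or on one of its two sides, so
    -- none belongs to `V`.
    · exfalso
      obtain ⟨i, hi⟩ := Set.mem_iUnion.1 hPb
      have hM : P ∈ openSegment ℝ (S i) (S (i + 1)) :=
        mem_openSegment_of_ne_left_right (fun h => hPv ⟨i, h⟩) (fun h => hPv ⟨_, h⟩) hi
      obtain ⟨δ₁, hδ₁, h₁⟩ := hL.all hS one_ne_zero i P hM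
      obtain ⟨δ₂, hδ₂, h₂⟩ := hR.all hS (by norm_num) i P hM
      obtain ⟨T, ⟨⟨hT1, hT2⟩, hT3⟩, hTV⟩ := mem_closure_iff_nhds.1 hP _ (Filter.inter_mem
        (Filter.inter_mem (Metric.ball_mem_nhds P hδ₁) (Metric.ball_mem_nhds P hδ₂))
        (eventually_mem_segment_of_cross (hS.ne_succ i) hM))
      rcases lt_trichotomy (cross (S i) (S (i + 1)) T) 0 with h | h | h
      · exact hTV.2 (Or.inr (h₂ T hT2 (by linarith)))
      · exact hTV.1 (segment_subset_boundary S i (hT3 h))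
      · exact hTV.2 (Or.inl (h₁ T hT1 (by linarith)))
    · refine ⟨hPb, fun h => ?_⟩
      obtain ⟨δ, hδ, hj⟩ := joinedIn_of_mem_ball hPb
      obtain ⟨T, hT, hTV⟩ := mem_closure_iff_nhds.1 hP _ (Metric.ball_mem_nhds P hδ)
      exact hTV.2 (h.imp (fun h => h.trans (hj T hT)) (fun h => h.trans (hj T hT)))
  have hzL : zL ∉ boundary S := by
    have hM := midpoint_mem_openSegment (𝕜 := ℝ) (S 0) (S (0 + 1))
    obtain ⟨δ, hδ, h⟩ := hL _ hM
    obtain ⟨T, hT, hT0⟩ := exists_mem_side (hS.ne_succ 0)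
      (cross_eq_zero_of_mem_segment (openSegment_subset_segment ℝ _ _ hM)) one_ne_zero
      (Metric.ball_mem_nhds _ hδ)
    exact (h T hT hT0).source_mem
  have hzV : zL ∉ V := fun h => h.2 (Or.inl (JoinedIn.refl hzL))
  have hzs : zL ∈ (Set.range S)ᶜ := by
    rintro ⟨i, hi⟩
    exact hzL (hi ▸ segment_subset_boundary S i (left_mem_segment ℝ _ _))
  have hVne : Q ∈ V := ⟨hQ, hcon⟩
  obtain ⟨T, hT, hT1, hT2⟩ := hconn V (closure V)ᶜ hVo isClosed_closure.isOpen_compl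
    (fun P hP => by
      by_cases hPV : P ∈ V
      · exact Or.inl hPV
      · exact Or.inr fun h => hPV (hcl ⟨h, hP⟩))
    ⟨Q, hVs hVne, hVne⟩ ⟨zL, hzs, fun h => hzV (hcl ⟨h, hzs⟩)⟩
  exact hT2 (subset_closure hT1)

/-- If all edges were horizontal, both edges at a vertex of greatest abscissa would run to the left
and overlap. -/
lemma IsSimplePolygon.exists_not_horizontal (hS : IsSimplePolygon S) :
    ∃ i, S i 1 ≠ S (i + 1) 1 := by
  by_contra! h
  obtain ⟨j, -, hj⟩ := Finset.exists_max_image Finset.univ (fun i => S i 0) ⟨0, Finset.mem_univ _⟩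
  obtain ⟨i, rfl⟩ : ∃ i, i + 1 = j := ⟨j - 1, by simp⟩
  have hA := hj i (Finset.mem_univ _)
  have hC := hj (i + 1 + 1) (Finset.mem_univ _)
  have hne : i ≠ i + 1 := (fin_add_one_ne hS.three_le i).symm
  have hint := hS.inter_subset i (i + 1) hne
  have hAB := hS.ne_succ i
  have hBC := hS.ne_succ (i + 1)
  have hAC := hS.ne_succ_succ i
  have e1 := h i
  have e2 := h (i + 1)
  rcases le_total (S i 0) (S (i + 1 + 1) 0) with hle | hle
  · have hm : S (i + 1 + 1) ∈ segment ℝ (S i) (S (i + 1)) := by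
      have := horizontal_mem_segment (x := S (i + 1 + 1) 0) e1 (Set.mem_uIcc.2 (Or.inl ⟨hle, hC⟩))
      rwa [show (!₂[S (i + 1 + 1) 0, S i 1] : Plane) = S (i + 1 + 1) from
        plane_ext rfl (e1.trans e2)] at this
    rcases (hint ⟨hm, right_mem_segment ℝ _ _⟩).1 with h | h
    · exact hAC h.symm
    · exact hBC h.symm
  · have hm : S i ∈ segment ℝ (S (i + 1)) (S (i + 1 + 1)) := by
      have := horizontal_mem_segment (x := S i 0) e2 (Set.mem_uIcc.2 (Or.inr ⟨hle, hA⟩))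
      rwa [show (!₂[S i 0, S (i + 1) 1] : Plane) = S i from plane_ext rfl e1.symm] at this
    rcases (hint ⟨left_mem_segment ℝ _ _, hm⟩).2 with h | h
    · exact hAB h
    · exact hAC h

/-- The winding number jumps by one when an edge is crossed. -/
lemma winding_sub_winding (hS : IsSimplePolygon S) {zL zR : Plane} (hL : IsSide S 1 0 zL)
    (hR : IsSide S (-1) 0 zR) : winding S zL - winding S zR = 1 := by
  obtain ⟨i, hi⟩ := hS.exists_not_horizontal
  have hM := midpoint_mem_openSegment (𝕜 := ℝ) (S i) (S (i + 1))
  set M := midpoint ℝ (S i) (S (i + 1)) with hMd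
  obtain ⟨δ₁, hδ₁, h₁⟩ := hL.all hS one_ne_zero i M hM
  obtain ⟨δ₂, hδ₂, h₂⟩ := hR.all hS (by norm_num) i M hM
  obtain ⟨δ₃, hδ₃, h₃⟩ := exists_thickening_disjoint hS i (isCompact_singleton (x := M))
    (Set.singleton_subset_iff.2 hM)
  rw [Metric.thickening_singleton] at h₃
  set A := S i with hA
  set B := S (i + 1) with hB
  have hM0 := cross_eq_zero_of_mem_segment (openSegment_subset_segment ℝ _ _ hM)
  -- A horizontal displacement has `leftCross` equal to `0`, so crossing the edge horizontally
  -- changes the contribution of this edge alone. The factor `B 1 - A 1` puts `f (-s)` on the left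
  -- side whether the edge rises or falls.
  let f : ℝ → Plane := fun s => M + s • !₂[B 1 - A 1, 0]
  have hf : Continuous f := by unfold f; fun_prop
  have hU : Metric.ball M δ₁ ∩ Metric.ball M δ₂ ∩ Metric.ball M δ₃ ∈ 𝓝 (f 0) := by
    have : f 0 = M := by simp [f]
    rw [this]
    exact Filter.inter_mem (Filter.inter_mem (Metric.ball_mem_nhds _ hδ₁)
      (Metric.ball_mem_nhds _ hδ₂)) (Metric.ball_mem_nhds _ hδ₃)
  have hev : ∀ᶠ s in 𝓝[>] (0 : ℝ), f s ∈ Metric.ball M δ₁ ∩ Metric.ball M δ₂ ∩ Metric.ball M δ₃ ∧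
      f (-s) ∈ Metric.ball M δ₁ ∩ Metric.ball M δ₂ ∩ Metric.ball M δ₃ := by
    have hf' : Continuous fun s => f (-s) := hf.comp continuous_neg
    exact nhdsWithin_le_nhds (Filter.inter_mem (hf.continuousAt hU)
      (hf'.continuousAt (by rw [neg_zero]; exact hU)))
  obtain ⟨s, ⟨⟨⟨hs1, hs2⟩, hs3⟩, ⟨⟨hs4, hs5⟩, hs6⟩⟩, hs0⟩ := (hev.and self_mem_nhdsWithin).exists
  have hs0 : 0 < s := hs0
  have hsq : 0 < (B 1 - A 1) ^ 2 := by
    have : B 1 - A 1 ≠ 0 := sub_ne_zero.2 (Ne.symm hi)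
    positivity
  have hcross : ∀ s, cross A B (f s) = -s * (B 1 - A 1) ^ 2 := by
    intro s
    have : cross A B (f s) = cross A B M - s * (B 1 - A 1) ^ 2 := by
      simp [f, cross]; ring
    rw [this, hM0]; ring
  have hy : ∀ s, f s 1 = M 1 := by intro s; simp [f]
  have hMy : M 1 = (A 1 + B 1) / 2 := by
    rw [hMd, midpoint_eq_smul_add]; simp; ring
  have hcL : 0 < cross A B (f (-s)) := by rw [hcross]; nlinarith
  have hcR : cross A B (f s) < 0 := by rw [hcross]; nlinarith
  rw [winding_eq_of_joinedIn (h₁ _ hs4 (by linarith)),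
    winding_eq_of_joinedIn (h₂ _ hs2 (by linarith)), winding, winding, ← Finset.sum_sub_distrib,
    Finset.sum_eq_single i]
  · rw [← hA, ← hB]
    unfold rayCross
    simp only [hy, hcL, hcR, hcL.not_gt, hcR.not_gt, and_true, and_false, if_false]
    rcases lt_or_gt_of_ne hi with hlt | hlt
    · rw [if_pos ⟨by linarith, by linarith⟩, if_neg (fun h => by linarith [h.1])]; rfl
    · rw [if_neg (fun h => by linarith [h.1]), if_pos ⟨by linarith, by linarith⟩]; rfl
  · intro j _ hj
    rw [rayCross_sub_rayCross]
    · have hh : ∀ R, leftCross (f (-s)) (f s) R = 0 := by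
        intro R
        unfold leftCross
        simp only [hy]
        rw [if_neg (fun h => by linarith [h.1, h.2.1]), if_neg (fun h => by linarith [h.1, h.2.1])]
      rw [hh, hh, sub_self]
    · exact Set.disjoint_left.2 fun R hR hR' =>
        h₃ R ((convex_ball M δ₃).segment_subset hs6 hs3 hR') j hj hR
  · simp

/-- The Jordan curve theorem for polygons, in terms of winding numbers: `ε` is `1` for a polygon
with the interior to the left and `-1` for one with the interior to the right. -/
theorem IsSimplePolygon.exists_orientation (hS : IsSimplePolygon S) :
    ∃ ε : ℤ, (ε = 1 ∨ ε = -1) ∧ (∀ Q ∉ boundary S, winding S Q = 0 ∨ winding S Q = ε) ∧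
      (∀ Q ∉ boundary S, Bornology.IsBounded (connectedComponentIn (boundary S)ᶜ Q) ↔
        winding S Q ≠ 0) ∧
      (∃ Q ∉ boundary S, winding S Q = ε) ∧
      ∀ i, ∀ M ∈ openSegment ℝ (S i) (S (i + 1)), ∃ δ > 0, ∀ Q ∈ Metric.ball M δ,
        0 < cross (S i) (S (i + 1)) Q → Q ∉ boundary S ∧ 2 * winding S Q = ε + 1 := by
  obtain ⟨zL, hL⟩ := exists_isSide hS one_ne_zero 0
  obtain ⟨zR, hR⟩ := exists_isSide hS (ε := -1) (by norm_num) 0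
  have hjump := winding_sub_winding hS hL hR
  have hjoin := fun Q => @joinedIn_or_joinedIn n _ S hS zL zR hL hR Q
  obtain ⟨M, hM⟩ := exists_winding_eq_zero S
  have hfar : ∀ t : ℝ, M < t → M < ‖(!₂[t, 0] : Plane)‖ := fun t ht =>
    (ht.trans_le (le_abs_self t)).trans_le (by
      simpa using PiLp.norm_apply_le (!₂[t, 0] : Plane) 0)
  have hdich : ∀ Q ∉ boundary S, winding S Q = winding S zL ∨ winding S Q = winding S zR :=
    fun Q hQ => (hjoin Q hQ).imp (fun h => (winding_eq_of_joinedIn h).symm)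
      (fun h => (winding_eq_of_joinedIn h).symm)
  have hz : winding S zL = 0 ∨ winding S zR = 0 := by
    obtain ⟨h1, h2⟩ := hM _ (hfar (M + 1) (by linarith))
    rcases hdich _ h1 with h | h
    · left; rw [← h, h2]
    · right; rw [← h, h2]
  have hjoin' : ∀ P ∉ boundary S, ∀ Q ∉ boundary S, winding S P = winding S Q →
      JoinedIn (boundary S)ᶜ P Q := by
    intro P hP Q hQ h
    rcases hjoin P hP with h1 | h1 <;> rcases hjoin Q hQ with h2 | h2
    · exact h1.symm.trans h2
    · rw [← winding_eq_of_joinedIn h1, ← winding_eq_of_joinedIn h2] at h; omega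
    · rw [← winding_eq_of_joinedIn h1, ← winding_eq_of_joinedIn h2] at h; omega
    · exact h1.symm.trans h2
  have hzLm : zL ∉ boundary S := by
    obtain ⟨δ, hδ, h⟩ := hL _ (midpoint_mem_openSegment (𝕜 := ℝ) (S 0) (S (0 + 1)))
    obtain ⟨T, hT, hT0⟩ := exists_mem_side (hS.ne_succ 0) (cross_eq_zero_of_mem_segment
      (openSegment_subset_segment ℝ _ _ (midpoint_mem_openSegment (𝕜 := ℝ) _ _))) one_ne_zero
      (Metric.ball_mem_nhds _ hδ)
    exact (h T hT hT0).source_mem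
  have hzRm : zR ∉ boundary S := by
    obtain ⟨δ, hδ, h⟩ := hR _ (midpoint_mem_openSegment (𝕜 := ℝ) (S 0) (S (0 + 1)))
    obtain ⟨T, hT, hT0⟩ := exists_mem_side (hS.ne_succ 0) (cross_eq_zero_of_mem_segment
      (openSegment_subset_segment ℝ _ _ (midpoint_mem_openSegment (𝕜 := ℝ) _ _)))
      (show (-1 : ℝ) ≠ 0 by norm_num) (Metric.ball_mem_nhds _ hδ)
    exact (h T hT hT0).source_mem
  -- One of the two values is `0` and they differ by one, so their sum is the other value, `1` or
  -- `-1`. On the left side the winding number is therefore `(ε + 1) / 2`.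
  refine ⟨winding S zL + winding S zR, by omega, fun Q hQ => ?_, fun Q hQ => ⟨fun hb h0 => ?_,
    fun h0 => ?_⟩, ?_, fun i P hP => ?_⟩
  · rcases hdich Q hQ with h | h <;> omega
  · obtain ⟨R, hR⟩ := hb.exists_norm_le
    obtain ⟨h1, h2⟩ := hM _ (hfar (max M R + 1) (by linarith [le_max_left M R]))
    have h3 := hR _ (mem_connectedComponentIn_of_joinedIn (hjoin' Q hQ _ h1 (h0.trans h2.symm)))
    have h4 := PiLp.norm_apply_le (!₂[max M R + 1, 0] : Plane) 0
    have h5 := le_abs_self (max M R + 1)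
    simp only [Matrix.cons_val_zero, Real.norm_eq_abs] at h4
    linarith [le_max_right M R]
  · rw [isBounded_iff_forall_norm_le]
    refine ⟨M, fun R hR => ?_⟩
    by_contra! h
    apply h0
    rw [winding_eq_of_isPreconnected isPreconnected_connectedComponentIn
      (connectedComponentIn_subset _ Q) (mem_connectedComponentIn hQ) hR]
    exact (hM R h).2
  · rcases hz with h | h
    · exact ⟨zR, hzRm, by omega⟩
    · exact ⟨zL, hzLm, by omega⟩
  · obtain ⟨δ, hδ, h⟩ := hL.all hS one_ne_zero i P hP
    refine ⟨δ, hδ, fun Q hQ hc => ?_⟩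
    have := h Q hQ (by linarith)
    refine ⟨this.target_mem, ?_⟩
    rw [← winding_eq_of_joinedIn this]; omega

/-- For small `s > 0` the displacement `(s, -s ^ 2)` leaves every line through `Q`, horizontal ones
included. Its direction agrees with the conventions of `rayCross`: a ray that starts on an edge does
not count it, and the levels are open below and closed above. -/
lemma cross_add_parabola (A B Q : Plane) (s : ℝ) : cross A B (Q + !₂[s, -s ^ 2]) =
    cross A B Q - s * ((B 1 - A 1) + s * (B 0 - A 0)) := by
  simp [cross]; ring

lemma eventually_lt_sub_sq_iff (a y : ℝ) : ∀ᶠ s in 𝓝[>] (0 : ℝ), (a < y - s ^ 2 ↔ a < y) := by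
  rcases lt_or_ge a y with h | h
  · have hc : ContinuousAt (fun s : ℝ => y - s ^ 2) 0 := by fun_prop
    filter_upwards [nhdsWithin_le_nhds (hc (Ioi_mem_nhds (show a < y - 0 ^ 2 by simpa)))] with s hs
    exact ⟨fun _ => h, fun _ => hs⟩
  · filter_upwards with s
    exact ⟨fun h' => by nlinarith [sq_nonneg s], fun h' => by linarith⟩

lemma eventually_cross_ne_zero {A B : Plane} (h : A ≠ B) (Q : Plane) :
    ∀ᶠ s in 𝓝[>] (0 : ℝ), cross A B (Q + !₂[s, -s ^ 2]) ≠ 0 := by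
  simp only [cross_add_parabola]
  by_cases hQ : cross A B Q = 0
  · by_cases hAB : B 1 - A 1 = 0
    · have h0 : B 0 - A 0 ≠ 0 := fun h0 => h (plane_ext (by linarith) (by linarith))
      filter_upwards [self_mem_nhdsWithin] with s hs
      have hs : s ≠ 0 := (ne_of_gt hs)
      rw [hQ, hAB]
      simp [hs, h0]
    · have hc : ContinuousAt (fun s : ℝ => (B 1 - A 1) + s * (B 0 - A 0)) 0 := by fun_prop
      filter_upwards [self_mem_nhdsWithin, nhdsWithin_le_nhds (hc.eventually_ne (y := 0)
        (by simpa using hAB))] with s hs hs'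
      have hs : s ≠ 0 := (ne_of_gt hs)
      rw [hQ]
      simp [hs, hs']
  · have hc : ContinuousAt
        (fun s : ℝ => cross A B Q - s * ((B 1 - A 1) + s * (B 0 - A 0))) 0 := by fun_prop
    exact nhdsWithin_le_nhds (hc.eventually_ne (by simpa using hQ))

lemma eventually_cross_pos_iff {A B : Plane} (h : A 1 < B 1) (Q : Plane) :
    ∀ᶠ s in 𝓝[>] (0 : ℝ), (0 < cross A B (Q + !₂[s, -s ^ 2]) ↔ 0 < cross A B Q) := by
  simp only [cross_add_parabola]
  rcases lt_or_ge 0 (cross A B Q) with hQ | hQ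
  · have hc : ContinuousAt
        (fun s : ℝ => cross A B Q - s * ((B 1 - A 1) + s * (B 0 - A 0))) 0 := by fun_prop
    filter_upwards [nhdsWithin_le_nhds (hc.eventually_const_lt (u := 0) (by simpa using hQ))]
      with s hs
    exact ⟨fun _ => hQ, fun _ => hs⟩
  · have hc : ContinuousAt (fun s : ℝ => (B 1 - A 1) + s * (B 0 - A 0)) 0 := by fun_prop
    filter_upwards [self_mem_nhdsWithin, nhdsWithin_le_nhds (hc.eventually_const_lt (u := 0)
      (by simpa using h))] with s hs hs'
    have hs : 0 < s := hs
    have := mul_pos hs hs'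
    exact ⟨fun _ => by linarith, fun _ => by linarith⟩

/-- Crossing numbers do not change if the point is moved slightly to the right and still less
downwards. -/
lemma eventually_rayCross_eq (A B Q : Plane) :
    ∀ᶠ s in 𝓝[>] (0 : ℝ), rayCross A B (Q + !₂[s, -s ^ 2]) = rayCross A B Q := by
  have key : ∀ A B : Plane, A 1 ≤ B 1 →
      ∀ᶠ s in 𝓝[>] (0 : ℝ), rayCross A B (Q + !₂[s, -s ^ 2]) = rayCross A B Q := by
    intro A B hAB
    rcases hAB.eq_or_lt with hAB | hAB
    · filter_upwards with s
      rw [rayCross_of_le hAB.le, rayCross_of_le hAB.le, if_neg (fun h => by linarith [h.1, h.2.1]),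
        if_neg (fun h => by linarith [h.1, h.2.1])]
    · filter_upwards [eventually_lt_sub_sq_iff (A 1) (Q 1), eventually_lt_sub_sq_iff (B 1) (Q 1),
        eventually_cross_pos_iff hAB Q] with s h1 h2 h3
      have e : (Q + !₂[s, -s ^ 2]) 1 = Q 1 - s ^ 2 := by simp; ring
      rw [rayCross_of_le hAB.le, rayCross_of_le hAB.le, e]
      refine if_congr ?_ rfl rfl
      rw [h1, h3, ← not_lt, h2, not_lt]
  rcases le_total (A 1) (B 1) with h | h
  · exact key A B h
  · filter_upwards [key B A h] with s hs
    rw [rayCross_swap B A, hs, rayCross_swap B A]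

/-- Extends the dichotomy to points of the boundary, by moving them off it without changing any
crossing number. It makes later arguments independent of whether the point in question lies on an
edge. -/
lemma winding_eq_zero_or {ε : ℤ} (hS : IsSimplePolygon S)
    (h : ∀ Q ∉ boundary S, winding S Q = 0 ∨ winding S Q = ε) (Q : Plane) :
    winding S Q = 0 ∨ winding S Q = ε := by
  have h1 : ∀ᶠ s in 𝓝[>] (0 : ℝ), ∀ i, rayCross (S i) (S (i + 1)) (Q + !₂[s, -s ^ 2]) =
      rayCross (S i) (S (i + 1)) Q := eventually_all.2 fun i => eventually_rayCross_eq _ _ Q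
  have h2 : ∀ᶠ s in 𝓝[>] (0 : ℝ), ∀ i, cross (S i) (S (i + 1)) (Q + !₂[s, -s ^ 2]) ≠ 0 :=
    eventually_all.2 fun i => eventually_cross_ne_zero (hS.ne_succ i) Q
  obtain ⟨s, hs1, hs2⟩ := (h1.and h2).exists
  have hb : Q + !₂[s, -s ^ 2] ∉ boundary S := fun hb => by
    obtain ⟨i, hi⟩ := Set.mem_iUnion.1 hb
    exact hs2 i (cross_eq_zero_of_mem_segment hi)
  have := h _ hb
  rwa [winding, Finset.sum_congr rfl fun i _ => hs1 i] at this

lemma mem_planeRegion_iff {Q : Plane} : Q ∈ planeRegion S ↔ Q ∈ boundary S ∨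
    Q ∉ boundary S ∧ Bornology.IsBounded (connectedComponentIn (boundary S)ᶜ Q) := by
  simp only [planeRegion, region, Set.mem_union, Set.mem_ofPred_eq, Set.mem_sdiff, Set.mem_univ,
    true_and, Set.compl_eq_univ_sdiff]

/-- A polygon is positively oriented if it has winding numbers `0` and `1`. -/
structure PositivelyOriented (S : Fin n → Plane) : Prop where
  winding_eq : ∀ Q, winding S Q = 0 ∨ winding S Q = 1
  mem_region_iff : ∀ Q ∉ boundary S, (Q ∈ planeRegion S ↔ winding S Q = 1)
  exists_winding_eq_one : ∃ Q ∉ boundary S, winding S Q = 1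

end

end PolygonDistance
end

noncomputable section
namespace PolygonDistance

/-! ### Integrals of crossing numbers over a disk -/

lemma dist_sq_eq (P Q : Plane) : dist P Q ^ 2 = (P 0 - Q 0) ^ 2 + (P 1 - Q 1) ^ 2 := by
  rw [EuclideanSpace.dist_eq, Fin.sum_univ_two, Real.sq_sqrt (by positivity), Real.dist_eq,
    Real.dist_eq, sq_abs, sq_abs]

lemma dist_lt_iff {P Q : Plane} {d : ℝ} (hd : 0 ≤ d) :
    dist P Q < d ↔ (P 0 - Q 0) ^ 2 + (P 1 - Q 1) ^ 2 < d ^ 2 := by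
  rw [← dist_sq_eq, sq_lt_sq₀ dist_nonneg hd]

lemma dist_le_iff {P Q : Plane} {d : ℝ} (hd : 0 ≤ d) :
    dist P Q ≤ d ↔ (P 0 - Q 0) ^ 2 + (P 1 - Q 1) ^ 2 ≤ d ^ 2 := by
  rw [← dist_sq_eq, sq_le_sq₀ dist_nonneg hd]

/-- Half the length of the horizontal chord at the ordinate `y`. -/
def halfChord (P : Plane) (d y : ℝ) : ℝ := Real.sqrt (d ^ 2 - (y - P 1) ^ 2)

lemma continuous_halfChord (P : Plane) (d : ℝ) : Continuous (halfChord P d) := by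
  unfold halfChord; fun_prop

lemma halfChord_nonneg (P : Plane) (d y : ℝ) : 0 ≤ halfChord P d y := Real.sqrt_nonneg _

lemma dist_lt_iff_halfChord {P Q : Plane} {d : ℝ} (hd : 0 < d) :
    dist Q P < d ↔ |Q 0 - P 0| < halfChord P d (Q 1) := by
  rw [dist_lt_iff hd.le, halfChord, Real.lt_sqrt (abs_nonneg _), sq_abs]
  constructor <;> intro h <;> linarith

lemma dist_le_iff_halfChord {P Q : Plane} {d : ℝ} (hd : 0 < d) (h : |Q 1 - P 1| ≤ d) :
    dist Q P ≤ d ↔ |Q 0 - P 0| ≤ halfChord P d (Q 1) := by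
  have : (Q 1 - P 1) ^ 2 ≤ d ^ 2 := sq_le_sq' (abs_le.1 h).1 (abs_le.1 h).2
  have h0 : 0 ≤ d ^ 2 - (Q 1 - P 1) ^ 2 := by linarith
  rw [dist_le_iff hd.le, halfChord, ← abs_of_nonneg (Real.sqrt_nonneg _), ← sq_le_sq,
    Real.sq_sqrt h0]
  constructor <;> intro h <;> linarith

lemma abs_sub_le_of_dist_le {P Q : Plane} {d : ℝ} (h : dist Q P ≤ d) : |Q 1 - P 1| ≤ d := by
  have := PiLp.norm_apply_le (Q - P) 1
  rw [← dist_eq_norm] at this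
  simpa using this.trans h

lemma halfChord_pos {P : Plane} {d y : ℝ} (h : |y - P 1| < d) : 0 < halfChord P d y := by
  have : (y - P 1) ^ 2 < d ^ 2 := sq_lt_sq' (abs_lt.1 h).1 (abs_lt.1 h).2
  exact Real.sqrt_pos.2 (by linarith)

/-- Integration over a disk, by horizontal chords. -/
lemma integral_ball (P : Plane) {d : ℝ} (hd : 0 < d) {F : Plane → ℝ}
    (hF : IntegrableOn F (Metric.ball P d)) :
    ∫ Q in Metric.ball P d, F Q = ∫ y in (P 1 - d)..(P 1 + d),
      ∫ x in (P 0 - halfChord P d y)..(P 0 + halfChord P d y), F !₂[x, y] := by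
  let e : ℝ × ℝ ≃ᵐ Plane :=
    (MeasurableEquiv.finTwoArrow (α := ℝ)).symm.trans (MeasurableEquiv.toLp 2 (Fin 2 → ℝ))
  have he : ∀ x y : ℝ, e (x, y) = !₂[x, y] := fun x y => rfl
  have hmp : MeasurePreserving e (volume.prod volume) volume :=
    (PiLp.volume_preserving_toLp (Fin 2)).comp ((volume_preserving_finTwoArrow ℝ).symm _)
  have hint := (integrable_indicator_iff Metric.isOpen_ball.measurableSet).2 hF
  rw [← integral_indicator Metric.isOpen_ball.measurableSet,
    ← hmp.integral_comp e.measurableEmbedding,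
    integral_prod_symm (fun p => (Metric.ball P d).indicator F (e p))
      (hmp.integrable_comp_of_integrable hint),
    intervalIntegral.integral_of_le (by linarith), integral_Ioc_eq_integral_Ioo,
    ← integral_indicator measurableSet_Ioo]
  congr 1
  ext y
  by_cases hy : y ∈ Set.Ioo (P 1 - d) (P 1 + d)
  · have hh := halfChord_nonneg P d y
    rw [Set.indicator_of_mem hy, intervalIntegral.integral_of_le (by linarith),
      integral_Ioc_eq_integral_Ioo, ← integral_indicator measurableSet_Ioo]
    congr 1
    ext x
    rw [he]
    have : (!₂[x, y] : Plane) ∈ Metric.ball P d ↔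
        x ∈ Set.Ioo (P 0 - halfChord P d y) (P 0 + halfChord P d y) := by
      rw [Metric.mem_ball, dist_lt_iff_halfChord hd, abs_lt]
      simp only [Matrix.cons_val_zero, Matrix.cons_val_one, Matrix.cons_val_fin_one, Set.mem_Ioo]
      constructor <;> rintro ⟨h1, h2⟩ <;> constructor <;> linarith
    by_cases hx : x ∈ Set.Ioo (P 0 - halfChord P d y) (P 0 + halfChord P d y)
    · rw [Set.indicator_of_mem hx, Set.indicator_of_mem (this.2 hx)]
    · rw [Set.indicator_of_notMem hx, Set.indicator_of_notMem (fun h => hx (this.1 h))]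
  · rw [Set.indicator_of_notMem hy]
    have : ∀ x, (Metric.ball P d).indicator F (e (x, y)) = 0 := by
      intro x
      refine Set.indicator_of_notMem (fun h => hy ?_) _
      rw [he, Metric.mem_ball, dist_lt_iff hd.le] at h
      simp only [Matrix.cons_val_zero, Matrix.cons_val_one, Matrix.cons_val_fin_one] at h
      have := abs_lt_of_sq_lt_sq (show (y - P 1) ^ 2 < d ^ 2 by nlinarith [sq_nonneg (x - P 0)])
        hd.le
      rw [abs_lt] at this
      constructor <;> linarith [this.1, this.2]
    simp [this]

/-- The signed number of crossings of the segment from `A` to `B` with the horizontal line of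
ordinate `y`. -/
def level (A B : Plane) (y : ℝ) : ℤ := (if A 1 < y then 1 else 0) - (if B 1 < y then 1 else 0)

lemma level_self (A : Plane) (y : ℝ) : level A A y = 0 := by simp [level]

lemma level_swap (A B : Plane) (y : ℝ) : level B A y = -level A B y := by simp [level]

lemma xAt_swap {A B : Plane} (h : A 1 ≠ B 1) (y : ℝ) : xAt B A y = xAt A B y := by
  have h1 : B 1 - A 1 ≠ 0 := sub_ne_zero.2 h.symm
  have h2 : A 1 - B 1 ≠ 0 := sub_ne_zero.2 h
  unfold xAt
  field_simp
  ring

/-- Separates the ordinate, which determines the sign, from the abscissa, which decides whether the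
ray reaches the crossing. This is the form that can be integrated along a horizontal chord. -/
lemma rayCross_eq_level (A B Q : Plane) :
    rayCross A B Q = if Q 0 < xAt A B (Q 1) then level A B (Q 1) else 0 := by
  have key : ∀ A B : Plane, A 1 < B 1 →
      rayCross A B Q = if Q 0 < xAt A B (Q 1) then level A B (Q 1) else 0 := by
    intro A B h
    rw [rayCross_of_le h.le]
    simp only [cross_pos_iff h]
    unfold level
    split_ifs <;> first | rfl | grind
  rcases lt_trichotomy (A 1) (B 1) with h | h | h
  · exact key A B h
  · have : level A B (Q 1) = 0 := by simp [level, h]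
    rw [this, rayCross_of_level, ite_self]
    rcases lt_or_ge (A 1) (Q 1) with h1 | h1
    · exact Or.inl ⟨h1, h ▸ h1⟩
    · exact Or.inr ⟨h1, h ▸ h1⟩
  · rw [rayCross_swap B A, key B A h, xAt_swap h.ne, level_swap B A]
    split_ifs <;> simp

lemma measurable_rayCross (A B : Plane) : Measurable (rayCross A B) := by
  unfold rayCross
  have hc := (continuous_cross A B).measurable
  have h1 : Measurable fun Q : Plane => Q 1 := by fun_prop
  refine Measurable.ite ?_ measurable_const (Measurable.ite ?_ measurable_const measurable_const)
  · exact (measurableSet_lt measurable_const h1).inter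
      ((measurableSet_le h1 measurable_const).inter (measurableSet_lt measurable_const hc))
  · exact (measurableSet_lt measurable_const h1).inter
      ((measurableSet_le h1 measurable_const).inter (measurableSet_lt hc measurable_const))

lemma abs_rayCross_le (A B Q : Plane) : |(rayCross A B Q : ℝ)| ≤ 1 := by
  unfold rayCross
  split_ifs <;> simp

lemma measurable_winding {n : ℕ} [NeZero n] (S : Fin n → Plane) : Measurable (winding S) := by
  unfold winding
  exact Finset.measurable_sum _ fun i _ => measurable_rayCross _ _

lemma integrableOn_rayCross (A B P : Plane) (d : ℝ) :
    IntegrableOn (fun Q => (rayCross A B Q : ℝ)) (Metric.ball P d) := by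
  refine Measure.integrableOn_of_bounded (M := 1) measure_ball_lt_top.ne
    ((measurable_from_top (f := fun k : ℤ => (k : ℝ))).comp
      (measurable_rayCross A B)).aestronglyMeasurable ?_
  filter_upwards with Q
  exact abs_rayCross_le A B Q

lemma integrableOn_winding {n : ℕ} [NeZero n] (S : Fin n → Plane) (P : Plane) (d : ℝ) :
    IntegrableOn (fun Q => (winding S Q : ℝ)) (Metric.ball P d) := by
  simp only [winding, Int.cast_sum]
  exact integrable_finsetSum _ fun i _ => integrableOn_rayCross _ _ _ _

/-- The half-open levels make crossing numbers additive under subdivision, even if the division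
point is at the level of `Q`. -/
lemma rayCross_of_mem_segment {A B X : Plane} (hX : X ∈ segment ℝ A B) (Q : Plane) :
    rayCross A B Q = rayCross A X Q + rayCross X B Q := by
  have self : ∀ A, rayCross A A Q = 0 := fun A => by
    have := rayCross_swap A A Q; omega
  obtain ⟨t, h0, h1, hx, hy⟩ := mem_segment_iff_exists.1 hX
  rcases h0.eq_or_lt with rfl | h0
  · have : X = A := plane_ext (by simp [hx]) (by simp [hy])
    rw [this, self, zero_add]
  rcases h1.eq_or_lt with rfl | h1
  · have : X = B := plane_ext (by simp [hx]) (by simp [hy])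
    rw [this, self, add_zero]
  have e1 : cross A X Q = t * cross A B Q := by unfold cross; rw [hx, hy]; ring
  have e2 : cross X B Q = (1 - t) * cross A B Q := by unfold cross; rw [hx, hy]; ring
  have h1' : 0 < 1 - t := by linarith
  have n1 : t * cross A B Q < 0 ↔ cross A B Q < 0 := by
    rw [← neg_pos, ← mul_neg, mul_pos_iff_of_pos_left h0, neg_pos]
  have n2 : (1 - t) * cross A B Q < 0 ↔ cross A B Q < 0 := by
    rw [← neg_pos, ← mul_neg, mul_pos_iff_of_pos_left h1', neg_pos]
  have hb : (A 1 ≤ X 1 ∧ X 1 ≤ B 1) ∨ (B 1 ≤ X 1 ∧ X 1 ≤ A 1) := by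
    rcases le_total (A 1) (B 1) with h | h
    · left; constructor <;> nlinarith
    · right; constructor <;> nlinarith
  unfold rayCross
  simp only [e1, e2, mul_pos_iff_of_pos_left h0, mul_pos_iff_of_pos_left h1', n1, n2]
  split_ifs <;> first | rfl | grind

/-- Crossing numbers of a segment outside an open disk are constant along horizontal chords. -/
lemma rayCross_eq_center {A B P Q : Plane} {d : ℝ} (hout : ∀ R ∈ segment ℝ A B, d ≤ dist R P)
    (hQ : dist Q P < d) : rayCross A B Q = rayCross A B !₂[P 0, Q 1] := by
  have hd : 0 < d := dist_nonneg.trans_lt hQ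
  have hC : dist (!₂[P 0, Q 1] : Plane) P < d := by
    rw [dist_lt_iff hd.le] at hQ ⊢
    simp only [Matrix.cons_val_zero, Matrix.cons_val_one, Matrix.cons_val_fin_one]
    nlinarith [sq_nonneg (Q 0 - P 0)]
  rw [← sub_eq_zero, rayCross_sub_rayCross]
  · have : ∀ R, leftCross Q !₂[P 0, Q 1] R = 0 := by
      intro R
      rw [leftCross_of_le (by simp), if_neg]
      rintro ⟨h1, h2, -⟩
      simp at h2; linarith
    rw [this, this, sub_self]
  · refine Set.disjoint_left.2 fun R hR hR' => ?_
    have := (convex_ball P d).segment_subset (Metric.mem_ball.2 hQ) (Metric.mem_ball.2 hC) hR'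
    exact (hout R hR).not_gt this

/-- The indicator of the points to the right of the abscissa `x` and below the ordinate `y`. -/
def lowerRight (x y : ℝ) (R : Plane) : ℤ := if x < R 0 ∧ R 1 < y then 1 else 0

lemma leftCross_vertical (x y z : ℝ) (R : Plane) :
    leftCross !₂[x, y] !₂[x, z] R = lowerRight x z R - lowerRight x y R := by
  have key : ∀ y z : ℝ, y ≤ z →
      leftCross !₂[x, y] !₂[x, z] R = lowerRight x z R - lowerRight x y R := by
    intro y z hyz
    rw [leftCross_of_le (by simpa)]
    have e : cross !₂[x, y] !₂[x, z] R = -((z - y) * (R 0 - x)) := by simp [cross]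
    rw [e]
    unfold lowerRight
    simp only [Matrix.cons_val_one, Matrix.cons_val_fin_one]
    rcases hyz.eq_or_lt with rfl | hyz
    · rw [if_neg (fun h => by linarith [h.1, h.2.1]), sub_self]
    · have : -((z - y) * (R 0 - x)) < 0 ↔ x < R 0 := by
        rw [neg_lt_zero, mul_pos_iff_of_pos_left (by linarith), sub_pos]
      simp only [this]
      split_ifs <;> first | rfl | grind
  rcases le_total y z with h | h
  · exact key y z h
  · rw [leftCross_swap !₂[x, z], key z y h]; ring

/-- The open vertical diameter avoids an outer segment, so along it the crossing number changes only
by terms at the end points of that segment. -/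
lemma rayCross_vertical {A B P : Plane} {d y z : ℝ} (hout : ∀ R ∈ segment ℝ A B, d ≤ dist R P)
    (hy : |y - P 1| < d) (hz : |z - P 1| < d) :
    rayCross A B !₂[P 0, z] - rayCross A B !₂[P 0, y] =
      (lowerRight (P 0) y B - lowerRight (P 0) z B) -
        (lowerRight (P 0) y A - lowerRight (P 0) z A) := by
  have hd : 0 < d := (abs_nonneg _).trans_lt hy
  rw [rayCross_sub_rayCross, leftCross_vertical, leftCross_vertical]
  refine Set.disjoint_left.2 fun R hR hR' => ?_
  have hb : ∀ y, |y - P 1| < d → (!₂[P 0, y] : Plane) ∈ Metric.ball P d := fun y hy => by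
    rw [Metric.mem_ball, dist_lt_iff_halfChord hd]
    simpa using halfChord_pos hy
  exact (hout R hR).not_gt ((convex_ball P d).segment_subset (hb z hz) (hb y hy) hR')

end PolygonDistance
end

/-! ### Inner and outer parts of the edges -/

noncomputable section
namespace PolygonDistance

/-- The line integral of `x dy - y dx` over the segment from `A` to `B`. -/
def shoelace (A B : Plane) : ℝ := B 1 * A 0 - A 1 * B 0

lemma shoelace_self (A : Plane) : shoelace A A = 0 := by unfold shoelace; ring

/-- The points `X`, `Y` divide the segment from `A` to `B` into a part in the closed disk, between
`X` and `Y`, and two parts outside the open disk. -/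
structure IsSplit (P : Plane) (d : ℝ) (A B X Y : Plane) : Prop where
  mem_left : X ∈ segment ℝ A B
  mem_right : Y ∈ segment ℝ X B
  inside : X = Y ∨ (dist X P ≤ d ∧ dist Y P ≤ d)
  outside_left : X = A ∨ ∀ R ∈ segment ℝ A X, d ≤ dist R P
  outside_right : Y = B ∨ ∀ R ∈ segment ℝ Y B, d ≤ dist R P

lemma rayCross_self (A Q : Plane) : rayCross A A Q = 0 := by
  have := rayCross_swap A A Q; omega

lemma IsSplit.rayCross_eq {P A B X Y Q : Plane} {d : ℝ} (h : IsSplit P d A B X Y)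
    (hQ : dist Q P < d) : rayCross A B Q =
      (rayCross A X !₂[P 0, Q 1] + rayCross Y B !₂[P 0, Q 1]) + rayCross X Y Q := by
  rw [rayCross_of_mem_segment h.mem_left, rayCross_of_mem_segment h.mem_right]
  have h1 : rayCross A X Q = rayCross A X !₂[P 0, Q 1] := by
    rcases h.outside_left with rfl | h1
    · rw [rayCross_self, rayCross_self]
    · exact rayCross_eq_center h1 hQ
  have h2 : rayCross Y B Q = rayCross Y B !₂[P 0, Q 1] := by
    rcases h.outside_right with rfl | h1
    · rw [rayCross_self, rayCross_self]
    · exact rayCross_eq_center h1 hQ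
  rw [h1, h2]; ring

/-- A strict inequality `a < y` is left-continuous in `y`. Hence levels just below `y` show the same
counts while avoiding finitely many exceptional levels. -/
lemma eventually_lt_iff_of_left (a y : ℝ) : ∀ᶠ z in 𝓝[<] y, (a < z ↔ a < y) ∧ a ≠ z := by
  rcases lt_or_ge a y with h | h
  · filter_upwards [Ioo_mem_nhdsLT h] with z hz
    exact ⟨⟨fun _ => h, fun _ => hz.1⟩, hz.1.ne⟩
  · filter_upwards [self_mem_nhdsWithin] with z hz
    have hz : z < y := hz
    exact ⟨⟨fun h1 => by linarith, fun h1 => by linarith⟩, (hz.trans_le h).ne'⟩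

/-- Strict convexity of the disk: the interior points of a chord are in the open disk. A crossing at
a level different from those of `X` and `Y` thus stays away from both ends of the horizontal chord.
-/
lemma abs_xAt_sub_lt {P X Y : Plane} {d y : ℝ} (hX : dist X P ≤ d) (hY : dist Y P ≤ d)
    (hy : |y - P 1| < d) (hl : level X Y y ≠ 0) (hXy : X 1 ≠ y) (hYy : Y 1 ≠ y) :
    |xAt X Y y - P 0| < halfChord P d y := by
  have key : ∀ X Y : Plane, dist X P ≤ d → dist Y P ≤ d → X 1 < y → y < Y 1 →
      |xAt X Y y - P 0| < halfChord P d y := by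
    intro X Y hX hY h1 h2
    have hm := xAt_mem_segment (h1.trans h2) h1.le h2.le
    have hne : X ≠ Y := by rintro rfl; linarith
    have := openSegment_subset_ball_of_ne (Metric.mem_closedBall.2 hX) (Metric.mem_closedBall.2 hY)
      hne (mem_openSegment_of_ne_left_right (fun h => h1.ne (by rw [h]; simp))
        (fun h => h2.ne' (by rw [h]; simp)) hm)
    rw [Metric.mem_ball, dist_lt_iff_halfChord ((abs_nonneg _).trans_lt hy)] at this
    simpa using this
  unfold level at hl
  rcases lt_or_gt_of_ne hXy with h1 | h1 <;> rcases lt_or_gt_of_ne hYy with h2 | h2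
  · simp [h1, h2] at hl
  · exact key X Y hX hY h1 h2
  · rw [← xAt_swap (h2.trans h1).ne']
    exact key Y X hY hX h2 h1
  · simp [h1.not_gt, h2.not_gt] at hl

section
variable {n : ℕ} [NeZero n] {S X Y : Fin n → Plane} {P : Plane} {d : ℝ}

/-- The signed number of crossings of the outer parts of the edges with a ray to the right that
starts in the disk at the ordinate `y`. -/
def outerLevel (P : Plane) (S X Y : Fin n → Plane) (y : ℝ) : ℤ :=
  ∑ i, (rayCross (S i) (X i) !₂[P 0, y] + rayCross (Y i) (S (i + 1)) !₂[P 0, y])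

lemma winding_eq_outerLevel_add (h : ∀ i, IsSplit P d (S i) (S (i + 1)) (X i) (Y i)) {Q : Plane}
    (hQ : dist Q P < d) :
    winding S Q = outerLevel P S X Y (Q 1) + ∑ i, rayCross (X i) (Y i) Q := by
  rw [winding, outerLevel, ← Finset.sum_add_distrib]
  exact Finset.sum_congr rfl fun i _ => (h i).rayCross_eq hQ

/-- Along the vertical diameter each outer part contributes terms at its two ends. Those at the
vertices of the polygon cancel around it, and those at the `X i` and `Y i` remain. -/
lemma outerLevel_sub (h : ∀ i, IsSplit P d (S i) (S (i + 1)) (X i) (Y i)) {y z : ℝ}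
    (hy : |y - P 1| < d) (hz : |z - P 1| < d) :
    outerLevel P S X Y z - outerLevel P S X Y y =
      ∑ i, ((lowerRight (P 0) z (Y i) - lowerRight (P 0) z (X i)) -
        (lowerRight (P 0) y (Y i) - lowerRight (P 0) y (X i))) := by
  have h0 := sum_succ_sub fun i => lowerRight (P 0) y (S i) - lowerRight (P 0) z (S i)
  rw [outerLevel, outerLevel, ← Finset.sum_sub_distrib, ← add_zero (∑ i, (_ - _ - _)), ← h0,
    ← Finset.sum_add_distrib]
  refine Finset.sum_congr rfl fun i _ => ?_
  have h1 : rayCross (S i) (X i) !₂[P 0, z] - rayCross (S i) (X i) !₂[P 0, y] =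
      (lowerRight (P 0) y (X i) - lowerRight (P 0) z (X i)) -
        (lowerRight (P 0) y (S i) - lowerRight (P 0) z (S i)) := by
    rcases (h i).outside_left with e | e
    · rw [e, rayCross_self, rayCross_self]; ring
    · exact rayCross_vertical e hy hz
  have h2 : rayCross (Y i) (S (i + 1)) !₂[P 0, z] - rayCross (Y i) (S (i + 1)) !₂[P 0, y] =
      (lowerRight (P 0) y (S (i + 1)) - lowerRight (P 0) z (S (i + 1))) -
        (lowerRight (P 0) y (Y i) - lowerRight (P 0) z (Y i)) := by
    rcases (h i).outside_right with e | e
    · rw [e, rayCross_self, rayCross_self]; ring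
    · exact rayCross_vertical e hy hz
  linarith

/-- The constant `c` is what the end points of the inner parts cannot tell about the position of the
disk. It enters the area as a multiple of the full disk, and is controlled by `arc_depth_prefix` or,
without marks, by the winding number of the center. -/
lemma exists_outerLevel_eq (hd : 0 < d) (h : ∀ i, IsSplit P d (S i) (S (i + 1)) (X i) (Y i)) :
    ∃ c : ℤ, ∀ y, |y - P 1| < d → outerLevel P S X Y y =
      c + ∑ i, (lowerRight (P 0) y (Y i) - lowerRight (P 0) y (X i)) := by
  refine ⟨outerLevel P S X Y (P 1) -
    ∑ i, (lowerRight (P 0) (P 1) (Y i) - lowerRight (P 0) (P 1) (X i)), fun y hy => ?_⟩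
  have := outerLevel_sub h (y := P 1) (by simpa) hy
  rw [Finset.sum_sub_distrib] at this
  linarith

/-- Close to a level there is a lower level without end points of inner parts. -/
lemma exists_generic_level (hd : 0 < d) (h : ∀ i, IsSplit P d (S i) (S (i + 1)) (X i) (Y i)) {y : ℝ}
    (hy : |y - P 1| < d) : ∃ z, |z - P 1| < d ∧ outerLevel P S X Y z = outerLevel P S X Y y ∧
      (∀ i, level (X i) (Y i) z = level (X i) (Y i) y) ∧ (∀ i, X i 1 ≠ z) ∧ ∀ i, Y i 1 ≠ z := by
  obtain ⟨c, hc⟩ := exists_outerLevel_eq hd h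
  have h1 : ∀ᶠ z in 𝓝[<] y, ∀ i, (X i 1 < z ↔ X i 1 < y) ∧ X i 1 ≠ z :=
    eventually_all.2 fun i => eventually_lt_iff_of_left _ _
  have h2 : ∀ᶠ z in 𝓝[<] y, ∀ i, (Y i 1 < z ↔ Y i 1 < y) ∧ Y i 1 ≠ z :=
    eventually_all.2 fun i => eventually_lt_iff_of_left _ _
  have h3 : ∀ᶠ z in 𝓝[<] y, |z - P 1| < d := by
    have : ContinuousAt (fun z => |z - P 1|) y := by fun_prop
    exact nhdsWithin_le_nhds (this.eventually_lt_const hy)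
  obtain ⟨z, ⟨hz1, hz2⟩, hz3⟩ := ((h1.and h2).and h3).exists
  refine ⟨z, hz3, ?_, fun i => ?_, fun i => (hz1 i).2, fun i => (hz2 i).2⟩
  · rw [hc z hz3, hc y hy]
    unfold lowerRight
    simp only [(hz1 _).1, (hz2 _).1]
  · unfold level
    simp only [(hz1 _).1, (hz2 _).1]

/-- Just inside the right end of a chord no inner part lies farther to the right, so the outer count
is itself a winding number. The level is first made generic, so that inner parts cross it away from
the ends of the chord. -/
lemma outerLevel_eq_zero_or_one (hw : ∀ Q, winding S Q = 0 ∨ winding S Q = 1)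
    (h : ∀ i, IsSplit P d (S i) (S (i + 1)) (X i) (Y i)) {y : ℝ} (hy : |y - P 1| < d) :
    outerLevel P S X Y y = 0 ∨ outerLevel P S X Y y = 1 := by
  have hd : 0 < d := (abs_nonneg _).trans_lt hy
  obtain ⟨z, hz, hz1, hz2, hzX, hzY⟩ := exists_generic_level hd h hy
  rw [← hz1]
  have hev : ∀ i, ∀ᶠ x in 𝓝[<] (P 0 + halfChord P d z), rayCross (X i) (Y i) !₂[x, z] = 0 := by
    intro i
    by_cases hl : level (X i) (Y i) z = 0
    · filter_upwards with x
      rw [rayCross_eq_level]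
      simp [hl]
    · rcases (h i).inside with hi | ⟨hiX, hiY⟩
      · rw [hi, level_self] at hl; exact absurd rfl hl
      · have := (abs_lt.1 (abs_xAt_sub_lt hiX hiY hz hl (hzX i) (hzY i))).2
        filter_upwards [Ioo_mem_nhdsLT (show xAt (X i) (Y i) z < P 0 + halfChord P d z by linarith)]
          with x hx
        rw [rayCross_eq_level, if_neg]
        simpa using hx.1.le
  have hp := halfChord_pos hz
  obtain ⟨x, hx, hx'⟩ := ((eventually_all.2 hev).and (Ioo_mem_nhdsLT
    (show P 0 < P 0 + halfChord P d z by linarith))).exists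
  have hQ : dist (!₂[x, z] : Plane) P < d := by
    rw [dist_lt_iff_halfChord hd, abs_lt]
    simp only [Matrix.cons_val_zero, Matrix.cons_val_one, Matrix.cons_val_fin_one]
    constructor <;> linarith [hx'.1, hx'.2]
  have := winding_eq_outerLevel_add h hQ
  rw [Finset.sum_eq_zero fun i _ => hx i, add_zero] at this
  have e : (!₂[x, z] : Plane) 1 = z := by simp
  rw [e] at this
  rw [← this]
  exact hw _

/-- Just inside the left end of a chord every inner part that crosses the level lies to the right,
and the winding number contains all their levels. -/
lemma outerLevel_add_level_eq_zero_or_one (hw : ∀ Q, winding S Q = 0 ∨ winding S Q = 1)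
    (h : ∀ i, IsSplit P d (S i) (S (i + 1)) (X i) (Y i)) {y : ℝ} (hy : |y - P 1| < d) :
    outerLevel P S X Y y + ∑ i, level (X i) (Y i) y = 0 ∨
      outerLevel P S X Y y + ∑ i, level (X i) (Y i) y = 1 := by
  have hd : 0 < d := (abs_nonneg _).trans_lt hy
  obtain ⟨z, hz, hz1, hz2, hzX, hzY⟩ := exists_generic_level hd h hy
  rw [← hz1, ← Finset.sum_congr rfl fun i _ => hz2 i]
  have hev : ∀ i, ∀ᶠ x in 𝓝[>] (P 0 - halfChord P d z),
      rayCross (X i) (Y i) !₂[x, z] = level (X i) (Y i) z := by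
    intro i
    by_cases hl : level (X i) (Y i) z = 0
    · filter_upwards with x
      rw [rayCross_eq_level]
      simp [hl]
    · rcases (h i).inside with hi | ⟨hiX, hiY⟩
      · rw [hi, level_self] at hl; exact absurd rfl hl
      · have := (abs_lt.1 (abs_xAt_sub_lt hiX hiY hz hl (hzX i) (hzY i))).1
        filter_upwards [Ioo_mem_nhdsGT (show P 0 - halfChord P d z < xAt (X i) (Y i) z by linarith)]
          with x hx
        rw [rayCross_eq_level, if_pos]
        · simp
        · simpa using hx.2
  have hp := halfChord_pos hz
  obtain ⟨x, hx, hx'⟩ := ((eventually_all.2 hev).and (Ioo_mem_nhdsGT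
    (show P 0 - halfChord P d z < P 0 by linarith))).exists
  have hQ : dist (!₂[x, z] : Plane) P < d := by
    rw [dist_lt_iff_halfChord hd, abs_lt]
    simp only [Matrix.cons_val_zero, Matrix.cons_val_one, Matrix.cons_val_fin_one]
    constructor <;> linarith [hx'.1, hx'.2]
  have := winding_eq_outerLevel_add h hQ
  rw [Finset.sum_congr rfl fun i _ => hx i] at this
  have e : (!₂[x, z] : Plane) 1 = z := by simp
  rw [e] at this
  rw [← this]
  exact hw _

end

/-! ### Integration of the winding number over the disk -/

lemma intervalIntegrable_ite_lt {f : ℝ → ℝ} (hf : Continuous f) (a b c : ℝ) :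
    IntervalIntegrable (fun y => if a < y then f y else 0) volume b c := by
  have := hf.intervalIntegrable (μ := volume) b c
  rw [intervalIntegrable_iff] at this ⊢
  exact this.indicator measurableSet_Ioi

lemma integral_ite_lt {f : ℝ → ℝ} (hf : Continuous f) {a b c : ℝ} (hba : b ≤ a) (hac : a ≤ c) :
    ∫ y in b..c, (if a < y then f y else 0) = ∫ y in a..c, f y := by
  rw [← intervalIntegral.integral_add_adjacent_intervals (intervalIntegrable_ite_lt hf a b a)
    (intervalIntegrable_ite_lt hf a a c)]
  have h1 : ∫ y in b..a, (if a < y then f y else 0) = 0 := by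
    rw [intervalIntegral.integral_of_le hba]
    refine setIntegral_eq_zero_of_forall_eq_zero fun y hy => if_neg hy.2.not_gt
  have h2 : ∫ y in a..c, (if a < y then f y else 0) = ∫ y in a..c, f y := by
    rw [intervalIntegral.integral_of_le hac, intervalIntegral.integral_of_le hac]
    exact setIntegral_congr_fun measurableSet_Ioc fun y hy => if_pos hy.1
  rw [h1, h2, zero_add]

lemma integral_xAt (A B : Plane) :
    ∫ y in (A 1)..(B 1), xAt A B y = (A 0 + B 0) / 2 * (B 1 - A 1) := by
  by_cases h : A 1 = B 1
  · rw [h]; simp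
  have h1 : B 1 - A 1 ≠ 0 := sub_ne_zero.2 (Ne.symm h)
  have hd : ∀ y, HasDerivAt (fun y => A 0 * y + (y - A 1) ^ 2 / (B 1 - A 1) * (B 0 - A 0) / 2)
      (xAt A B y) y := by
    intro y
    have := ((hasDerivAt_id y).const_mul (A 0)).add (((((hasDerivAt_id y).sub_const (A 1)).pow 2
      ).div_const (B 1 - A 1)).mul_const (B 0 - A 0) |>.div_const 2)
    exact this.congr_deriv (by simp [xAt]; ring)
  rw [intervalIntegral.integral_eq_sub_of_hasDerivAt (fun y _ => hd y)
    ((continuous_xAt A B).intervalIntegrable _ _)]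
  field_simp
  ring

/-- The integral of `halfChord` from the bottom of the disk. -/
def chordPrimitive (P : Plane) (d y : ℝ) : ℝ := ∫ t in (P 1 - d)..y, halfChord P d t

/-- The contribution of an end point of an inner part of the boundary to the area of the
intersection with the disk. -/
def endPotential (P : Plane) (d : ℝ) (R : Plane) : ℝ :=
  R 0 * R 1 / 2 - P 0 * R 1 + chordPrimitive P d (R 1) +
    if P 0 < R 0 then 2 * (chordPrimitive P d (P 1 + d) - chordPrimitive P d (R 1)) else 0

lemma chordPrimitive_sub (P : Plane) (d y z : ℝ) :
    chordPrimitive P d z - chordPrimitive P d y = ∫ t in y..z, halfChord P d t := by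
  have hi := fun a b => (continuous_halfChord P d).intervalIntegrable (μ := volume) a b
  exact intervalIntegral.integral_interval_sub_left (hi _ _) (hi _ _)

/-- By convexity of the disk the crossing lies on the chord. The integral is the level times the
length of the chord to the left of the crossing. -/
lemma integral_chord_rayCross {P X Y : Plane} {d y : ℝ} (h : X = Y ∨ (dist X P ≤ d ∧ dist Y P ≤ d))
    (hy : |y - P 1| < d) :
    ∫ x in (P 0 - halfChord P d y)..(P 0 + halfChord P d y), (rayCross X Y !₂[x, y] : ℝ) =
      level X Y y * (xAt X Y y - P 0 + halfChord P d y) := by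
  by_cases hl : level X Y y = 0
  · have : ∀ x, rayCross X Y !₂[x, y] = 0 := fun x => by rw [rayCross_eq_level]; simp [hl]
    simp [this, hl]
  rcases h with rfl | ⟨hX, hY⟩
  · exact absurd (level_self X y) hl
  have hd : 0 < d := (abs_nonneg _).trans_lt hy
  have hmem : (!₂[xAt X Y y, y] : Plane) ∈ segment ℝ X Y := by
    unfold level at hl
    rcases lt_or_ge (X 1) y with h1 | h1 <;> rcases lt_or_ge (Y 1) y with h2 | h2
    · simp [h1, h2] at hl
    · exact xAt_mem_segment (h1.trans_le h2) h1.le h2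
    · rw [segment_symm, ← xAt_swap (h2.trans_le h1).ne']
      exact xAt_mem_segment (h2.trans_le h1) h2.le h1
    · simp [h1.not_gt, h2.not_gt] at hl
  have hb := (convex_closedBall P d).segment_subset (Metric.mem_closedBall.2 hX)
    (Metric.mem_closedBall.2 hY) hmem
  rw [Metric.mem_closedBall, dist_le_iff_halfChord hd (by simpa using hy.le), abs_le] at hb
  simp only [Matrix.cons_val_zero, Matrix.cons_val_one, Matrix.cons_val_fin_one] at hb
  have hp := halfChord_nonneg P d y
  have e : ∀ x, (rayCross X Y !₂[x, y] : ℝ) =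
      Set.indicator (Set.Iio (xAt X Y y)) (fun _ => (level X Y y : ℝ)) x := by
    intro x
    rw [rayCross_eq_level]
    simp only [Set.indicator, Set.mem_Iio, Matrix.cons_val_zero, Matrix.cons_val_one,
      Matrix.cons_val_fin_one]
    split_ifs <;> simp
  simp only [e]
  rw [intervalIntegral.integral_of_le (by linarith), integral_Ioc_eq_integral_Ioo,
    setIntegral_indicator measurableSet_Iio, setIntegral_const,
    show Set.Ioo (P 0 - halfChord P d y) (P 0 + halfChord P d y) ∩ Set.Iio (xAt X Y y) =
      Set.Ioo (P 0 - halfChord P d y) (xAt X Y y) by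
        ext x; simp only [Set.mem_inter_iff, Set.mem_Ioo, Set.mem_Iio]
        constructor
        · rintro ⟨⟨h1, h2⟩, h3⟩; exact ⟨h1, h3⟩
        · rintro ⟨h1, h2⟩; exact ⟨⟨h1, by linarith⟩, h2⟩,
    Real.volume_real_Ioo_of_le (by linarith), smul_eq_mul]
  ring

/-- The integrand that an inner part contributes, apart from the constant. -/
def partIntegrand (P : Plane) (d : ℝ) (X Y : Plane) (y : ℝ) : ℝ :=
  2 * halfChord P d y * (lowerRight (P 0) y Y - lowerRight (P 0) y X) +
    level X Y y * (xAt X Y y - P 0 + halfChord P d y)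

lemma lowerRight_mul (x y c : ℝ) (R : Plane) :
    c * (lowerRight x y R : ℝ) = if x < R 0 then (if R 1 < y then c else 0) else 0 := by
  unfold lowerRight
  split_ifs <;> first | (exfalso; grind) | simp

/-- Written as functions cut off below the ordinate of one end point each, the terms integrate to
differences of primitives. -/
lemma partIntegrand_eq (P : Plane) (d : ℝ) (X Y : Plane) : partIntegrand P d X Y = fun y =>
    ((if P 0 < Y 0 then (if Y 1 < y then 2 * halfChord P d y else 0) else 0) -
      (if P 0 < X 0 then (if X 1 < y then 2 * halfChord P d y else 0) else 0)) +
    ((if X 1 < y then xAt X Y y - P 0 + halfChord P d y else 0) -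
      (if Y 1 < y then xAt X Y y - P 0 + halfChord P d y else 0)) := by
  ext y
  rw [partIntegrand, mul_sub, lowerRight_mul, lowerRight_mul]
  congr 1
  unfold level
  push_cast
  split_ifs <;> ring

lemma intervalIntegrable_right (P R : Plane) (d a b : ℝ) : IntervalIntegrable (fun y =>
    if P 0 < R 0 then (if R 1 < y then 2 * halfChord P d y else 0) else 0) volume a b := by
  split_ifs
  · exact intervalIntegrable_ite_lt ((continuous_halfChord P d).const_mul 2) _ _ _
  · exact intervalIntegrable_const

lemma continuous_xAt_add (P X Y : Plane) (d : ℝ) :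
    Continuous fun y => xAt X Y y - P 0 + halfChord P d y :=
  ((continuous_xAt X Y).sub continuous_const).add (continuous_halfChord P d)

lemma intervalIntegrable_partIntegrand (P : Plane) (d : ℝ) (X Y : Plane) (a b : ℝ) :
    IntervalIntegrable (partIntegrand P d X Y) volume a b := by
  rw [partIntegrand_eq]
  exact ((intervalIntegrable_right P Y d a b).sub (intervalIntegrable_right P X d a b)).add
    ((intervalIntegrable_ite_lt (continuous_xAt_add P X Y d) _ a b).sub
      (intervalIntegrable_ite_lt (continuous_xAt_add P X Y d) _ a b))

lemma integral_right {P R : Plane} {d : ℝ} (h : dist R P ≤ d) :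
    ∫ y in (P 1 - d)..(P 1 + d),
      (if P 0 < R 0 then (if R 1 < y then 2 * halfChord P d y else 0) else 0) =
    if P 0 < R 0 then 2 * (chordPrimitive P d (P 1 + d) - chordPrimitive P d (R 1)) else 0 := by
  have hb := abs_le.1 (abs_sub_le_of_dist_le h)
  split_ifs
  · rw [integral_ite_lt ((continuous_halfChord P d).const_mul 2) (by linarith) (by linarith),
      intervalIntegral.integral_const_mul, chordPrimitive_sub]
  · simp

/-- The integral of `xAt` is `shoelace X Y / 2` up to the difference of `R 0 * R 1 / 2` at `Y` and
`X`. Everything else is also a difference of values at the two end points, and `endPotential`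
collects it. -/
lemma integral_partIntegrand {P X Y : Plane} {d : ℝ}
    (h : X = Y ∨ (dist X P ≤ d ∧ dist Y P ≤ d)) :
    ∫ y in (P 1 - d)..(P 1 + d), partIntegrand P d X Y y =
      shoelace X Y / 2 + (endPotential P d Y - endPotential P d X) := by
  rcases h with rfl | ⟨hX, hY⟩
  · have : ∀ y, partIntegrand P d X X y = 0 := fun y => by simp [partIntegrand, level_self]
    simp [this, shoelace_self]
  have hbX := abs_le.1 (abs_sub_le_of_dist_le hX)
  have hbY := abs_le.1 (abs_sub_le_of_dist_le hY)
  have hc := continuous_xAt_add P X Y d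
  have hch := continuous_halfChord P d
  rw [partIntegrand_eq, intervalIntegral.integral_add
      ((intervalIntegrable_right P Y d _ _).sub (intervalIntegrable_right P X d _ _))
      ((intervalIntegrable_ite_lt hc _ _ _).sub (intervalIntegrable_ite_lt hc _ _ _)),
    intervalIntegral.integral_sub (intervalIntegrable_right P Y d _ _)
      (intervalIntegrable_right P X d _ _),
    intervalIntegral.integral_sub (intervalIntegrable_ite_lt hc _ _ _)
      (intervalIntegrable_ite_lt hc _ _ _),
    integral_right hX, integral_right hY, integral_ite_lt hc (by linarith) (by linarith),
    integral_ite_lt hc (by linarith) (by linarith)]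
  have e1 := intervalIntegral.integral_add_adjacent_intervals (μ := volume)
    (hc.intervalIntegrable (X 1) (Y 1)) (hc.intervalIntegrable (Y 1) (P 1 + d))
  have e2 : ∫ y in (X 1)..(Y 1), (xAt X Y y - P 0 + halfChord P d y) =
      (X 0 + Y 0) / 2 * (Y 1 - X 1) - P 0 * (Y 1 - X 1) +
        (chordPrimitive P d (Y 1) - chordPrimitive P d (X 1)) := by
    rw [intervalIntegral.integral_add (f := fun y => xAt X Y y - P 0) (((continuous_xAt X Y).sub
      continuous_const).intervalIntegrable _ _) (hch.intervalIntegrable _ _),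
      intervalIntegral.integral_sub ((continuous_xAt X Y).intervalIntegrable _ _)
      intervalIntegrable_const, integral_xAt, chordPrimitive_sub, intervalIntegral.integral_const,
      smul_eq_mul]
    ring
  rw [← e1, e2]
  unfold endPotential shoelace
  ring

lemma intervalIntegrable_sum {ι : Type*} [Fintype ι] {f : ι → ℝ → ℝ} {a b : ℝ}
    (h : ∀ i, IntervalIntegrable (f i) volume a b) :
    IntervalIntegrable (fun x => ∑ i, f i x) volume a b := by
  have := IntervalIntegrable.sum Finset.univ fun i _ => h i
  rwa [Finset.sum_fn] at this

section
variable {n : ℕ} [NeZero n] {S X Y : Fin n → Plane} {P : Plane} {d : ℝ}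

/-- On the chord at ordinate `y` the winding number is the outer level, which is constant there,
plus the crossings with inner parts. The constant `c` integrates to `c` times the area of the disk;
the end point terms of the outer level are distributed among the inner parts as the first summand of
`partIntegrand`. -/
theorem integral_winding (hd : 0 < d) (h : ∀ i, IsSplit P d (S i) (S (i + 1)) (X i) (Y i)) {c : ℤ}
    (hc : ∀ y, |y - P 1| < d → outerLevel P S X Y y =
      c + ∑ i, (lowerRight (P 0) y (Y i) - lowerRight (P 0) y (X i))) :
    ∫ Q in Metric.ball P d, (winding S Q : ℝ) =
      c * (2 * chordPrimitive P d (P 1 + d)) + ∑ i, shoelace (X i) (Y i) / 2 +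
        ∑ i, (endPotential P d (Y i) - endPotential P d (X i)) := by
  have hslice : ∀ y, |y - P 1| < d →
      ∫ x in (P 0 - halfChord P d y)..(P 0 + halfChord P d y), (winding S !₂[x, y] : ℝ) =
        c * (2 * halfChord P d y) + ∑ i, partIntegrand P d (X i) (Y i) y := by
    intro y hy
    have hp := halfChord_nonneg P d y
    have e : ∀ x ∈ Set.uIoo (P 0 - halfChord P d y) (P 0 + halfChord P d y),
        (winding S !₂[x, y] : ℝ) = (outerLevel P S X Y y : ℝ) +
          ∑ i, (rayCross (X i) (Y i) !₂[x, y] : ℝ) := by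
      intro x hx
      rw [Set.uIoo_of_le (by linarith), Set.mem_Ioo] at hx
      rw [winding_eq_outerLevel_add h (Q := !₂[x, y])]
      · push_cast; simp
      · rw [dist_lt_iff_halfChord hd, abs_lt]
        simp only [Matrix.cons_val_zero, Matrix.cons_val_one, Matrix.cons_val_fin_one]
        constructor <;> linarith [hx.1, hx.2]
    have hi : ∀ i, IntervalIntegrable (fun x => (rayCross (X i) (Y i) !₂[x, y] : ℝ)) volume
        (P 0 - halfChord P d y) (P 0 + halfChord P d y) := by
      intro i
      have hm : Measurable fun x : ℝ => (rayCross (X i) (Y i) !₂[x, y] : ℝ) :=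
        (measurable_from_top (f := fun k : ℤ => (k : ℝ))).comp
          ((measurable_rayCross _ _).comp (by fun_prop))
      rw [intervalIntegrable_iff]
      refine Measure.integrableOn_of_bounded (M := 1) ?_ hm.aestronglyMeasurable
        (by filter_upwards with x using abs_rayCross_le _ _ _)
      rw [Set.uIoc_of_le (by linarith)]
      exact measure_Ioc_lt_top.ne
    rw [intervalIntegral.integral_congr_uIoo e, intervalIntegral.integral_add
      intervalIntegrable_const (intervalIntegrable_sum hi),
      intervalIntegral.integral_finsetSum fun i _ => hi i]
    simp only [fun i => integral_chord_rayCross (h i).inside hy, partIntegrand]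
    rw [Finset.sum_add_distrib, ← Finset.mul_sum, hc y hy]
    simp
    ring
  rw [integral_ball P hd (integrableOn_winding S P d), intervalIntegral.integral_congr_uIoo
    (g := fun y => c * (2 * halfChord P d y) + ∑ i, partIntegrand P d (X i) (Y i) y)]
  · rw [intervalIntegral.integral_add
      (((continuous_halfChord P d).const_mul 2).const_mul _ |>.intervalIntegrable _ _)
      (intervalIntegrable_sum fun i => intervalIntegrable_partIntegrand _ _ _ _ _ _),
      intervalIntegral.integral_finsetSum fun i _ => intervalIntegrable_partIntegrand _ _ _ _ _ _,
      intervalIntegral.integral_const_mul, intervalIntegral.integral_const_mul,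
      Finset.sum_congr rfl fun i _ => integral_partIntegrand (h i).inside, Finset.sum_add_distrib,
      chordPrimitive]
    ring
  · intro y hy
    rw [Set.uIoo_of_le (by linarith), Set.mem_Ioo] at hy
    exact hslice y (abs_lt.2 ⟨by linarith, by linarith⟩)

end

end PolygonDistance
end

noncomputable section
namespace PolygonDistance

/-! ### Areas -/

/-- The signed area enclosed by a polygonal line. -/
def signedArea {n : ℕ} [NeZero n] (S : Fin n → Plane) : ℝ := ∑ i, shoelace (S i) (S (i + 1)) / 2

/-- The frontier of a convex set is null, and a segment has empty interior because there are points
off its line close to each of its points. -/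
lemma volume_segment {A B : Plane} (h : A ≠ B) : volume (segment ℝ A B) = 0 := by
  have hc : IsClosed (segment ℝ A B) := (isCompact_segment A B).isClosed
  have hi : interior (segment ℝ A B) = ∅ := by
    rw [Set.eq_empty_iff_forall_notMem]
    intro Q hQ
    obtain ⟨T, hT, hT0⟩ := exists_mem_side h (cross_eq_zero_of_mem_segment (interior_subset hQ))
      one_ne_zero (isOpen_interior.mem_nhds hQ)
    rw [cross_eq_zero_of_mem_segment (interior_subset hT)] at hT0
    simp at hT0
  have := (convex_segment (𝕜 := ℝ) A B).addHaar_frontier volume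
  rwa [hc.frontier_eq, hi, Set.sdiff_empty] at this

section
variable {n : ℕ} [NeZero n] {S : Fin n → Plane}

lemma IsSimplePolygon.volume_boundary (hS : IsSimplePolygon S) : volume (boundary S) = 0 :=
  measure_iUnion_null fun i => volume_segment (hS.ne_succ i)

lemma measurableSet_winding_ne_zero (S : Fin n → Plane) :
    MeasurableSet {Q | winding S Q ≠ 0} :=
  (measurable_winding S) (measurableSet_singleton 0).compl

lemma planeRegion_ae_eq (hS : IsSimplePolygon S)
    (h : ∀ Q ∉ boundary S, (Q ∈ planeRegion S ↔ winding S Q ≠ 0)) :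
    planeRegion S =ᵐ[volume] {Q | winding S Q ≠ 0} := by
  have : ∀ᵐ Q ∂(volume : Measure Plane), Q ∉ boundary S :=
    measure_eq_zero_iff_ae_notMem.1 hS.volume_boundary
  filter_upwards [this] with Q hQ
  exact propext (h Q hQ)

lemma integral_winding_eq {ε : ℤ} (hS : IsSimplePolygon S)
    (hw : ∀ Q, winding S Q = 0 ∨ winding S Q = ε)
    (h : ∀ Q ∉ boundary S, (Q ∈ planeRegion S ↔ winding S Q ≠ 0)) (hε : ε ≠ 0)
    (B : Set Plane) :
    ∫ Q in B, (winding S Q : ℝ) = ε * volume.real (planeRegion S ∩ B) := by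
  have e : ∀ Q, (winding S Q : ℝ) = {Q | winding S Q ≠ 0}.indicator (fun _ => (ε : ℝ)) Q := by
    intro Q
    rcases hw Q with h | h
    · rw [Set.indicator_of_notMem (by simp [h]), h, Int.cast_zero]
    · rw [Set.indicator_of_mem (by simp [h, hε]), h]
  simp only [e]
  rw [setIntegral_indicator (measurableSet_winding_ne_zero S), setIntegral_const, smul_eq_mul,
    mul_comm, Set.inter_comm]
  congr 1
  exact measureReal_congr ((planeRegion_ae_eq hS h).symm.inter (ae_eq_refl B))

lemma isSplit_of_dist_le {P A B : Plane} {d : ℝ} (hA : dist A P ≤ d) (hB : dist B P ≤ d) :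
    IsSplit P d A B A B :=
  ⟨left_mem_segment ℝ _ _, right_mem_segment ℝ _ _, Or.inr ⟨hA, hB⟩, Or.inl rfl, Or.inl rfl⟩

/-- If the disk contains all vertices, there are no outer parts and the end potentials cancel around
the polygon: the shoelace formula. -/
lemma integral_winding_of_vertices_mem {P : Plane} {d : ℝ} (hd : 0 < d)
    (h : ∀ i, dist (S i) P ≤ d) :
    ∫ Q in Metric.ball P d, (winding S Q : ℝ) = signedArea S := by
  have h0 : ∀ f : Plane → ℤ, ∑ i, (f (S (i + 1)) - f (S i)) = 0 := fun f =>
    sum_succ_sub fun i => f (S i)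
  have h1 : ∀ f : Plane → ℝ, ∑ i, (f (S (i + 1)) - f (S i)) = 0 := fun f =>
    sum_succ_sub fun i => f (S i)
  rw [integral_winding (X := S) (Y := fun i => S (i + 1)) (c := 0) hd
    (fun i => isSplit_of_dist_le (h i) (h (i + 1))), h1, signedArea]
  · simp
  · intro y hy
    rw [h0]
    simp [outerLevel, rayCross_self]

lemma isBounded_planeRegion (S : Fin n → Plane)
    (h : ∀ Q ∉ boundary S, (Q ∈ planeRegion S ↔ winding S Q ≠ 0)) :
    ∃ M : ℝ, 0 < M ∧ (∀ i, ‖S i‖ ≤ M) ∧ planeRegion S ⊆ Metric.ball 0 M := by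
  obtain ⟨M, hM⟩ := exists_winding_eq_zero S
  have hr : ∀ Q ∈ planeRegion S, ‖Q‖ ≤ M := fun Q hQ => by
    by_contra! hn
    obtain ⟨h1, h2⟩ := hM Q hn
    exact (h Q h1).1 hQ h2
  have hb : ∀ i, ‖S i‖ ≤ M := fun i => hr _ (Or.inl (segment_subset_boundary S i
    (left_mem_segment ℝ _ _)))
  refine ⟨M + 1, by linarith [norm_nonneg (S 0), hb 0], fun i => by linarith [hb i],
    fun Q hQ => ?_⟩
  rw [mem_ball_zero_iff]
  linarith [hr Q hQ]

/-- The two orientations of a simple polygon and the sign of the area. -/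
theorem IsSimplePolygon.orientation (hS : IsSimplePolygon S) :
    ∃ ε : ℤ, (ε = 1 ∨ ε = -1) ∧ (ε = 1 → PositivelyOriented S) ∧
      signedArea S = ε * volume.real (planeRegion S) ∧ 0 < volume.real (planeRegion S) ∧
      (InteriorOnLeft S → ε = 1) := by
  obtain ⟨ε, hε, hw, hb, ⟨Q₀, hQ₀, hQ₀w⟩, hside⟩ := hS.exists_orientation
  have hε0 : ε ≠ 0 := by rcases hε with rfl | rfl <;> norm_num
  have hw' := winding_eq_zero_or hS hw
  have hmem : ∀ Q ∉ boundary S, (Q ∈ planeRegion S ↔ winding S Q ≠ 0) := by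
    intro Q hQ
    rw [mem_planeRegion_iff, ← hb Q hQ]
    simp [hQ]
  obtain ⟨M, hM, hSM, hRM⟩ := isBounded_planeRegion S hmem
  refine ⟨ε, hε, ?_, ?_, ?_, ?_⟩
  · rintro rfl
    refine ⟨hw', fun Q hQ => ?_, Q₀, hQ₀, hQ₀w⟩
    rw [hmem Q hQ]
    rcases hw' Q with h | h <;> simp [h]
  -- Over a ball that contains the vertices and the region, the integral of the winding number is
  -- the signed area on one hand and `ε` times the area on the other.
  · rw [← integral_winding_of_vertices_mem hM (P := 0) (by simpa using hSM),
      integral_winding_eq hS hw' hmem hε0,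
      Set.inter_eq_left.2 hRM]
  · obtain ⟨δ, hδ, hj⟩ := joinedIn_of_mem_ball hQ₀
    have hsub : Metric.ball Q₀ δ ⊆ planeRegion S := fun R hR => by
      have := hj R hR
      rw [hmem R this.target_mem, ← winding_eq_of_joinedIn this, hQ₀w]
      exact hε0
    have h1 : volume (planeRegion S) ≠ ⊤ :=
      ((measure_mono hRM).trans_lt measure_ball_lt_top).ne
    exact ENNReal.toReal_pos (((Metric.measure_ball_pos volume Q₀ hδ).trans_le
      (measure_mono hsub)).ne') h1
  -- For `ε = -1` the points just to the left of an edge would have winding number `0` and lie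
  -- outside the region.
  · intro hl
    have hM := midpoint_mem_openSegment (𝕜 := ℝ) (S 0) (S (0 + 1))
    set P := midpoint ℝ (S 0) (S (0 + 1))
    obtain ⟨δ, hδ, hd⟩ := hside 0 P hM
    have hc : ContinuousAt (fun t : ℝ => P + t • leftNormal (S (0 + 1) - S 0)) 0 := by fun_prop
    have h1 : ∀ᶠ t in 𝓝[>] (0 : ℝ), P + t • leftNormal (S (0 + 1) - S 0) ∈ Metric.ball P δ :=
      nhdsWithin_le_nhds (hc (by simpa using Metric.ball_mem_nhds P hδ))
    obtain ⟨t, ⟨ht1, ht2⟩, ht0⟩ := ((h1.and (hl 0 P hM)).and self_mem_nhdsWithin).exists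
    have ht0 : 0 < t := ht0
    have hcr : 0 < cross (S 0) (S (0 + 1)) (P + t • leftNormal (S (0 + 1) - S 0)) := by
      rw [cross_add_smul_leftNormal,
        cross_eq_zero_of_mem_segment (openSegment_subset_segment ℝ _ _ hM), zero_add]
      exact mul_pos ht0 (sq_add_sq_pos_of_ne (hS.ne_succ 0))
    obtain ⟨h3, h4⟩ := hd _ ht1 hcr
    have := (hmem _ h3).1 (interior_subset ht2)
    rcases hε with rfl | rfl
    · rfl
    · omega

lemma IsSimplePolygon.positivelyOriented_of_interiorOnLeft (hS : IsSimplePolygon S)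
    (h : InteriorOnLeft S) : PositivelyOriented S := by
  obtain ⟨ε, -, h1, -, -, h2⟩ := hS.orientation
  exact h1 (h2 h)

lemma IsSimplePolygon.volume_pos (hS : IsSimplePolygon S) : 0 < volume.real (planeRegion S) := by
  obtain ⟨ε, -, -, -, h, -⟩ := hS.orientation
  exact h

/-- The area of the region is positive, so `ε = -1` would make the signed area negative. This
justifies the sign test of the algorithm in space. -/
lemma IsSimplePolygon.positivelyOriented_of_signedArea (hS : IsSimplePolygon S)
    (h : 0 ≤ signedArea S) : PositivelyOriented S := by
  obtain ⟨ε, hε, h1, h2, h3, -⟩ := hS.orientation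
  refine h1 (hε.resolve_right ?_)
  rintro rfl
  push_cast at h2
  linarith

lemma PositivelyOriented.region_iff (h : PositivelyOriented S) :
    ∀ Q ∉ boundary S, (Q ∈ planeRegion S ↔ winding S Q ≠ 0) := by
  intro Q hQ
  rw [h.mem_region_iff Q hQ]
  rcases h.winding_eq Q with e | e <;> simp [e]

lemma PositivelyOriented.signedArea_eq (hS : IsSimplePolygon S) (h : PositivelyOriented S) :
    signedArea S = volume.real (planeRegion S) := by
  obtain ⟨M, hM, hSM, hRM⟩ := isBounded_planeRegion S h.region_iff
  rw [← integral_winding_of_vertices_mem hM (P := 0) (by simpa using hSM),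
      integral_winding_eq (ε := 1) hS h.winding_eq h.region_iff one_ne_zero,
      Set.inter_eq_left.2 hRM]
  simp

lemma PositivelyOriented.integral_winding (hS : IsSimplePolygon S) (h : PositivelyOriented S)
    (P : Plane) (d : ℝ) : ∫ Q in Metric.ball P d, (winding S Q : ℝ) =
      volume.real (planeRegion S ∩ Metric.closedBall P d) := by
  rw [integral_winding_eq (ε := 1) hS h.winding_eq h.region_iff one_ne_zero, Int.cast_one, one_mul]
  have : (Metric.ball P d : Set Plane) =ᵐ[volume] Metric.closedBall P d := by
    refine ae_eq_of_subset_of_measure_ge Metric.ball_subset_closedBall ?_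
      Metric.isOpen_ball.measurableSet.nullMeasurableSet measure_closedBall_lt_top.ne
    rw [Measure.addHaar_closedBall_eq_addHaar_ball]
  exact measureReal_congr ((ae_eq_refl _).inter this)

lemma PositivelyOriented.isBounded (h : PositivelyOriented S) :
    Bornology.IsBounded (planeRegion S) := by
  obtain ⟨M, -, -, hRM⟩ := isBounded_planeRegion S h.region_iff
  exact Metric.isBounded_ball.subset hRM

/-- A point off the boundary is in the interior of the region iff it is in the region. -/
lemma PositivelyOriented.mem_interior_iff (h : PositivelyOriented S) {Q : Plane}
    (hQ : Q ∉ boundary S) : Q ∈ interior (planeRegion S) ↔ winding S Q = 1 := by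
  rw [← h.mem_region_iff Q hQ]
  refine ⟨fun hi => interior_subset hi, fun hm => ?_⟩
  obtain ⟨δ, hδ, hj⟩ := joinedIn_of_mem_ball hQ
  refine mem_interior.2 ⟨Metric.ball Q δ, fun R hR => ?_, Metric.isOpen_ball,
    Metric.mem_ball_self hδ⟩
  rw [h.mem_region_iff R (hj R hR).target_mem, ← winding_eq_of_joinedIn (hj R hR),
    ← h.mem_region_iff Q hQ]
  exact hm

end

end PolygonDistance
end

noncomputable section
namespace PolygonDistance

/-! ### Values and step counts of computations -/

section
variable {α β : Type}

@[simp] lemma Timed.val_bind (t : Timed α) (f : α → Timed β) : (t >>= f).val = (f t.val).val := rfl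

@[simp] lemma Timed.cost_bind (t : Timed α) (f : α → Timed β) :
    (t >>= f).cost = t.cost + (f t.val).cost := rfl

@[simp] lemma Timed.val_pure (a : α) : (pure a : Timed α).val = a := rfl

@[simp] lemma Timed.cost_pure (a : α) : (pure a : Timed α).cost = 0 := rfl

@[simp] lemma tick_cost (k : ℕ) : (tick k).cost = k := rfl

@[simp] lemma Timed.val_ite (p : Prop) [Decidable p] (s t : Timed α) :
    (if p then s else t).val = if p then s.val else t.val := apply_ite Timed.val p s t

@[simp] lemma Timed.cost_ite (p : Prop) [Decidable p] (s t : Timed α) :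
    (if p then s else t).cost = if p then s.cost else t.cost := apply_ite Timed.cost p s t

end

@[simp] lemma RExpr.val_run (e : RExpr) : e.run.val = e.eval := rfl

@[simp] lemma RExpr.cost_run (e : RExpr) : e.run.cost = e.ops := rfl

@[simp] lemma testLt_iff (a b : RExpr) : (testLt a b).val = true ↔ a.eval < b.eval :=
  decide_eq_true_iff

@[simp] lemma testLe_iff (a b : RExpr) : (testLe a b).val = true ↔ a.eval ≤ b.eval :=
  decide_eq_true_iff

@[simp] lemma testEq_iff (a b : RExpr) : (testEq a b).val = true ↔ a.eval = b.eval :=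
  decide_eq_true_iff

@[simp] lemma testLt_cost (a b : RExpr) : (testLt a b).cost = a.ops + b.ops + 1 := rfl

@[simp] lemma testLe_cost (a b : RExpr) : (testLe a b).cost = a.ops + b.ops + 1 := rfl

@[simp] lemma testEq_cost (a b : RExpr) : (testEq a b).cost = a.ops + b.ops + 1 := rfl

namespace RExpr

@[simp] lemma eval_lit (x : ℝ) : (lit x).eval = x := rfl
@[simp] lemma eval_zero : (0 : RExpr).eval = 0 := rfl
@[simp] lemma eval_neg (a : RExpr) : (-a).eval = -a.eval := rfl
@[simp] lemma eval_add (a b : RExpr) : (a + b).eval = a.eval + b.eval := rfl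
@[simp] lemma eval_sub (a b : RExpr) : (a - b).eval = a.eval - b.eval := rfl
@[simp] lemma eval_mul (a b : RExpr) : (a * b).eval = a.eval * b.eval := rfl
@[simp] lemma eval_div (a b : RExpr) : (a / b).eval = a.eval / b.eval := rfl
@[simp] lemma eval_sqrt (a : RExpr) : (RExpr.sqrt a).eval = Real.sqrt a.eval := rfl
@[simp] lemma eval_arccos (a : RExpr) : (RExpr.arccos a).eval = Real.arccos a.eval := rfl
@[simp] lemma ops_lit (x : ℝ) : (lit x).ops = 1 := rfl
@[simp] lemma ops_zero : (0 : RExpr).ops = 1 := rfl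
@[simp] lemma ops_neg (a : RExpr) : (-a).ops = a.ops + 1 := rfl
@[simp] lemma ops_add (a b : RExpr) : (a + b).ops = a.ops + b.ops + 1 := rfl
@[simp] lemma ops_sub (a b : RExpr) : (a - b).ops = a.ops + b.ops + 1 := rfl
@[simp] lemma ops_mul (a b : RExpr) : (a * b).ops = a.ops + b.ops + 1 := rfl
@[simp] lemma ops_div (a b : RExpr) : (a / b).ops = a.ops + b.ops + 1 := rfl
@[simp] lemma ops_sqrt (a : RExpr) : (RExpr.sqrt a).ops = a.ops + 1 := rfl
@[simp] lemma ops_arccos (a : RExpr) : (RExpr.arccos a).ops = a.ops + 1 := rfl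

end RExpr

@[simp] lemma xOf_eval (A : Plane) : (xOf A).eval = A 0 := rfl
@[simp] lemma yOf_eval (A : Plane) : (yOf A).eval = A 1 := rfl
@[simp] lemma xOf_ops (A : Plane) : (xOf A).ops = 1 := rfl
@[simp] lemma yOf_ops (A : Plane) : (yOf A).ops = 1 := rfl

/-- The scalar product of `AB` and `CD`. -/
def dotProd (A B C D : Plane) : ℝ := (B 0 - A 0) * (D 0 - C 0) + (B 1 - A 1) * (D 1 - C 1)

@[simp] lemma dot_eval (A B C D : Plane) : (dot A B C D).eval = dotProd A B C D := rfl
@[simp] lemma dot_ops (A B C D : Plane) : (dot A B C D).ops = 15 := rfl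

@[simp] lemma len_eval (A B : Plane) : (len A B).eval = dist A B := by
  rw [len, RExpr.eval_sqrt, dot_eval, ← Real.sqrt_sq (dist_nonneg (x := A) (y := B)), dist_sq_eq,
    dotProd]
  congr 1; ring

@[simp] lemma len_ops (A B : Plane) : (len A B).ops = 16 := rfl

@[simp] lemma pointAt_val (A B : Plane) (t : ℝ) : (pointAt A B t).val = A + t • (B - A) :=
  plane_ext (by simp [pointAt]) (by simp [pointAt])

@[simp] lemma pointAt_cost (A B : Plane) (t : ℝ) : (pointAt A B t).cost = 14 := rfl

@[simp] lemma samePoint_iff (A B : Plane) : (samePoint A B).val = true ↔ A = B := by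
  have : A = B ↔ A 0 = B 0 ∧ A 1 = B 1 := ⟨by rintro rfl; simp, fun h => plane_ext h.1 h.2⟩
  simp [samePoint, this]

@[simp] lemma samePoint_cost (A B : Plane) : (samePoint A B).cost = 6 := rfl

@[simp] lemma shoelace_eval (A B : Plane) : (segmentIntegral A B).eval = shoelace A B := rfl

@[simp] lemma segmentIntegral_ops (A B : Plane) : (segmentIntegral A B).ops = 7 := rfl

end PolygonDistance
end

noncomputable section
namespace PolygonDistance

/-! ### Arcs of the circle -/

/-- Substitution of `P 1 + d * sin t`; in this range of angles the half chord is `d * cos t`, which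
is nonnegative. -/
lemma chordPrimitive_sin (P : Plane) {d φ : ℝ} (hd : 0 < d) (h1 : -(Real.pi / 2) ≤ φ)
    (h2 : φ ≤ Real.pi / 2) : chordPrimitive P d (P 1 + d * Real.sin φ) =
      d ^ 2 * (φ + Real.pi / 2 + Real.sin φ * Real.cos φ) / 2 := by
  have hder : ∀ t ∈ Set.uIcc (-(Real.pi / 2)) φ, HasDerivAt (fun t => P 1 + d * Real.sin t)
      (d * Real.cos t) t := fun t _ => ((Real.hasDerivAt_sin t).const_mul d).const_add _
  have := intervalIntegral.integral_comp_mul_deriv hder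
    (by fun_prop) (continuous_halfChord P d)
  simp only [Real.sin_neg, Real.sin_pi_div_two, mul_neg, mul_one] at this
  rw [chordPrimitive, sub_eq_add_neg, ← this]
  have e : ∫ t in (-(Real.pi / 2))..φ, ((halfChord P d ∘ fun t => P 1 + d * Real.sin t) t) *
      (d * Real.cos t) = ∫ t in (-(Real.pi / 2))..φ, d ^ 2 * Real.cos t ^ 2 := by
    refine intervalIntegral.integral_congr fun t ht => ?_
    rw [Set.uIcc_of_le h1] at ht
    have hc : 0 ≤ Real.cos t := Real.cos_nonneg_of_mem_Icc ⟨ht.1, ht.2.trans h2⟩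
    have : halfChord P d (P 1 + d * Real.sin t) = d * Real.cos t := by
      rw [halfChord, ← Real.sqrt_sq (mul_nonneg hd.le hc)]
      congr 1
      linear_combination (-d ^ 2) * Real.sin_sq_add_cos_sq t
    simp only [Function.comp_apply, this]; ring
  rw [e, intervalIntegral.integral_const_mul, integral_cos_sq]
  simp
  ring

lemma chordPrimitive_top (P : Plane) {d : ℝ} (hd : 0 < d) :
    chordPrimitive P d (P 1 + d) = d ^ 2 * Real.pi / 2 := by
  have := chordPrimitive_sin P hd (φ := Real.pi / 2) (by linarith [Real.pi_pos]) le_rfl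
  rw [Real.sin_pi_div_two, mul_one] at this
  rw [this]; simp

/-- The angular primitive of the line integral along the circle. -/
def arcPotential (P : Plane) (d a : ℝ) (R : Plane) : ℝ := (d ^ 2 * a + P 0 * R 1 - P 1 * R 0) / 2

/-- The point `R` lies on the circle, at the angle `a`. -/
structure HasAngle (P : Plane) (d a : ℝ) (R : Plane) : Prop where
  nonneg : 0 ≤ a
  lt : a < 2 * Real.pi
  x_eq : R 0 = P 0 + d * Real.cos a
  y_eq : R 1 = P 1 + d * Real.sin a

lemma angleOf_hasAngle {P I : Plane} {d : ℝ} (hd : 0 < d) (h : dist I P = d) :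
    HasAngle P d (angleOf P d I).val I := by
  have hs : (I 0 - P 0) ^ 2 + (I 1 - P 1) ^ 2 = d ^ 2 := by rw [← dist_sq_eq, h]
  set q := (I 0 - P 0) / d with hq
  have hqd : q * d = I 0 - P 0 := by rw [hq]; field_simp
  have hq1 : q ^ 2 ≤ 1 := by
    rw [hq, div_pow, div_le_one (by positivity)]; nlinarith [sq_nonneg (I 1 - P 1)]
  have hq2 : -1 ≤ q ∧ q ≤ 1 := abs_le.1 (by rwa [← sq_le_one_iff_abs_le_one])
  have hcos := Real.cos_arccos hq2.1 hq2.2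
  have hsin := Real.sin_arccos q
  have hsq : (1 - q ^ 2) * d ^ 2 = (I 1 - P 1) ^ 2 := by
    linear_combination -hs - (q * d + (I 0 - P 0)) * hqd
  have hval : (angleOf P d I).val = if P 1 ≤ I 1 then Real.arccos q
      else 2 * Real.pi - Real.arccos q := by
    simp [angleOf, hq]
  have h0 := Real.arccos_nonneg q
  have hpi := Real.arccos_le_pi q
  have hroot : d * Real.sqrt (1 - q ^ 2) = |I 1 - P 1| := by
    rw [← Real.sqrt_sq_eq_abs, ← hsq, Real.sqrt_mul (by linarith), Real.sqrt_sq hd.le, mul_comm]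
  rw [hval]
  split_ifs with hy
  · refine ⟨h0, by linarith [Real.pi_pos], by rw [hcos]; linarith, ?_⟩
    rw [hsin, hroot, abs_of_nonneg (by linarith)]; ring
  · push Not at hy
    -- Strictly below the center `q = 1` is impossible, so the angle `2π - arccos q` stays below
    -- `2π`.
    have hpos : 0 < Real.arccos q := by
      rw [Real.arccos_pos]
      by_contra! h1
      have : q = 1 := le_antisymm hq2.2 h1
      rw [this] at hsq
      nlinarith
    refine ⟨by linarith [Real.pi_pos], by linarith, ?_, ?_⟩
    · rw [Real.cos_two_pi_sub, hcos]; linarith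
    · rw [Real.sin_two_pi_sub, hsin, mul_neg, hroot, abs_of_neg (by linarith)]; ring

/-- The part of the circle below and to the right of the center. -/
def lastQuarter (a : ℝ) : ℤ := if 3 * Real.pi / 2 < a then 1 else 0

/-- Both functions are primitives along the circle, with opposite signs and different cuts.
`endPotential` jumps by `π * d ^ 2` at the lowest point, where the condition `P 0 < R 0` changes
with the whole disk above; at the highest point the same change has no effect. `arcPotential` jumps
at the angle `0`, and `lastQuarter` marks the angles between the two cuts. -/
lemma endPotential_eq {P R : Plane} {d a : ℝ} (hd : 0 < d) (h : HasAngle P d a R) :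
    endPotential P d R = (3 * Real.pi * d ^ 2 / 4 - P 0 * P 1 / 2) - arcPotential P d a R +
      lastQuarter a * (Real.pi * d ^ 2) := by
  have hpi := Real.pi_pos
  have h0 := h.nonneg
  have h1 := h.lt
  unfold endPotential arcPotential lastQuarter
  rw [chordPrimitive_top P hd]
  rcases le_or_gt a (Real.pi / 2) with h2 | h2
  · have hc := Real.cos_nonneg_of_mem_Icc (x := a) ⟨by linarith, h2⟩
    have hcp := chordPrimitive_sin P hd (φ := a) (by linarith) h2
    rw [if_neg (show ¬ 3 * Real.pi / 2 < a by linarith), h.y_eq, hcp, h.x_eq]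
    rcases h2.eq_or_lt with h3 | h3
    · rw [h3]; simp; ring
    · have := Real.cos_pos_of_mem_Ioo (x := a) ⟨by linarith, h3⟩
      rw [if_pos (by nlinarith)]
      push_cast; ring
  · rcases le_or_gt a (3 * Real.pi / 2) with h3 | h3
    · have hc := Real.cos_nonpos_of_pi_div_two_le_of_le h2.le (by linarith)
      have hcp := chordPrimitive_sin P hd (φ := Real.pi - a) (by linarith) (by linarith)
      rw [Real.sin_pi_sub, Real.cos_pi_sub] at hcp
      rw [if_neg (show ¬ 3 * Real.pi / 2 < a by linarith), h.y_eq, hcp, h.x_eq, if_neg (by nlinarith)]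
      push_cast; ring
    · have hc := Real.cos_pos_of_mem_Ioo (x := a - 2 * Real.pi) ⟨by linarith, by linarith⟩
      have hcp := chordPrimitive_sin P hd (φ := a - 2 * Real.pi) (by linarith) (by linarith)
      rw [Real.sin_sub_two_pi, Real.cos_sub_two_pi] at hcp
      rw [Real.cos_sub_two_pi] at hc
      rw [if_pos h3, h.y_eq, hcp, h.x_eq, if_pos (by nlinarith)]
      push_cast; ring

lemma sin_lt_sin_iff_right {a b : ℝ} (ha : -(Real.pi / 2) ≤ a ∧ a ≤ Real.pi / 2)
    (hb : -(Real.pi / 2) ≤ b ∧ b ≤ Real.pi / 2) : Real.sin a < Real.sin b ↔ a < b :=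
  Real.strictMonoOn_sin.lt_iff_lt ha hb

lemma lowerRight_hasAngle_iff {P R : Plane} {d a b : ℝ} (hd : 0 < d) (h : HasAngle P d a R) :
    lowerRight (P 0) (P 1 + d * Real.sin b) R =
      if 0 < Real.cos a ∧ Real.sin a < Real.sin b then 1 else 0 := by
  unfold lowerRight
  refine if_congr ?_ rfl rfl
  rw [h.x_eq, h.y_eq, lt_add_iff_pos_right, mul_pos_iff_of_pos_left hd, add_lt_add_iff_left,
    mul_lt_mul_iff_right₀ hd]

/-- The indicator of an angle being less than `b`. -/
def before (a b : ℝ) : ℤ := if a < b then 1 else 0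

/-- The part of the right half-circle below the level of `b` consists of the last quarter and the
angles before `b`. The variants for other positions of `b` express the count near the circle at `b`
by the same two indicators, up to a constant that is irrelevant because signs of marks add up to
`0`. -/
lemma lowerRight_first_quarter {P R : Plane} {d a b : ℝ} (hd : 0 < d) (h : HasAngle P d a R)
    (hb0 : 0 < b) (hb : b < Real.pi / 2) :
    lowerRight (P 0) (P 1 + d * Real.sin b) R = lastQuarter a + before a b := by
  have hpi := Real.pi_pos
  have h0 := h.nonneg
  have h1 := h.lt
  rw [lowerRight_hasAngle_iff hd h]
  unfold lastQuarter before
  rcases lt_or_ge a (Real.pi / 2) with h2 | h2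
  · have hc := Real.cos_pos_of_mem_Ioo (x := a) ⟨by linarith, h2⟩
    simp only [sin_lt_sin_iff_right (a := a) (b := b) ⟨by linarith, h2.le⟩ ⟨by linarith, hb.le⟩]
    rw [if_neg (show ¬ 3 * Real.pi / 2 < a by linarith)]
    simp [hc]
  · rw [if_neg (show ¬ a < b by linarith)]
    rcases le_or_gt a (3 * Real.pi / 2) with h3 | h3
    · have hc := Real.cos_nonpos_of_pi_div_two_le_of_le h2 (by linarith)
      rw [if_neg (fun h => by linarith [h.1]), if_neg h3.not_gt]; rfl
    · have hc := Real.cos_pos_of_mem_Ioo (x := a - 2 * Real.pi) ⟨by linarith, by linarith⟩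
      have hs := (sin_lt_sin_iff_right (a := a - 2 * Real.pi) (b := b) ⟨by linarith, by linarith⟩
        ⟨by linarith, hb.le⟩).2 (by linarith)
      rw [Real.cos_sub_two_pi] at hc
      rw [Real.sin_sub_two_pi] at hs
      rw [if_pos ⟨hc, hs⟩, if_pos h3]; rfl

lemma lowerRight_last_quarter {P R : Plane} {d a b : ℝ} (hd : 0 < d) (h : HasAngle P d a R)
    (hb0 : 3 * Real.pi / 2 < b) (hb : b < 2 * Real.pi) :
    lowerRight (P 0) (P 1 + d * Real.sin b) R = lastQuarter a + before a b - 1 := by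
  have hpi := Real.pi_pos
  have h0 := h.nonneg
  have h1 := h.lt
  rw [lowerRight_hasAngle_iff hd h]
  unfold lastQuarter before
  rcases lt_or_ge a (Real.pi / 2) with h2 | h2
  · have hs := (sin_lt_sin_iff_right (a := b - 2 * Real.pi) (b := a) ⟨by linarith, by linarith⟩
        ⟨by linarith, h2.le⟩).2 (by linarith)
    rw [Real.sin_sub_two_pi] at hs
    rw [if_neg (fun h => by linarith [h.2]), if_neg (by linarith), if_pos (by linarith)]; rfl
  · rcases le_or_gt a (3 * Real.pi / 2) with h3 | h3
    · have hc := Real.cos_nonpos_of_pi_div_two_le_of_le h2 (by linarith)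
      rw [if_neg (fun h => by linarith [h.1]), if_neg h3.not_gt, if_pos (by linarith)]; rfl
    · have hc := Real.cos_pos_of_mem_Ioo (x := a - 2 * Real.pi) ⟨by linarith, by linarith⟩
      have hs := sin_lt_sin_iff_right (a := a - 2 * Real.pi) (b := b - 2 * Real.pi)
        ⟨by linarith, by linarith⟩ ⟨by linarith, by linarith⟩
      rw [Real.cos_sub_two_pi] at hc
      rw [Real.sin_sub_two_pi, Real.sin_sub_two_pi, sub_lt_sub_iff_right] at hs
      simp only [hs]
      rw [if_pos h3]
      simp [hc]

/-- On the left half-circle the count belongs to the left end of the chord, whence the second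
indicator on the left-hand side. The ordinate decreases there as the angle grows, so the strict
inequalities disagree at `a = b`, which has to be excluded. -/
lemma lowerRight_left_half {P R : Plane} {d a b : ℝ} (hd : 0 < d) (h : HasAngle P d a R)
    (hb0 : Real.pi / 2 < b) (hb : b < 3 * Real.pi / 2) (hab : a ≠ b) :
    lowerRight (P 0) (P 1 + d * Real.sin b) R - (if R 1 < P 1 + d * Real.sin b then 1 else 0) =
      lastQuarter a + before a b - 1 := by
  have hpi := Real.pi_pos
  have h0 := h.nonneg
  have h1 := h.lt
  rw [lowerRight_hasAngle_iff hd h, h.y_eq]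
  have e : P 1 + d * Real.sin a < P 1 + d * Real.sin b ↔ Real.sin a < Real.sin b := by
    rw [add_lt_add_iff_left, mul_lt_mul_iff_right₀ hd]
  simp only [e]
  unfold lastQuarter before
  rcases lt_or_ge a (Real.pi / 2) with h2 | h2
  · have hc := Real.cos_pos_of_mem_Ioo (x := a) ⟨by linarith, h2⟩
    rw [if_neg (show ¬ 3 * Real.pi / 2 < a by linarith), if_pos (show a < b by linarith)]
    simp [hc]
  · rcases le_or_gt a (3 * Real.pi / 2) with h3 | h3
    · have hc := Real.cos_nonpos_of_pi_div_two_le_of_le h2 (by linarith)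
      have hs := sin_lt_sin_iff_right (a := Real.pi - a) (b := Real.pi - b)
        ⟨by linarith, by linarith⟩ ⟨by linarith, by linarith⟩
      rw [Real.sin_pi_sub, Real.sin_pi_sub, sub_lt_sub_iff_left] at hs
      simp only [hs]
      rw [if_neg h3.not_gt, if_neg (fun h => by linarith [h.1])]
      rcases lt_or_gt_of_ne hab with h4 | h4
      · simp [h4, h4.not_gt]
      · simp [h4, h4.not_gt]
    · have hc := Real.cos_pos_of_mem_Ioo (x := a - 2 * Real.pi) ⟨by linarith, by linarith⟩
      rw [Real.cos_sub_two_pi] at hc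
      rw [if_pos h3, if_neg (show ¬ a < b by linarith)]
      simp [hc]

end PolygonDistance
end

noncomputable section
namespace PolygonDistance

/-! ### The loop over the arcs -/

/-- `1` if an arc starts at the mark, and `-1` if an arc ends there. -/
def Mark.sign (m : Mark) : ℤ := if m.arc then 1 else -1

lemma addArc_val (P : Plane) (d : ℝ) (A B : Mark) (ℓ : ℝ) : (addArc P d A B ℓ).val =
    if A.arc then ℓ + (arcPotential P d B.angle B.point - arcPotential P d A.angle A.point +
      if A.angle ≤ B.angle then 0 else Real.pi * d ^ 2) else ℓ := by
  unfold addArc arcIntegral arcPotential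
  by_cases h1 : A.arc
  · by_cases h2 : A.angle ≤ B.angle
    · simp [h1, h2]; ring
    · simp [h1, h2]; ring
  · simp [h1]

/-- `W` is the number of arcs open before `A`. As it stays in `{0, 1}`, a start is met only with `W
= 0` and an end only with `W = 1`. An arc from `A` adds the primitive at its successor in advance;
the term with `W` cancels this at the next step. An arc still open at the end of the list passes the
angle `0` and closes at `first`, where the full turn adds `π * d ^ 2`; it is recognized because
`first` has a smaller angle than the last mark. -/
lemma addArcs_val {P : Plane} {d : ℝ} {first : Mark} (l : List Mark) :
    ∀ (A : Mark) (W : ℤ) (ℓ : ℝ), (A :: l).Pairwise (fun a b => a.angle < b.angle) →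
      first.angle < ((A :: l).getLast (by simp)).angle → (W = 0 ∨ W = 1) →
      (∀ l₁ l₂, A :: l = l₁ ++ l₂ →
        W + (l₁.map Mark.sign).sum = 0 ∨ W + (l₁.map Mark.sign).sum = 1) →
      (addArcs P d first (A :: l) ℓ).val = ℓ +
        (W + ((A :: l).map Mark.sign).sum : ℤ) *
          (arcPotential P d first.angle first.point + Real.pi * d ^ 2) -
        W * arcPotential P d A.angle A.point -
        ((A :: l).map fun m => (m.sign : ℝ) * arcPotential P d m.angle m.point).sum := by
  induction l with
  | nil =>
    intro A W ℓ _ hf hW hp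
    have h1 := hp [A] [] rfl
    have hf' : ¬ A.angle ≤ first.angle := by simpa using hf
    simp only [addArcs, addArc_val, if_neg hf']
    simp only [List.map_cons, List.map_nil, List.sum_cons, List.sum_nil, Mark.sign] at h1 ⊢
    by_cases ha : A.arc
    · simp only [ha, if_true] at h1 ⊢
      obtain rfl : W = 0 := by omega
      push_cast; ring
    · simp only [ha, if_false, Bool.false_eq_true] at h1 ⊢
      obtain rfl : W = 1 := by omega
      push_cast; ring
  | cons B l ih =>
    intro A W ℓ hs hf hW hp
    have h1 := hp [A] (B :: l) rfl
    have hAB : A.angle ≤ B.angle := (List.rel_of_pairwise_cons hs (by simp)).le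
    simp only [addArcs, Timed.val_bind]
    rw [ih B (W + A.sign) _ hs.of_cons (by simpa using hf) (by simpa using h1)
      (fun l₁ l₂ e => by simpa [add_assoc] using hp (A :: l₁) l₂ (by simp [e])), addArc_val,
      if_pos hAB]
    simp only [List.map_cons, List.map_nil, List.sum_cons, List.sum_nil, Mark.sign] at h1 ⊢
    by_cases ha : A.arc
    · simp only [ha, if_true] at h1 ⊢
      obtain rfl : W = 0 := by omega
      push_cast; ring
    · simp only [ha, if_false, Bool.false_eq_true] at h1 ⊢
      obtain rfl : W = 1 := by omega
      push_cast; ring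

section
variable {n : ℕ} {S X Y : Fin n → Plane} {P : Plane} {d : ℝ} {l : List Mark}

/-- The hypothesis for all `g` is an equality of formal sums of points: the marks with their signs
form the boundary of the inner parts. Only its real form is assumed, and integer functions are cast.
-/
lemma sum_map_int_of_flux
    (hg : ∀ g : Plane → ℝ, (l.map fun m => (m.sign : ℝ) * g m.point).sum = ∑ i, (g (Y i) - g (X i)))
    (g : Plane → ℤ) : (l.map fun m => m.sign * g m.point).sum = ∑ i, (g (Y i) - g (X i)) := by
  have := hg fun R => g R
  have e : (((l.map fun m => m.sign * g m.point).sum : ℤ) : ℝ) =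
      ((∑ i, (g (Y i) - g (X i)) : ℤ) : ℝ) := by
    rw [Int.cast_list_sum, List.map_map]
    push_cast
    rw [← this]
    congr 1
    exact List.map_congr_left fun m _ => by simp
  exact_mod_cast e

variable [NeZero n]

lemma sum_map_sub_of_flux (l : List Mark) (f g : Mark → ℤ) :
    (l.map fun m => f m - g m).sum = (l.map f).sum - (l.map g).sum := by
  induction l with
  | nil => simp
  | cons a l ih => simp [ih]; ring

/-- Along the circle, the number of arcs that have started exceeds the number of those that have
ended by `0` or `1`, up to a constant. -/
lemma arc_depth (hw : ∀ Q, winding S Q = 0 ∨ winding S Q = 1) (hd : 0 < d)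
    (h : ∀ i, IsSplit P d (S i) (S (i + 1)) (X i) (Y i)) {c : ℤ}
    (hc : ∀ y, |y - P 1| < d → outerLevel P S X Y y =
      c + ∑ i, (lowerRight (P 0) y (Y i) - lowerRight (P 0) y (X i)))
    (ha : ∀ m ∈ l, HasAngle P d m.angle m.point)
    (hg : ∀ g : Plane → ℝ, (l.map fun m => (m.sign : ℝ) * g m.point).sum = ∑ i, (g (Y i) - g (X i)))
    {b : ℝ} (hb0 : 0 < b) (hb1 : b < 2 * Real.pi) (hb2 : b ≠ Real.pi / 2)
    (hb3 : b ≠ 3 * Real.pi / 2) (hb4 : ∀ m ∈ l, m.angle ≠ b) :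
    c + (l.map fun m => m.sign * lastQuarter m.angle).sum +
        (l.map fun m => m.sign * before m.angle b).sum = 0 ∨
      c + (l.map fun m => m.sign * lastQuarter m.angle).sum +
        (l.map fun m => m.sign * before m.angle b).sum = 1 := by
  have hpi := Real.pi_pos
  have hs0 : (l.map Mark.sign).sum = 0 := by
    have := sum_map_int_of_flux hg fun _ => 1
    simpa using this
  -- The signs add up to `0`, so a constant `k` in the weights drops out.
  have key (k : ℤ) : (l.map fun m => m.sign * (lastQuarter m.angle + before m.angle b - k)).sum =
      (l.map fun m => m.sign * lastQuarter m.angle).sum +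
        (l.map fun m => m.sign * before m.angle b).sum := by
    have : (fun m : Mark => m.sign * (lastQuarter m.angle + before m.angle b - k)) =
        fun m => (m.sign * lastQuarter m.angle + m.sign * before m.angle b) - m.sign * k := by
      funext m; ring
    rw [this, sum_map_sub_of_flux, List.sum_map_add, List.sum_map_mul_right, hs0]
    ring
  -- The angle `b` is neither that of the highest nor that of the lowest point, so its level is
  -- strictly inside the disk.
  have hy : |P 1 + d * Real.sin b - P 1| < d := by
    have hcos : Real.cos b ≠ 0 := by
      intro h0
      rcases lt_or_gt_of_ne hb2 with h2 | h2
      · exact (Real.cos_pos_of_mem_Ioo (x := b) ⟨by linarith, h2⟩).ne' h0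
      · rcases lt_or_gt_of_ne hb3 with h3 | h3
        · exact (Real.cos_neg_of_pi_div_two_lt_of_lt h2 (by linarith)).ne h0
        · have := Real.cos_pos_of_mem_Ioo (x := b - 2 * Real.pi) ⟨by linarith, by linarith⟩
          rw [Real.cos_sub_two_pi] at this
          exact this.ne' h0
    have hsin : |Real.sin b| < 1 := by
      rw [← sq_lt_one_iff_abs_lt_one]
      have := Real.sin_sq_add_cos_sq b
      have := sq_pos_of_ne_zero hcos
      linarith
    rw [add_sub_cancel_left, abs_mul, abs_of_pos hd]
    nlinarith
  -- The winding numbers just inside the right and the left end of the chord through the point of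
  -- angle `b`; which of them is used depends on the half-circle of `b`.
  have hR := outerLevel_eq_zero_or_one hw h hy
  have hL := outerLevel_add_level_eq_zero_or_one hw h hy
  rw [hc _ hy, ← sum_map_int_of_flux hg (lowerRight (P 0) (P 1 + d * Real.sin b))] at hR hL
  have conv {k : ℤ} {f : Mark → ℤ}
      (hf : ∀ m ∈ l, f m = lastQuarter m.angle + before m.angle b - k) :
      (l.map fun m => m.sign * f m).sum = (l.map fun m => m.sign * lastQuarter m.angle).sum +
        (l.map fun m => m.sign * before m.angle b).sum := by
    rw [← key k]
    congr 1
    exact List.map_congr_left fun m hm => by rw [hf m hm]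
  rcases lt_or_gt_of_ne hb2 with h2 | h2
  · rwa [conv (k := 0) fun m hm => by rw [lowerRight_first_quarter hd (ha m hm) hb0 h2, sub_zero],
      ← add_assoc] at hR
  · rcases lt_or_gt_of_ne hb3 with h3 | h3
    · have e : ∑ i, level (X i) (Y i) (P 1 + d * Real.sin b) =
          -(l.map fun m => m.sign * if m.point 1 < P 1 + d * Real.sin b then (1 : ℤ) else 0).sum := by
        rw [sum_map_int_of_flux hg fun R => if R 1 < P 1 + d * Real.sin b then (1 : ℤ) else 0,
          ← Finset.sum_neg_distrib]
        refine Finset.sum_congr rfl fun i _ => ?_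
        unfold level
        split_ifs <;> rfl
      rw [e, add_assoc, ← sub_eq_add_neg, ← sum_map_sub_of_flux] at hL
      simp only [← mul_sub] at hL
      rwa [conv (k := 1) fun m hm =>
        lowerRight_left_half hd (ha m hm) h2 h3 (hb4 m hm), ← add_assoc] at hL
    · rwa [conv (k := 1) fun m hm => lowerRight_last_quarter hd (ha m hm) h3 hb1,
        ← add_assoc] at hR

lemma exists_between_avoiding {a b : ℝ} (hab : a < b) (u v : ℝ) :
    ∃ x, a < x ∧ x < b ∧ x ≠ u ∧ x ≠ v := by
  obtain ⟨x, hx, hx'⟩ := (Set.Ioo_infinite hab).exists_notMem_finset {u, v}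
  simp only [Finset.mem_insert, Finset.mem_singleton, not_or] at hx'
  exact ⟨x, hx.1, hx.2, hx'⟩

/-- For an angle strictly between the last mark of the prefix and the next mark, the marks before
the angle are exactly those of the prefix. -/
lemma arc_depth_prefix (hw : ∀ Q, winding S Q = 0 ∨ winding S Q = 1) (hd : 0 < d)
    (h : ∀ i, IsSplit P d (S i) (S (i + 1)) (X i) (Y i)) {c : ℤ}
    (hc : ∀ y, |y - P 1| < d → outerLevel P S X Y y =
      c + ∑ i, (lowerRight (P 0) y (Y i) - lowerRight (P 0) y (X i)))
    (ha : ∀ m ∈ l, HasAngle P d m.angle m.point)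
    (hg : ∀ g : Plane → ℝ, (l.map fun m => (m.sign : ℝ) * g m.point).sum = ∑ i, (g (Y i) - g (X i)))
    (hl : l.Pairwise fun a b => a.angle < b.angle) (hne : l ≠ []) {l₁ l₂ : List Mark}
    (hl' : l = l₁ ++ l₂) :
    c + (l.map fun m => m.sign * lastQuarter m.angle).sum + (l₁.map Mark.sign).sum = 0 ∨
      c + (l.map fun m => m.sign * lastQuarter m.angle).sum + (l₁.map Mark.sign).sum = 1 := by
  have hs0 : (l.map Mark.sign).sum = 0 := by
    have := sum_map_int_of_flux hg fun _ => 1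
    simpa using this
  -- The empty prefix has the same sum of signs, `0`, as the whole list.
  wlog h1 : l₁ ≠ [] generalizing l₁ l₂
  · push Not at h1
    have := this (l₁ := l) (l₂ := []) (by simp) hne
    rw [hs0] at this
    simpa [h1] using this
  obtain ⟨k, a, rfl⟩ := List.eq_nil_or_concat'.{0} l₁ |>.resolve_left h1
  have hpair := hl
  rw [hl', List.pairwise_append, List.pairwise_append] at hpair
  have hlo : ∀ m ∈ k ++ [a], m.angle ≤ a.angle := by
    intro m hm
    rcases List.mem_append.1 hm with hm | hm
    · exact (hpair.1.2.2 m hm a (by simp)).le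
    · rw [List.mem_singleton.1 hm]
  have haa := ha a (by simp [hl'])
  -- The next angle after the prefix, or `2π` if the prefix is the whole list.
  obtain ⟨hi, hi1, hi2, hi3⟩ : ∃ hi, a.angle < hi ∧ hi ≤ 2 * Real.pi ∧ ∀ m ∈ l₂, hi ≤ m.angle := by
    cases l₂ with
    | nil => exact ⟨_, haa.lt, le_rfl, by simp⟩
    | cons b l₂ =>
      refine ⟨b.angle, hpair.2.2 a (by simp) b (by simp), (ha b (by simp [hl'])).lt.le, ?_⟩
      intro m hm
      rcases List.mem_cons.1 hm with rfl | hm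
      · exact le_rfl
      · exact (List.rel_of_pairwise_cons hpair.2.1 hm).le
  obtain ⟨x, hx1, hx2, hx3, hx4⟩ := exists_between_avoiding hi1 (Real.pi / 2) (3 * Real.pi / 2)
  have key := arc_depth hw hd h hc ha hg (haa.nonneg.trans_lt hx1) (hx2.trans_le hi2) hx3 hx4 ?_
  · have e : (l.map fun m => m.sign * before m.angle x).sum = ((k ++ [a]).map Mark.sign).sum := by
      rw [hl', List.map_append, List.sum_append]
      have e1 : (List.map (fun m => m.sign * before m.angle x) (k ++ [a])) =
          List.map Mark.sign (k ++ [a]) := by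
        refine List.map_congr_left fun m hm => ?_
        rw [before, if_pos ((hlo m hm).trans_lt hx1), mul_one]
      have e2 : (List.map (fun m => m.sign * before m.angle x) l₂) = List.map (fun _ => 0) l₂ := by
        refine List.map_congr_left fun m hm => ?_
        rw [before, if_neg (hx2.trans_le (hi3 m hm)).le.not_gt, mul_zero]
      rw [e1, e2]
      simp
    rwa [e] at key
  · intro m hm
    rw [hl'] at hm
    rcases List.mem_append.1 hm with hm | hm
    · exact ((hlo m hm).trans_lt hx1).ne
    · exact (hx2.trans_le (hi3 m hm)).ne.symm

/-- The sum of the line integrals over the edge pieces and the arcs is the area of the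
intersection of region and disk. -/
lemma addArcs_eq_area (hS : IsSimplePolygon S) (hw : PositivelyOriented S) (hd : 0 < d)
    (h : ∀ i, IsSplit P d (S i) (S (i + 1)) (X i) (Y i))
    (ha : ∀ m ∈ l, HasAngle P d m.angle m.point)
    (hg : ∀ g : Plane → ℝ, (l.map fun m => (m.sign : ℝ) * g m.point).sum = ∑ i, (g (Y i) - g (X i)))
    (hl : l.Pairwise fun a b => a.angle < b.angle) {first : Mark} {t : List Mark}
    (hft : l = first :: t) :
    (addArcs P d first l (∑ i, shoelace (X i) (Y i) / 2)).val =
      volume.real (planeRegion S ∩ Metric.closedBall P d) := by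
  obtain ⟨c, hc⟩ := exists_outerLevel_eq hd h
  have hs0 : (l.map Mark.sign).sum = 0 := by
    have := sum_map_int_of_flux hg fun _ => 1
    simpa using this
  have hp := fun {l₁ l₂} => arc_depth_prefix hw.winding_eq hd h hc ha hg hl (by simp [hft])
    (l₁ := l₁) (l₂ := l₂)
  -- The number of arcs open at the angle `0`, that is, the initial `W` of the loop.
  set c₀ := c + (l.map fun m => m.sign * lastQuarter m.angle).sum with hc0
  -- A single mark would have a nonzero sum of signs, so there are at least two marks and the last
  -- angle exceeds the first.
  have hlast : first.angle < ((first :: t).getLast (by simp)).angle := by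
    cases t with
    | nil =>
      rw [hft] at hs0
      simp only [List.map_cons, List.map_nil, List.sum_cons, List.sum_nil, Mark.sign] at hs0
      split_ifs at hs0 <;> omega
    | cons b t =>
      rw [hft] at hl
      refine List.rel_of_pairwise_cons hl ?_
      rw [List.getLast_cons (by simp)]
      exact List.getLast_mem _
  -- Both sides become the line integrals over the inner parts, plus `c₀ * π * d ^ 2`, minus the
  -- signed sum of `arcPotential`. The constant of `endPotential_eq` drops out because the signs add
  -- up to `0`.
  rw [← hw.integral_winding hS P d, integral_winding hd h hc,
    chordPrimitive_top P hd, ← hg, hft,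
    addArcs_val t first c₀ _ (hft ▸ hl) hlast (by simpa using hp (l₁ := []) (l₂ := l) rfl)
      (fun l₁ l₂ e => hp (hft.trans e)), ← hft, hs0]
  have e : (l.map fun m => (m.sign : ℝ) * endPotential P d m.point) = l.map fun m =>
      (m.sign : ℝ) * (3 * Real.pi * d ^ 2 / 4 - P 0 * P 1 / 2) +
      (((m.sign * lastQuarter m.angle : ℤ) : ℝ) * (Real.pi * d ^ 2) +
      ((m.sign : ℝ) * arcPotential P d m.angle m.point) * (-1)) := by
    refine List.map_congr_left fun m hm => ?_
    rw [endPotential_eq hd (ha m hm)]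
    push_cast; ring
  have e0 : (l.map fun m => (m.sign : ℝ)).sum = 0 := by
    have := hg fun _ => 1
    simpa using this
  have e1 : (l.map fun m => ((m.sign * lastQuarter m.angle : ℤ) : ℝ)).sum = (c₀ - c : ℤ) := by
    rw [hc0, add_sub_cancel_left, Int.cast_list_sum, List.map_map]; rfl
  rw [e, List.sum_map_add, List.sum_map_add, List.sum_map_mul_right, List.sum_map_mul_right,
    List.sum_map_mul_right, e0, e1]
  push_cast; ring

end

end PolygonDistance
end

noncomputable section
namespace PolygonDistance

/-! ### A segment and a circle -/

/-- The point `A + t AB`. -/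
def along (A B : Plane) (t : ℝ) : Plane := A + t • (B - A)

@[simp] lemma along_zero (A B : Plane) : along A B 0 = A := by simp [along]

@[simp] lemma along_one (A B : Plane) : along A B 1 = B := by simp [along]

lemma along_apply (A B : Plane) (t : ℝ) (k : Fin 2) : along A B t k = A k + t * (B k - A k) := by
  simp [along]

lemma along_injective {A B : Plane} (h : A ≠ B) : Function.Injective (along A B) := by
  intro s t hst
  have : s • (B - A) = t • (B - A) := add_left_cancel hst
  exact smul_left_injective ℝ (sub_ne_zero.2 h.symm) this

@[simp] lemma along_eq_iff {A B : Plane} (h : A ≠ B) {s t : ℝ} : along A B s = along A B t ↔ s = t :=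
  (along_injective h).eq_iff

lemma along_eq_left_iff {A B : Plane} (h : A ≠ B) {s : ℝ} : along A B s = A ↔ s = 0 := by
  rw [← along_eq_iff h, along_zero]

lemma along_eq_right_iff {A B : Plane} (h : A ≠ B) {s : ℝ} : along A B s = B ↔ s = 1 := by
  rw [← along_eq_iff h, along_one]

lemma mem_segment_along {A B R : Plane} {r s : ℝ} (hrs : r ≤ s)
    (hR : R ∈ segment ℝ (along A B r) (along A B s)) : ∃ t, r ≤ t ∧ t ≤ s ∧ R = along A B t := by
  obtain ⟨t, h0, h1, hx, hy⟩ := mem_segment_iff_exists.1 hR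
  refine ⟨r + t * (s - r), by nlinarith, by nlinarith, plane_ext ?_ ?_⟩
  · rw [hx]; simp only [along_apply]; ring
  · rw [hy]; simp only [along_apply]; ring

lemma along_mem_segment {A B : Plane} {r s t : ℝ} (h1 : r ≤ t) (h2 : t ≤ s) :
    along A B t ∈ segment ℝ (along A B r) (along A B s) := by
  rcases h1.eq_or_lt with rfl | h1
  · exact left_mem_segment _ _ _
  refine mem_segment_iff_exists.2 ⟨(t - r) / (s - r), by apply div_nonneg <;> linarith,
    by rw [div_le_one (by linarith)]; linarith, ?_, ?_⟩ <;>
  · simp only [along_apply]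
    have : s - r ≠ 0 := by linarith
    field_simp
    ring

lemma pointAt_eq_along (A B : Plane) (t : ℝ) : (pointAt A B t).val = along A B t := pointAt_val A B t

lemma dotProd_self_pos {A B : Plane} (h : A ≠ B) : 0 < dotProd A B A B := by
  have := sq_add_sq_pos_of_ne h
  unfold dotProd; nlinarith

/-- The circle of radius `d` does not meet the line `AB`, or it meets it at the parameters
`r ≤ s`. -/
structure RootsOf (P : Plane) (d : ℝ) (A B : Plane) (r s : ℝ) : Prop where
  le : r ≤ s
  power : ∀ t, dist (along A B t) P ^ 2 - d ^ 2 = dotProd A B A B * ((t - r) * (t - s))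
  dot_eq : dotProd P A A B = -(dotProd A B A B * (r + s) / 2)

lemma dist_along_sq (P A B : Plane) (t : ℝ) : dist (along A B t) P ^ 2 =
    dotProd A B A B * t ^ 2 + 2 * dotProd P A A B * t + dotProd P A P A := by
  rw [dist_sq_eq, along_apply, along_apply]
  unfold dotProd; ring

lemma dotProd_along (A B : Plane) (t : ℝ) :
    dotProd (along A B t) A (along A B t) B = -(t * (1 - t)) * dotProd A B A B := by
  unfold dotProd; simp only [along_apply]; ring

/-- The sign of the discriminant separates lines strictly outside the circle from those with roots
`r ≤ s`. The test by the scalar product is the filter `0 ≤ t ≤ 1`, since by `dotProd_along` that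
product is `-(t * (1 - t))` times the squared length. The larger root comes first, as in the
algorithm. -/
lemma algorithm1_cases {A B : Plane} (P : Plane) (d : ℝ) (hAB : A ≠ B) :
    ((∀ t, 0 < dist (along A B t) P ^ 2 - d ^ 2) ∧ (algorithm1 A B P d).val = []) ∨
    ∃ r s, RootsOf P d A B r s ∧ (algorithm1 A B P d).val =
      ((if r = s then [s] else [s, r]).filter fun t => 0 ≤ t ∧ t ≤ 1).map (along A B) := by
  have ha := dotProd_self_pos hAB
  set a := dotProd A B A B with ha'
  set b := dotProd P A A B with hb'
  set D := b * b - a * (dotProd P A P A - d * d) with hD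
  have key : ∀ t, dotProd (along A B t) A (along A B t) B ≤ 0 ↔ 0 ≤ t ∧ t ≤ 1 := by
    intro t
    rw [dotProd_along, ← ha']
    constructor
    · intro h
      have : 0 ≤ t * (1 - t) := by nlinarith
      constructor <;> nlinarith
    · rintro ⟨h1, h2⟩
      nlinarith [mul_nonneg h1 (sub_nonneg.2 h2)]
  rcases lt_or_ge D 0 with hneg | hpos
  · refine .inl ⟨fun t => ?_, ?_⟩
    · have : a * (dist (along A B t) P ^ 2 - d ^ 2) = (a * t + b) ^ 2 - D := by
        rw [dist_along_sq, hD]; ring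
      have : 0 < a * (dist (along A B t) P ^ 2 - d ^ 2) := by nlinarith [sq_nonneg (a * t + b)]
      exact pos_of_mul_pos_right this ha.le
    · have : b * b - a * (dotProd P A P A - d * d) < 0 := hneg
      simp [algorithm1, ← ha', ← hb', this]
  right
  have hsq := Real.mul_self_sqrt hpos
  have h0 := Real.sqrt_nonneg D
  set q := Real.sqrt D with hq
  have hroots : RootsOf P d A B ((-b - q) / a) ((-b + q) / a) := by
    refine ⟨by gcongr; linarith, fun t => ?_, ?_⟩
    · rw [dist_along_sq, ← ha', ← hb']
      field_simp
      linear_combination hsq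
    · rw [← ha', ← hb']; field_simp; ring
  refine ⟨_, _, hroots, ?_⟩
  have hn : ¬ b * b - a * (dotProd P A P A - d * d) < 0 := hpos.not_gt
  rcases hpos.eq_or_lt with hz | hz
  · have hz' : b * b - a * (dotProd P A P A - d * d) = 0 := hz.symm
    have hq0 : q = 0 := by rw [hq, ← hz, Real.sqrt_zero]
    by_cases hk : 0 ≤ -b / a ∧ -b / a ≤ 1
    · simp [algorithm1, ← ha', ← hb', hz', pointAt_eq_along, key, hq0, hk, -pointAt_val]
    · simp [algorithm1, ← ha', ← hb', hz', pointAt_eq_along, key, hq0, hk, -pointAt_val]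
  · have hz' : b * b - a * (dotProd P A P A - d * d) ≠ 0 := hz.ne'
    have hqp : 0 < q := Real.sqrt_pos.2 hz
    have hne : (-b - q) / a ≠ (-b + q) / a := by
      rw [Ne, div_left_inj' ha.ne']; linarith
    have hq' : Real.sqrt (b * b - a * (dotProd P A P A - d * d)) = q := rfl
    by_cases hk1 : 0 ≤ (-b + q) / a ∧ (-b + q) / a ≤ 1 <;>
    by_cases hk2 : 0 ≤ (-b - q) / a ∧ (-b - q) / a ≤ 1 <;>
    simp only [if_neg hne, List.filter_cons, List.filter_nil, decide_eq_true_eq, hk1, hk2, and_self,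
      if_true, if_false, List.map_cons, List.map_nil] <;>
    simp [algorithm1, ← ha', ← hb', hn, hz', pointAt_eq_along, key, hq', hk1, hk2, -pointAt_val]

/-- Just after `A`, the segment from `A` to `B` is inside the open disk. -/
def StartsInside (P : Plane) (d : ℝ) (A B : Plane) : Prop :=
  dist A P < d ∨ dist A P = d ∧ dotProd P A A B < 0

open Classical in
/-- The indicator of `StartsInside`. -/
def startIndicator (P : Plane) (d : ℝ) (A B : Plane) : ℝ := if StartsInside P d A B then 1 else 0

section
variable {P A B C : Plane} {d : ℝ}

lemma startIndicator_of (h : StartsInside P d A B) : startIndicator P d A B = 1 := if_pos h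

lemma startIndicator_of_not (h : ¬ StartsInside P d A B) : startIndicator P d A B = 0 := if_neg h

lemma startsInside_iff_of_dist_eq (h : dist A P = d) :
    StartsInside P d A B ↔ dotProd P A A B < 0 := by
  simp [StartsInside, h]

lemma not_startsInside_of_lt (h : d < dist A P) : ¬ StartsInside P d A B := by
  rintro (h' | h')
  · linarith
  · linarith [h'.1]

/-- In both forms of the tangent, the test decides the sign of the scalar product of `PB` and `BC`.
For `P = B` there is no tangent; the test with `isIn = false` then still gives the right answer,
because both sides are false. -/
lemma algorithm3_iff (isIn : Bool) (hPB : P ≠ B ∨ isIn = false) :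
    (algorithm3 P B C isIn).val = true ↔ (isIn = true ↔ 0 ≤ dotProd P B B C) := by
  have hd : dotProd P B B C = (B 0 - P 0) * (C 0 - B 0) + (B 1 - P 1) * (C 1 - B 1) := rfl
  rw [hd]
  unfold algorithm3
  by_cases hy : P 1 = B 1
  · have h1 : (B 0 - P 0) * (C 0 - B 0) + (B 1 - P 1) * (C 1 - B 1) =
      (B 0 - P 0) * (C 0 - B 0) := by rw [hy]; ring
    rw [h1]
    rcases lt_trichotomy (P 0) (B 0) with hx | hx | hx
    · have e : 0 ≤ (B 0 - P 0) * (C 0 - B 0) ↔ B 0 ≤ C 0 := by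
        rw [mul_nonneg_iff_of_pos_left (by linarith), sub_nonneg]
      cases isIn <;> simp [hy, hx, hx.not_gt, e]
    · have : P = B := plane_ext hx hy
      have : isIn = false := by tauto
      subst this
      simp [hy, hx]
    · have e : 0 ≤ (B 0 - P 0) * (C 0 - B 0) ↔ C 0 ≤ B 0 := by
        constructor <;> intro <;> nlinarith
      cases isIn <;> simp [hy, hx, hx.not_gt, e]
  · have hp : B 1 - P 1 ≠ 0 := fun h => hy (by linarith)
    have ht : ∀ x, B 1 + (P 0 - B 0) / (B 1 - P 1) * (x - B 0) =
        C 1 - ((B 0 - P 0) * (x - B 0) + (B 1 - P 1) * (C 1 - B 1)) / (B 1 - P 1) := by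
      intro x; field_simp; ring
    have hP : B 1 + (P 0 - B 0) / (B 1 - P 1) * (P 0 - B 0) =
        P 1 + ((B 0 - P 0) ^ 2 + (B 1 - P 1) ^ 2) / (B 1 - P 1) := by field_simp; ring
    have hpos : 0 < (B 0 - P 0) ^ 2 + (B 1 - P 1) ^ 2 := by positivity
    have h4 : ∀ u v : ℝ, u < u - v ↔ v < 0 := fun u v => by constructor <;> intro <;> linarith
    obtain ⟨D, hD⟩ : ∃ D, (B 0 - P 0) * (C 0 - B 0) + (B 1 - P 1) * (C 1 - B 1) = D := ⟨_, rfl⟩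
    rw [hD]
    rcases lt_or_gt_of_ne hp with hn | hn
    · have h1 : ((B 0 - P 0) ^ 2 + (B 1 - P 1) ^ 2) / (B 1 - P 1) < 0 := div_neg_of_pos_of_neg hpos hn
      have h2 : D / (B 1 - P 1) ≤ 0 ↔ 0 ≤ D := by rw [div_le_iff_of_neg hn, zero_mul]
      have h3 : 0 < D / (B 1 - P 1) ↔ D < 0 := by rw [← not_le, h2, not_le]
      cases isIn <;> simp [hy, tangentAt, hP, ht, h1, h1.not_gt, h2, h3, h4, hD]
    · have h1 : 0 < ((B 0 - P 0) ^ 2 + (B 1 - P 1) ^ 2) / (B 1 - P 1) := div_pos hpos hn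
      have h2 : 0 ≤ D / (B 1 - P 1) ↔ 0 ≤ D := by rw [le_div_iff₀ hn, zero_mul]
      have h3 : D / (B 1 - P 1) < 0 ↔ D < 0 := by rw [← not_le, h2, not_le]
      cases isIn <;> simp [hy, tangentAt, hP, ht, h1, h1.not_gt, h2, h3, h4, hD]

end

end PolygonDistance
end

noncomputable section
namespace PolygonDistance

/-! ### The body of the first loop of Algorithm 4 -/

/-- `1` for the entry `true`, and `-1` for the entry `false`. -/
def arcSign (b : Bool) : ℝ := if b then 1 else -1

@[simp] lemma arcSign_true : arcSign true = 1 := rfl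

@[simp] lemma arcSign_false : arcSign false = -1 := rfl

lemma addSegment_val (A B : Plane) (s : Scan) :
    (addSegment A B s).val = ⟨s.integral + shoelace A B / 2, s.marks⟩ := by
  simp [addSegment]; ring

lemma addMark_val (I : Plane) (b : Bool) (s : Scan) :
    (addMark I b s).val = ⟨s.integral, (I, b) :: s.marks⟩ := rfl

/-- What the first loop does for the edge from `A` to `B`, followed by `C`: the inner part of the
edge goes from `X` to `Y`, and the marks `new` are stored. -/
structure EdgeScan (P : Plane) (d : ℝ) (A B C : Plane) (X Y : Plane)
    (new : List (Plane × Bool)) : Prop where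
  split : IsSplit P d A B X Y
  val_eq : ∀ s, (scanEdge P d A B C s).val = ⟨s.integral + shoelace X Y / 2, new ++ s.marks⟩
  on_circle : ∀ m ∈ new, dist m.1 P = d ∧ m.1 ∈ segment ℝ A B ∧ m.1 ≠ A
  nodup : (new.map Prod.fst).Nodup
  length_le : new.length ≤ 2
  flux : ∀ g : Plane → ℝ, (new.map fun m => arcSign m.2 * g m.1).sum =
    g Y - g X + startIndicator P d A B * g A - startIndicator P d B C * g B

section
variable {P A B C : Plane} {d : ℝ}

lemma dist_lt_iff_sq {R : Plane} (hd : 0 ≤ d) : dist R P < d ↔ dist R P ^ 2 - d ^ 2 < 0 := by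
  rw [sub_neg, sq_lt_sq₀ dist_nonneg hd]

lemma dist_gt_iff_sq {R : Plane} (hd : 0 ≤ d) : d < dist R P ↔ 0 < dist R P ^ 2 - d ^ 2 := by
  rw [sub_pos, sq_lt_sq₀ hd dist_nonneg]

lemma dist_le_iff_sq {R : Plane} (hd : 0 ≤ d) : dist R P ≤ d ↔ dist R P ^ 2 - d ^ 2 ≤ 0 := by
  rw [sub_nonpos, sq_le_sq₀ dist_nonneg hd]

lemma dist_ge_iff_sq {R : Plane} (hd : 0 ≤ d) : d ≤ dist R P ↔ 0 ≤ dist R P ^ 2 - d ^ 2 := by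
  rw [sub_nonneg, sq_le_sq₀ hd dist_nonneg]

lemma dist_eq_iff_sq {R : Plane} (hd : 0 ≤ d) : dist R P = d ↔ dist R P ^ 2 - d ^ 2 = 0 := by
  rw [sub_eq_zero, sq_eq_sq₀ dist_nonneg hd]

namespace RootsOf

variable {r s : ℝ} (h : RootsOf P d A B r s)
include h

lemma dist_lt_iff (hd : 0 ≤ d) (hAB : A ≠ B) (t : ℝ) :
    dist (along A B t) P < d ↔ r < t ∧ t < s := by
  have ha := dotProd_self_pos hAB
  have hrs := h.le
  rw [dist_lt_iff_sq hd, h.power, ← mul_zero (dotProd A B A B), mul_lt_mul_iff_right₀ ha]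
  constructor
  · intro h
    constructor <;> by_contra! <;> nlinarith
  · rintro ⟨h1, h2⟩
    nlinarith

lemma dist_le_iff (hd : 0 ≤ d) (hAB : A ≠ B) (t : ℝ) :
    dist (along A B t) P ≤ d ↔ r ≤ t ∧ t ≤ s := by
  have ha := dotProd_self_pos hAB
  have hrs := h.le
  rw [dist_le_iff_sq hd, h.power, ← mul_zero (dotProd A B A B), mul_le_mul_iff_right₀ ha]
  constructor
  · intro h
    constructor <;> by_contra! <;> nlinarith
  · rintro ⟨h1, h2⟩
    nlinarith [mul_nonneg (sub_nonneg.2 h1) (sub_nonneg.2 h2)]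

lemma dist_gt_iff (hd : 0 ≤ d) (hAB : A ≠ B) (t : ℝ) :
    d < dist (along A B t) P ↔ t < r ∨ s < t := by
  rw [← not_le, h.dist_le_iff hd hAB, not_and_or, not_le, not_le]

lemma dist_ge_iff (hd : 0 ≤ d) (hAB : A ≠ B) (t : ℝ) :
    d ≤ dist (along A B t) P ↔ t ≤ r ∨ s ≤ t := by
  rw [← not_lt, h.dist_lt_iff hd hAB, not_and_or, not_lt, not_lt]

/-- If `A` is on the circle, then `0` is one of the roots, and a negative scalar product means `r =
0 < s`. Tangency at `A` and leaving the disk at `A` give a nonnegative product. -/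
lemma startsInside_iff (hd : 0 ≤ d) (hAB : A ≠ B) : StartsInside P d A B ↔ r ≤ 0 ∧ 0 < s := by
  have ha := dotProd_self_pos hAB
  have hrs := h.le
  have h1 := h.dist_lt_iff hd hAB 0
  have h2 := h.power 0
  rw [along_zero] at h1 h2
  rw [StartsInside, h1, dist_eq_iff_sq hd, h2, h.dot_eq]
  simp only [zero_sub, neg_mul_neg, mul_eq_zero, ha.ne', false_or]
  constructor
  · rintro (⟨h3, h4⟩ | ⟨rfl | rfl, h4⟩)
    · exact ⟨h3.le, h4⟩
    · exact ⟨le_rfl, by nlinarith⟩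
    · nlinarith
  · rintro ⟨h3, h4⟩
    rcases h3.eq_or_lt with h3 | h3
    · exact .inr ⟨.inl h3, by nlinarith⟩
    · exact .inl ⟨h3, h4⟩

end RootsOf

lemma isSplit_along {u v : ℝ} (h0 : 0 ≤ u) (huv : u ≤ v) (h1 : v ≤ 1)
    (hin : u = v ∨ dist (along A B u) P ≤ d ∧ dist (along A B v) P ≤ d)
    (hl : ∀ t, 0 ≤ t → t ≤ u → u = 0 ∨ d ≤ dist (along A B t) P)
    (hr : ∀ t, v ≤ t → t ≤ 1 → v = 1 ∨ d ≤ dist (along A B t) P) :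
    IsSplit P d A B (along A B u) (along A B v) := by
  have m1 := along_mem_segment (A := A) (B := B) h0 (huv.trans h1)
  have m2 := along_mem_segment (A := A) (B := B) huv h1
  rw [along_zero, along_one] at m1
  rw [along_one] at m2
  refine ⟨m1, m2, hin.imp (by rintro rfl; rfl) id, ?_, ?_⟩
  · rcases h0.eq_or_lt with rfl | h0
    · exact .inl (along_zero A B)
    · refine .inr fun R hR => ?_
      rw [← along_zero A B] at hR
      obtain ⟨t, t0, t1, rfl⟩ := mem_segment_along h0.le (by simpa using hR)
      exact (hl t t0 t1).resolve_left h0.ne'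
  · rcases h1.eq_or_lt with rfl | h1
    · exact .inl (along_one A B)
    · refine .inr fun R hR => ?_
      obtain ⟨t, t0, t1, rfl⟩ := mem_segment_along (A := A) (B := B) h1.le (by simpa using hR)
      exact (hr t t0 t1).resolve_left h1.ne

lemma algorithm3_true_iff (hPB : P ≠ B) (hB : dist B P = d) :
    (algorithm3 P B C true).val = true ↔ ¬ StartsInside P d B C := by
  rw [algorithm3_iff true (.inl hPB), startsInside_iff_of_dist_eq hB]
  simp

lemma algorithm3_false_iff (hB : dist B P = d) :
    (algorithm3 P B C false).val = true ↔ StartsInside P d B C := by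
  rw [algorithm3_iff false (.inr rfl), startsInside_iff_of_dist_eq hB]
  simp

lemma position_along (hAB : A ≠ B) (t : ℝ) : (position A B (along A B t)).val = t := by
  unfold position
  by_cases h : A 0 = B 0
  · have : B 1 - A 1 ≠ 0 := fun h' => hAB (plane_ext h (by linarith))
    simp [h, along_apply, this]
  · have : B 0 - A 0 ≠ 0 := fun h' => h (by linarith)
    simp [h, along_apply, this]

/-- Covers edges that miss the open disk with both ends outside the closed one. Algorithm 1 may
still report a tangency point, but the scan reacts only to two points. -/
lemma edgeScan_of_outside (hA : d < dist A P) (hB : d < dist B P) (ho : ∀ t, 0 ≤ t → t ≤ 1 → d ≤ dist (along A B t) P)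
    (hl : ∀ I J, (algorithm1 A B P d).val ≠ [I, J]) : EdgeScan P d A B C A A [] := by
  refine ⟨?_, ?_, by simp, by simp, by simp, fun g => ?_⟩
  · have := isSplit_along (A := A) (B := B) (P := P) (d := d) le_rfl le_rfl zero_le_one (.inl rfl)
      (fun t _ _ => .inl rfl) fun t h0 h1 => .inr (ho t h0 h1)
    simpa using this
  · intro s
    have : ∀ l : List Plane, (algorithm1 A B P d).val = l →
      (scanEdge P d A B C s).val = s := by
      intro l hl'
      unfold scanEdge
      rcases l with _ | ⟨I, _ | ⟨J, _ | ⟨K, l⟩⟩⟩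
      · simp [hA.not_ge, hB.not_gt, hl']
      · simp [hA.not_ge, hB.not_gt, hB, hl']
      · exact absurd hl' (hl I J)
      · simp [hA.not_ge, hB.not_gt, hl']
    rw [this _ rfl, shoelace_self]
    simp
  · rw [startIndicator_of_not (not_startsInside_of_lt hA),
      startIndicator_of_not (not_startsInside_of_lt hB)]
    simp

/-- The marks of one edge account for the ends of its inner part, up to the indicators of starting
inside at `A` and at `B`. A vertex on the circle is treated once, by the edge that ends there; the
indicator at `B` refers to the next edge, and Algorithm 3 stores `B` precisely when this makes the
flux identity hold. The cases follow the positions of `A` and `B`, expressed through the roots `r ≤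
q`. -/
lemma exists_edgeScan (hd : 0 ≤ d) (hAB : A ≠ B) (C : Plane) :
    ∃ X Y new, EdgeScan P d A B C X Y new := by
  rcases algorithm1_cases P d hAB with ⟨h, hval⟩ | ⟨r, q, h, hval⟩
  · refine ⟨A, A, [], edgeScan_of_outside ?_ ?_ (fun t _ _ => ?_) (by simp [hval])⟩
    · rw [dist_gt_iff_sq hd]; simpa using h 0
    · rw [dist_gt_iff_sq hd]; simpa using h 1
    · rw [dist_ge_iff_sq hd]; exact (h t).le
  have hrq := h.le
  have hlt := h.dist_lt_iff hd hAB
  have hle := h.dist_le_iff hd hAB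
  have hgt := h.dist_gt_iff hd hAB
  have hge := h.dist_ge_iff hd hAB
  have hA : dist A P ≤ d ↔ r ≤ 0 ∧ 0 ≤ q := by simpa using hle 0
  have hB1 : dist B P < d ↔ r < 1 ∧ 1 < q := by simpa using hlt 1
  have hB2 : d < dist B P ↔ 1 < r ∨ q < 1 := by simpa using hgt 1
  have hstA := h.startsInside_iff hd hAB
  have hroot : ∀ t, (t = r ∨ t = q) → dist (along A B t) P = d := by
    intro t ht
    refine le_antisymm ((hle t).2 ?_) ((hge t).2 ?_) <;> rcases ht with rfl | rfl <;> simp [hrq]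
  -- Between two different roots there is a point of the open disk, so the radius is positive and a
  -- vertex on the circle differs from `P`.
  have hdpos : r < q → P ≠ B ∨ dist B P ≠ d := by
    intro hr
    by_contra! hP
    have := (hlt ((r + q) / 2)).2 ⟨by linarith, by linarith⟩
    rw [← hP.2, hP.1, dist_self] at this
    exact absurd this dist_nonneg.not_gt
  -- The common part of the cases with the inner part at the parameters from `u` to `v`: the
  -- geometry of the splitting is reduced to inequalities with the roots.
  have mk : ∀ u v new, 0 ≤ u → u ≤ v → v ≤ 1 → (u = v ∨ r ≤ u ∧ v ≤ q) → (u = 0 ∨ u ≤ r) →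
      (v = 1 ∨ q ≤ v) → (∀ s, (scanEdge P d A B C s).val =
        ⟨s.integral + shoelace (along A B u) (along A B v) / 2, new ++ s.marks⟩) →
      (∀ m ∈ new, ∃ t, (t = r ∨ t = q) ∧ 0 < t ∧ t ≤ 1 ∧ m.1 = along A B t) →
      (new.map Prod.fst).Nodup → new.length ≤ 2 →
      (∀ g : Plane → ℝ, (new.map fun m => arcSign m.2 * g m.1).sum =
        g (along A B v) - g (along A B u) + startIndicator P d A B * g A -
          startIndicator P d B C * g B) → ∃ X Y new, EdgeScan P d A B C X Y new := by
    intro u v new h0 huv h1 hin hl hr hv hm hn hlen hf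
    refine ⟨_, _, new, isSplit_along h0 huv h1 ?_ ?_ ?_, hv, ?_, hn, hlen, hf⟩
    · refine hin.imp id fun h => ⟨(hle u).2 ⟨h.1, huv.trans h.2⟩, (hle v).2 ⟨h.1.trans huv, h.2⟩⟩
    · exact fun t _ ht => hl.imp id fun h => (hge t).2 (.inl (ht.trans h))
    · exact fun t ht _ => hr.imp id fun h => (hge t).2 (.inr (h.trans ht))
    · intro m hm'
      obtain ⟨t, ht, t0, t1, e⟩ := hm m hm'
      rw [e]
      refine ⟨hroot t ht, ?_, by rw [Ne, along_eq_left_iff hAB]; exact t0.ne'⟩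
      simpa using along_mem_segment (A := A) (B := B) t0.le t1
  rcases le_or_gt (dist A P) d with hA' | hA'
  · obtain ⟨hr0, hq0⟩ := hA.1 hA'
    rcases lt_trichotomy (dist B P) d with hB | hB | hB
    · have hq := hB1.1 hB
      refine mk 0 1 [] le_rfl zero_le_one le_rfl (.inr ⟨hr0, hq.2.le⟩) (.inl rfl) (.inl rfl) ?_
        (by simp) (by simp) (by simp) fun g => ?_
      · intro s; simp [scanEdge, hA', hB, addSegment_val]
      · rw [startIndicator_of (hstA.2 ⟨hr0, by linarith⟩), startIndicator_of (.inl hB)]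
        simp
    · have h1 : ¬(r < 1 ∧ 1 < q) := fun h => (hB1.2 h).ne hB
      have h2 : ¬(1 < r ∨ q < 1) := fun h => (hB2.2 h).ne' hB
      obtain rfl : q = 1 := by
        push Not at h1 h2; exact le_antisymm (h1 (by linarith)) h2.2
      have hPB : P ≠ B := (hdpos (by linarith)).resolve_right (by simp [hB])
      have e := algorithm3_true_iff (C := C) hPB hB
      have hst := startIndicator_of (hstA.2 ⟨hr0, zero_lt_one⟩)
      by_cases hs : StartsInside P d B C
      · refine mk 0 1 [] le_rfl zero_le_one le_rfl (.inr ⟨hr0, le_rfl⟩) (.inl rfl) (.inl rfl) ?_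
          (by simp) (by simp) (by simp) fun g => ?_
        · intro s; simp [scanEdge, hA', hB, addSegment_val, addVertex, e, hs]
        · rw [hst, startIndicator_of hs]; simp
      · refine mk 0 1 [(along A B 1, true)] le_rfl zero_le_one le_rfl (.inr ⟨hr0, le_rfl⟩) (.inl rfl)
          (.inl rfl) ?_ ?_ (by simp) (by simp) fun g => ?_
        · intro s; simp [scanEdge, hA', hB, addSegment_val, addVertex, addMark_val, e, hs]
        · intro m hm
          rw [List.mem_singleton.1 hm]
          exact ⟨1, .inr rfl, one_pos, le_rfl, rfl⟩
        · rw [hst, startIndicator_of_not hs]; simp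
    · have hq1 : q < 1 := (hB2.1 hB).resolve_left (by linarith)
      have hsB := startIndicator_of_not (not_startsInside_of_lt (B := C) hB)
      -- For `q = 0` the edge meets the disk only at `A`. Nothing is stored here, since a mark at
      -- `A` belongs to the preceding edge.
      rcases hq0.eq_or_lt with rfl | hq0
      · have hl : (algorithm1 A B P d).val = [A] := by
          rw [hval]
          rcases hr0.eq_or_lt with rfl | hr
          · simp
          · simp [hr.ne, hr.not_ge]
        refine mk 0 0 [] le_rfl le_rfl zero_le_one (.inl rfl) (.inl rfl) (.inr le_rfl) ?_
          (by simp) (by simp) (by simp) fun g => ?_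
        · intro s; simp [scanEdge, hA', hB, hB.not_gt, hl, firstOther, shoelace_self]
        · rw [hsB, startIndicator_of_not (fun h => by linarith [(hstA.1 h).2])]; simp
      · have hne : along A B q ≠ A := by rw [Ne, along_eq_left_iff hAB]; exact hq0.ne'
        have hl : (algorithm1 A B P d).val = [along A B q] ∨
            (algorithm1 A B P d).val = [along A B q, A] := by
          rw [hval]
          rcases hr0.eq_or_lt with rfl | hr
          · right; simp [hq0.ne, hq0.le, hq1.le]
          · left; simp [(hr.trans hq0).ne, hr.not_ge, hq0.le, hq1.le]
        refine mk 0 q [(along A B q, true)] le_rfl hq0.le hq1.le (.inr ⟨hr0, le_rfl⟩) (.inl rfl)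
          (.inr le_rfl) ?_ ?_ (by simp) (by simp) fun g => ?_
        · intro s; rcases hl with hl | hl <;>
          simp [scanEdge, hA', hB, hB.not_gt, hl, firstOther, hne, addSegment_val, addMark_val]
        · intro m hm
          rw [List.mem_singleton.1 hm]
          exact ⟨q, .inr rfl, hq0, hq1.le, rfl⟩
        · rw [hsB, startIndicator_of (hstA.2 ⟨hr0, hq0⟩)]; simp
  · have hsA := startIndicator_of_not (not_startsInside_of_lt (B := B) hA')
    have hA2 : 0 < r ∨ q < 0 := by
      by_contra! h'
      exact (hA.2 h').not_gt hA'
    rcases lt_trichotomy (dist B P) d with hB | hB | hB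
    · obtain ⟨h1, h2⟩ := hB1.1 hB
      have hr0 : 0 < r := hA2.resolve_right (by linarith)
      have hl : (algorithm1 A B P d).val = [along A B r] := by
        rw [hval]
        simp [(h1.trans h2).ne, h2.not_ge, hr0.le, h1.le]
      refine mk r 1 [(along A B r, false)] hr0.le h1.le le_rfl (.inr ⟨le_rfl, h2.le⟩) (.inr le_rfl)
        (.inl rfl) ?_ ?_ (by simp) (by simp) fun g => ?_
      · intro s; simp [scanEdge, hA'.not_ge, hB, hl, addSegment_val, addMark_val]
      · intro m hm
        rw [List.mem_singleton.1 hm]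
        exact ⟨r, .inl rfl, hr0, h1.le, rfl⟩
      · rw [hsA, startIndicator_of (.inl hB)]; simp
    · have h1 : ¬(r < 1 ∧ 1 < q) := fun h => (hB1.2 h).ne hB
      have h2 : ¬(1 < r ∨ q < 1) := fun h => (hB2.2 h).ne' hB
      push Not at h1 h2
      have hr0 : 0 < r := hA2.resolve_right (by linarith)
      have e := algorithm3_false_iff (C := C) hB
      -- For `r = 1` the edge reaches the disk only at `B`, and `B` is an end of an arc if the next
      -- edge goes inside. For `r < 1` the edge enters at `r`, and `B` is the other root.
      rcases h2.1.eq_or_lt with rfl | hr1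
      · have hl : (algorithm1 A B P d).val = [B] := by
          rw [hval]
          rcases hrq.eq_or_lt with rfl | hq
          · simp
          · simp [hq.ne, hq.not_ge]
        by_cases hs : StartsInside P d B C
        · refine mk 1 1 [(along A B 1, false)] zero_le_one le_rfl le_rfl (.inl rfl) (.inr le_rfl)
            (.inl rfl) ?_ ?_ (by simp) (by simp) fun g => ?_
          · intro s; simp [scanEdge, hA'.not_ge, hB, hl, addVertex, addMark_val, e, hs, shoelace_self]
          · intro m hm
            rw [List.mem_singleton.1 hm]
            exact ⟨1, .inl rfl, one_pos, le_rfl, rfl⟩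
          · rw [hsA, startIndicator_of hs]; simp
        · refine mk 1 1 [] zero_le_one le_rfl le_rfl (.inl rfl) (.inr le_rfl)
            (.inl rfl) ?_ (by simp) (by simp) (by simp) fun g => ?_
          · intro s; simp [scanEdge, hA'.not_ge, hB, hl, addVertex, e, hs, shoelace_self]
          · rw [hsA, startIndicator_of_not hs]; simp
      · obtain rfl : q = 1 := le_antisymm (h1 hr1) h2.2
        have hPB : P ≠ B := (hdpos hr1).resolve_right (by simp [hB])
        have e := algorithm3_true_iff (C := C) hPB hB
        have hl : (algorithm1 A B P d).val = [B, along A B r] := by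
          rw [hval]; simp [hr1.ne, hr0.le, hr1.le]
        by_cases hs : StartsInside P d B C
        · refine mk r 1 [(along A B r, false)] hr0.le hr1.le le_rfl (.inr ⟨le_rfl, le_rfl⟩)
            (.inr le_rfl) (.inl rfl) ?_ ?_ (by simp) (by simp) fun g => ?_
          · intro s; simp [scanEdge, hA'.not_ge, hB, hl, addSegment_val, addMark_val, addVertex, e, hs]
          · intro m hm
            rw [List.mem_singleton.1 hm]
            exact ⟨r, .inl rfl, hr0, hr1.le, rfl⟩
          · rw [hsA, startIndicator_of hs]; simp
        · refine mk r 1 [(along A B 1, true), (along A B r, false)] hr0.le hr1.le le_rfl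
            (.inr ⟨le_rfl, le_rfl⟩) (.inr le_rfl) (.inl rfl) ?_ ?_ ?_ (by simp) fun g => ?_
          · intro s; simp [scanEdge, hA'.not_ge, hB, hl, addSegment_val, addMark_val, addVertex, e, hs]
          · intro m hm
            rcases List.mem_pair.1 hm with rfl | rfl
            · exact ⟨1, .inr rfl, one_pos, le_rfl, rfl⟩
            · exact ⟨r, .inl rfl, hr0, hr1.le, rfl⟩
          · have : B ≠ along A B r := by
              rw [ne_comm, Ne, along_eq_right_iff hAB]; exact hr1.ne
            simp [this]
          · rw [hsA, startIndicator_of_not hs]; simp; ring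
    -- With both ends outside, the edge meets the open disk only if there are two different roots
    -- strictly between `0` and `1`.
    · by_cases hin : 0 < r ∧ r < q ∧ q < 1
      · obtain ⟨hr0, hrq', hq1⟩ := hin
        have hl : (algorithm1 A B P d).val = [along A B q, along A B r] := by
          rw [hval]; simp [hrq'.ne, hr0.le, (hr0.trans hrq').le, hq1.le, (hrq'.trans hq1).le]
        refine mk r q [(along A B q, true), (along A B r, false)] hr0.le hrq hq1.le
          (.inr ⟨le_rfl, le_rfl⟩) (.inr le_rfl) (.inr le_rfl) ?_ ?_ ?_ (by simp) fun g => ?_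
        · intro s; simp [scanEdge, hA'.not_ge, hB, hB.not_gt, hl, addSegment_val, addMark_val,
            position_along hAB, hrq'.not_ge]
        · intro m hm
          rcases List.mem_pair.1 hm with rfl | rfl
          · exact ⟨q, .inr rfl, hr0.trans hrq', hq1.le, rfl⟩
          · exact ⟨r, .inl rfl, hr0, (hrq'.trans hq1).le, rfl⟩
        · simp [hAB, hrq'.ne']
        · rw [hsA, startIndicator_of_not (not_startsInside_of_lt hB)]; simp; ring
      · have hB3 := hB2.1 hB
        have hcase : r = q ∨ q < 0 ∨ 1 < r := by
          by_contra! h'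
          exact hin ⟨hA2.resolve_right h'.2.1.not_gt, lt_of_le_of_ne hrq h'.1,
            hB3.resolve_left h'.2.2.not_gt⟩
        refine ⟨A, A, [], edgeScan_of_outside hA' hB (fun t t0 t1 => ?_) fun I J hl => ?_⟩
        · rw [hge]
          rcases hcase with rfl | h' | h'
          · exact le_total _ _
          · exact .inr (h'.le.trans t0)
          · exact .inl (t1.trans h'.le)
        · rw [hval] at hl
          have := congrArg List.length hl
          rw [List.length_map] at this
          rcases hcase with rfl | h' | h'
          · have h2 := List.length_filter_le (fun t => decide (0 ≤ t ∧ t ≤ 1)) [r]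
            simp at this h2
            omega
          · have h3 : r < 0 := hrq.trans_lt h'
            split_ifs at this <;> simp [h'.not_ge, h3.not_ge] at this
          · have h3 : 1 < q := h'.trans_le hrq
            split_ifs at this <;> simp [h'.not_ge, h3.not_ge] at this

end

end PolygonDistance
end

noncomputable section
namespace PolygonDistance

/-! ### The first loop of Algorithm 4 -/

section
variable {n : ℕ} [NeZero n] {S : Fin n → Plane} {P : Plane} {d : ℝ}

lemma forLoop_scan {X Y : Fin n → Plane} {new : Fin n → List (Plane × Bool)}
    (h : ∀ i, EdgeScan P d (S i) (S (i + 1)) (S (i + 1 + 1)) (X i) (Y i) (new i))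
    (L : List (Fin n)) : ∀ s : Scan, ∃ marks,
      (forLoop (fun s i => scanEdge P d (S i) (S (i + 1)) (S (i + 1 + 1)) s) L s).val =
        ⟨s.integral + (L.map fun i => shoelace (X i) (Y i) / 2).sum, marks ++ s.marks⟩ ∧
      marks.Perm (L.flatMap new) := by
  induction L with
  | nil => exact fun s => ⟨[], by simp [forLoop], by simp⟩
  | cons i L ih =>
    intro s
    obtain ⟨marks, hv, hp⟩ := ih ⟨s.integral + shoelace (X i) (Y i) / 2, new i ++ s.marks⟩
    refine ⟨marks ++ new i, ?_, ?_⟩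
    · rw [forLoop, Timed.val_bind, Timed.val_bind, (h i).val_eq, hv]
      simp [add_assoc]
    · rw [List.flatMap_cons]
      exact List.perm_append_comm.trans (hp.append_left _)

/-- The result of the first loop. -/
structure ScanResult (P : Plane) (S : Fin n → Plane) (d : ℝ) (X Y : Fin n → Plane)
    (new : Fin n → List (Plane × Bool)) : Prop where
  edge : ∀ i, EdgeScan P d (S i) (S (i + 1)) (S (i + 1 + 1)) (X i) (Y i) (new i)
  integral_eq : (scan P S d).val.integral = ∑ i, shoelace (X i) (Y i) / 2
  marks_perm : (scan P S d).val.marks.Perm ((List.finRange n).flatMap new)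

lemma exists_scanResult (hS : IsSimplePolygon S) (P : Plane) (hd : 0 ≤ d) :
    ∃ X Y new, ScanResult P S d X Y new := by
  choose X Y new h using fun i => exists_edgeScan (P := P) hd (hS.ne_succ i) (S (i + 1 + 1))
  obtain ⟨marks, hv, hp⟩ := forLoop_scan h (List.finRange n) ⟨0, []⟩
  refine ⟨X, Y, new, h, ?_, ?_⟩
  · rw [scan, hv]; simp [Fin.sum_univ_def]
  · rw [scan, hv]; simpa using hp

namespace ScanResult

variable {X Y : Fin n → Plane} {new : Fin n → List (Plane × Bool)}
  (h : ScanResult P S d X Y new)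
include h

lemma on_circle : ∀ m ∈ (scan P S d).val.marks, dist m.1 P = d := by
  intro m hm
  rw [h.marks_perm.mem_iff, List.mem_flatMap] at hm
  obtain ⟨i, _, hm⟩ := hm
  exact ((h.edge i).on_circle m hm).1

/-- The marks of an edge are never at its starting vertex. A point marked by two different edges
would be a common vertex and thus the end of both, which is impossible. -/
lemma nodup (hS : IsSimplePolygon S) : ((scan P S d).val.marks.map Prod.fst).Nodup := by
  rw [(h.marks_perm.map Prod.fst).nodup_iff, List.map_flatMap, List.nodup_flatMap]
  refine ⟨fun i _ => (h.edge i).nodup, ?_⟩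
  refine (List.nodup_finRange n).imp fun {i j} hij => ?_
  intro Q hi hj
  obtain ⟨mi, hmi, rfl⟩ := List.mem_map.1 hi
  obtain ⟨mj, hmj, e⟩ := List.mem_map.1 hj
  obtain ⟨_, hi1, hi2⟩ := (h.edge i).on_circle mi hmi
  obtain ⟨_, hj1, hj2⟩ := (h.edge j).on_circle mj hmj
  rw [e] at hj1 hj2
  obtain ⟨h1, h2⟩ := hS.inter_subset i j hij ⟨hi1, hj1⟩
  have h3 := h1.resolve_left hi2
  have h4 := h2.resolve_left hj2
  exact hij (add_right_cancel (hS.injective (h3.symm.trans h4)))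

lemma length_le : (scan P S d).val.marks.length ≤ 2 * n := by
  rw [h.marks_perm.length_eq, List.length_flatMap, ← Fin.sum_univ_def]
  exact (Finset.sum_le_card_nsmul _ _ 2 fun i _ => (h.edge i).length_le).trans (by simp [mul_comm])

/-- The correction of an edge at its end is the correction of the next edge at its start, so the
corrections cancel around the polygon. -/
lemma flux (g : Plane → ℝ) : ((scan P S d).val.marks.map fun m => arcSign m.2 * g m.1).sum =
    ∑ i, (g (Y i) - g (X i)) := by
  rw [(h.marks_perm.map _).sum_eq, List.map_flatMap, List.flatMap_def, List.sum_flatten, List.map_map]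
  have e : (List.finRange n).map (List.sum ∘ fun i => ((new i).map fun m => arcSign m.2 * g m.1)) =
      (List.finRange n).map fun i => (g (Y i) - g (X i)) -
        (startIndicator P d (S (i + 1)) (S (i + 1 + 1)) * g (S (i + 1)) -
          startIndicator P d (S i) (S (i + 1)) * g (S i)) :=
    List.map_congr_left fun i _ => by rw [Function.comp_apply, (h.edge i).flux]; ring
  rw [e, ← Fin.sum_univ_def, Finset.sum_sub_distrib,
    sum_succ_sub fun i => startIndicator P d (S i) (S (i + 1)) * g (S i), sub_zero]

end ScanResult

open Classical in
-- The indicator of a marked point picks out one sign, `1` or `-1`, because no point is marked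
-- twice.
lemma eq_nil_of_flux_eq_zero {l : List (Plane × Bool)} (hn : (l.map Prod.fst).Nodup)
    (h : ∀ g : Plane → ℝ, (l.map fun m => arcSign m.2 * g m.1).sum = 0) : l = [] := by
  cases l with
  | nil => rfl
  | cons m l =>
    exfalso
    have := h fun R => if R = m.1 then 1 else 0
    rw [List.map_cons, List.nodup_cons] at hn
    have e : l.map (fun k => arcSign k.2 * if k.1 = m.1 then (1 : ℝ) else 0) = l.map fun _ => 0 := by
      refine List.map_congr_left fun k hk => ?_
      rw [if_neg, mul_zero]
      exact fun h' => hn.1 (h' ▸ List.mem_map_of_mem hk)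
    rw [List.map_cons, List.sum_cons, e] at this
    simp only [if_true, mul_one, arcSign, List.map_const', List.sum_replicate, smul_zero,
      add_zero] at this
    split_ifs at this <;> norm_num at this

/-! ### No intersections are stored -/

open Classical in
lemma eq_of_forall_apply_sub {A B X Y : Plane} (hAB : A ≠ B)
    (h : ∀ g : Plane → ℝ, g Y - g X = g B - g A) : X = A ∧ Y = B := by
  have h1 := h fun R => if R = A then 1 else 0
  have h2 := h fun R => if R = B then 1 else 0
  simp only [hAB, hAB.symm, if_true, if_false] at h1 h2
  constructor
  · by_contra hX
    rw [if_neg hX] at h1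
    split_ifs at h1 <;> norm_num at h1
  · by_contra hY
    rw [if_neg hY] at h2
    split_ifs at h2 <;> norm_num at h2

open Classical in
lemma eq_of_forall_apply_eq {X Y : Plane} (h : ∀ g : Plane → ℝ, g Y = g X) : X = Y := by
  have := h fun R => if R = X then 1 else 0
  by_contra hne
  simp [Ne.symm hne] at this

lemma forall_eq_of_forall_succ_eq {f : Fin n → ℝ} (h : ∀ i, f (i + 1) = f i) (i : Fin n) :
    f i = f 0 := by
  have : ∀ k : ℕ, f (Fin.ofNat n k) = f 0 := by
    intro k
    induction k with
    | zero => rfl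
    | succ k ih =>
      rw [← ih, ← h (Fin.ofNat n k)]
      congr 1
      apply Fin.ext
      simp [Fin.val_add, Fin.ofNat, Nat.add_mod]
  simpa using this i

/-- With `g = 1` the flux identity shows that the start indicator is the same at all vertices. If it
is `1`, each inner part has the same boundary as its edge; if it is `0`, each inner part has zero
boundary. -/
lemma ScanResult.of_marks_eq_nil {X Y : Fin n → Plane} {new : Fin n → List (Plane × Bool)}
    (h : ScanResult P S d X Y new) (hS : IsSimplePolygon S) (hm : (scan P S d).val.marks = []) :
    (∀ i, X i = Y i) ∨ ∀ i, X i = S i ∧ Y i = S (i + 1) := by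
  have hnew : ∀ i, new i = [] := by
    intro i
    have := h.marks_perm
    rw [hm, List.nil_perm, List.flatMap_eq_nil_iff] at this
    exact this i (List.mem_finRange i)
  have hf := fun i => (h.edge i).flux
  simp only [hnew, List.map_nil, List.sum_nil] at hf
  have hst := forall_eq_of_forall_succ_eq (f := fun i => startIndicator P d (S i) (S (i + 1)))
    fun i => by linarith [hf i fun _ => 1]
  have hst' : ∀ i, startIndicator P d (S (i + 1)) (S (i + 1 + 1)) =
    startIndicator P d (S 0) (S (0 + 1)) := fun i => hst (i + 1)
  by_cases hi : StartsInside P d (S 0) (S (0 + 1))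
  · right
    intro i
    refine eq_of_forall_apply_sub (hS.ne_succ i) fun g => ?_
    have := hf i g
    rw [hst i, hst' i, startIndicator_of hi] at this
    linarith
  · left
    intro i
    refine eq_of_forall_apply_eq fun g => ?_
    have := hf i g
    rw [hst i, hst' i, startIndicator_of_not hi] at this
    linarith

/-- If no intersection is stored, then either the disk is on one side of the boundary, or it
contains the region. -/
lemma area_of_marks_eq_nil (hS : IsSimplePolygon S) (hw : PositivelyOriented S) (hd : 0 ≤ d)
    (hm : (scan P S d).val.marks = []) :
    ((scan P S d).val.integral = 0 ∧
      volume.real (planeRegion S ∩ Metric.closedBall P d) = winding S P * (Real.pi * d ^ 2)) ∨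
    ((scan P S d).val.integral = signedArea S ∧
      volume.real (planeRegion S ∩ Metric.closedBall P d) = signedArea S) := by
  obtain ⟨X, Y, new, h⟩ := exists_scanResult hS P hd
  have hsplit := fun i => (h.edge i).split
  -- For radius `0` all inner parts are points and the disk is a null set.
  rcases hd.eq_or_lt with rfl | hd
  · left
    have hXY : ∀ i, X i = Y i := fun i => by
      rcases (hsplit i).inside with e | ⟨e1, e2⟩
      · exact e
      · rw [dist_le_zero.1 e1, dist_le_zero.1 e2]
    refine ⟨by rw [h.integral_eq]; simp [hXY, shoelace_self], ?_⟩
    have : volume (planeRegion S ∩ Metric.closedBall P 0) = 0 := by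
      rw [Metric.closedBall_zero]
      exact measure_mono_null Set.inter_subset_right (by simp)
    rw [measureReal_def, this]; simp
  obtain ⟨c, hc⟩ := exists_outerLevel_eq hd hsplit
  have hI := integral_winding hd hsplit hc
  rw [hw.integral_winding hS P d, chordPrimitive_top P hd] at hI
  rcases h.of_marks_eq_nil hS hm with hXY | hXY
  · left
    refine ⟨by rw [h.integral_eq]; simp [hXY, shoelace_self], ?_⟩
    -- With trivial inner parts `c` is the winding number of the center, and the integral is `c`
    -- times the area of the disk.
    have h1 := winding_eq_outerLevel_add hsplit (Q := P) (by simpa using hd)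
    have h2 := hc (P 1) (by simpa using hd)
    simp only [hXY, rayCross_self, sub_self, Finset.sum_const_zero, add_zero] at h1 h2
    rw [hI, h1, h2]
    simp only [hXY, shoelace_self, sub_self, Finset.sum_const_zero, zero_div]; ring
  · right
    have hX : X = S := funext fun i => (hXY i).1
    have hY : Y = fun i => S (i + 1) := funext fun i => (hXY i).2
    subst hX hY
    have h2 := hc (P 1) (by simpa using hd)
    rw [sum_succ_sub fun i => lowerRight (P 0) (P 1) (X i), outerLevel] at h2
    simp only [rayCross_self, add_zero, Finset.sum_const_zero] at h2
    refine ⟨h.integral_eq, ?_⟩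
    rw [hI, ← h2, sum_succ_sub fun i => endPotential P d (X i), signedArea]
    simp

/-! ### Intersections are stored -/

lemma computeAngles_val (P : Plane) (d : ℝ) (l : List (Plane × Bool)) :
    (computeAngles P d l).val = l.map fun m => ⟨(angleOf P d m.1).val, m.1, m.2⟩ := by
  induction l with
  | nil => rfl
  | cons m l ih => simp [computeAngles, ih]

lemma HasAngle.eq {a : ℝ} {R Q : Plane} (h : HasAngle P d a R) (h' : HasAngle P d a Q) : R = Q :=
  plane_ext (h.x_eq.trans h'.x_eq.symm) (h.y_eq.trans h'.y_eq.symm)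

/-- Independent of the sorting procedure: the marked points are distinct, a point of the circle is
determined by its angle, and so the ascending order is automatically strict and there are no ties to
be broken. -/
lemma addArcs_of_sorted (hS : IsSimplePolygon S) (hw : PositivelyOriented S) (hd : 0 ≤ d)
    (hm : (scan P S d).val.marks ≠ []) {l : List Mark}
    (hp : l.Perm (computeAngles P d (scan P S d).val.marks).val)
    (hl : l.Pairwise fun a b => a.angle ≤ b.angle) :
    ∃ first t, l = first :: t ∧ (addArcs P d first l (scan P S d).val.integral).val =
      volume.real (planeRegion S ∩ Metric.closedBall P d) := by
  obtain ⟨X, Y, new, h⟩ := exists_scanResult hS P hd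
  have hsplit := fun i => (h.edge i).split
  -- For `d = 0` the inner parts are points, the flux vanishes and no mark can have been stored.
  replace hd : 0 < d := by
    refine lt_of_le_of_ne hd fun h0 => hm ?_
    subst h0
    refine eq_nil_of_flux_eq_zero (h.nodup hS) fun g => ?_
    rw [h.flux]
    refine Finset.sum_eq_zero fun i _ => ?_
    rcases (hsplit i).inside with e | ⟨e1, e2⟩
    · rw [e, sub_self]
    · rw [dist_le_zero.1 e1, dist_le_zero.1 e2, sub_self]
  rw [computeAngles_val] at hp
  have ha : ∀ m ∈ l, HasAngle P d m.angle m.point := by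
    intro m hm
    rw [hp.mem_iff] at hm
    obtain ⟨k, hk, rfl⟩ := List.mem_map.1 hm
    exact angleOf_hasAngle hd (h.on_circle k hk)
  have hg : ∀ g : Plane → ℝ, (l.map fun m => (m.sign : ℝ) * g m.point).sum =
      ∑ i, (g (Y i) - g (X i)) := by
    intro g
    rw [(hp.map _).sum_eq, List.map_map, ← h.flux g]
    congr 1
    refine List.map_congr_left fun m _ => ?_
    rcases hb : m.2 <;> simp [Mark.sign, hb]
  have hnod : (l.map Mark.point).Nodup := by
    rw [(hp.map _).nodup_iff, List.map_map]
    exact h.nodup hS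
  have hstrict : l.Pairwise fun a b => a.angle < b.angle := by
    have h1 : l.Pairwise fun a b => a.point ≠ b.point := List.pairwise_map.1 hnod
    refine (hl.and h1).imp_of_mem fun {a b} hma hmb hab => lt_of_le_of_ne hab.1 fun e => hab.2 ?_
    exact (ha a hma).eq (e ▸ ha b hmb)
  have hne : l ≠ [] := by
    rintro rfl
    have := hp.length_eq
    simp at this
    exact hm (List.length_eq_zero_iff.1 this.symm)
  obtain ⟨first, t, hft⟩ := List.exists_cons_of_ne_nil hne
  refine ⟨first, t, hft, ?_⟩
  rw [h.integral_eq]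
  exact addArcs_eq_area hS hw hd hsplit ha hg hstrict hft

end

end PolygonDistance
end

noncomputable section
namespace PolygonDistance

/-! ### Merge sort -/

lemma merge_perm (l m : List Mark) : (merge l m).val.Perm (l ++ m) := by
  induction l, m using merge.induct with
  | case1 m => simp [merge]
  | case2 l h => cases l <;> simp_all [merge]
  | case3 a l b m ih1 ih2 =>
    by_cases h : a.angle ≤ b.angle
    · simp only [merge, Timed.val_bind, testLe_iff, RExpr.eval_lit, h, if_true, Timed.val_pure,
        List.cons_append]
      exact ih1.cons a
    · simp only [merge, Timed.val_bind, testLe_iff, RExpr.eval_lit, h, if_false, Timed.val_pure]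
      exact (ih2.cons b).trans (List.perm_middle (l₁ := a :: l)).symm

lemma merge_pairwise (l m : List Mark) (hl : l.Pairwise fun a b => a.angle ≤ b.angle)
    (hm : m.Pairwise fun a b => a.angle ≤ b.angle) :
    (merge l m).val.Pairwise fun a b => a.angle ≤ b.angle := by
  induction l, m using merge.induct with
  | case1 m => simpa [merge] using hm
  | case2 l h => cases l <;> simp_all [merge]
  | case3 a l b m ih1 ih2 =>
    by_cases h : a.angle ≤ b.angle
    · simp only [merge, Timed.val_bind, testLe_iff, RExpr.eval_lit, h, if_true, Timed.val_pure]
      refine List.pairwise_cons.2 ⟨fun c hc => ?_, ih1 hl.of_cons hm⟩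
      rw [(merge_perm _ _).mem_iff, List.mem_append] at hc
      rcases hc with hc | hc
      · exact List.rel_of_pairwise_cons hl hc
      · rcases List.mem_cons.1 hc with rfl | hc
        · exact h
        · exact h.trans (List.rel_of_pairwise_cons hm hc)
    · simp only [merge, Timed.val_bind, testLe_iff, RExpr.eval_lit, h, if_false, Timed.val_pure]
      refine List.pairwise_cons.2 ⟨fun c hc => ?_, ih2 hl hm.of_cons⟩
      rw [(merge_perm _ _).mem_iff, List.mem_append] at hc
      rcases hc with hc | hc
      · rcases List.mem_cons.1 hc with rfl | hc
        · exact (not_le.1 h).le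
        · exact (not_le.1 h).le.trans (List.rel_of_pairwise_cons hl hc)
      · exact List.rel_of_pairwise_cons hm hc

/-- Each output element is paid by one comparison of stored numbers, which costs `3`, and one
storing step. -/
lemma merge_cost_le (l m : List Mark) : (merge l m).cost ≤ 4 * (l.length + m.length) + 1 := by
  induction l, m using merge.induct with
  | case1 m => simp [merge]
  | case2 l h => cases l <;> simp_all [merge]
  | case3 a l b m ih1 ih2 =>
    by_cases h : a.angle ≤ b.angle
    · simp only [merge, Timed.cost_bind, testLe_iff, RExpr.eval_lit, h, if_true, Timed.cost_pure,
        testLe_cost, RExpr.ops_lit, tick_cost, List.length_cons] at ih1 ⊢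
      omega
    · simp only [merge, Timed.cost_bind, testLe_iff, RExpr.eval_lit, h, if_false, Timed.cost_pure,
        testLe_cost, RExpr.ops_lit, tick_cost, List.length_cons] at ih2 ⊢
      omega

lemma mergeSort_perm (l : List Mark) : (mergeSort l).val.Perm l := by
  induction l using mergeSort.induct with
  | case1 l h ih1 ih2 =>
    rw [mergeSort, if_pos h]
    simp only [Timed.val_bind]
    exact (merge_perm _ _).trans (by simpa using ih1.append ih2)
  | case2 l h => rw [mergeSort, if_neg h]; simp

lemma mergeSort_pairwise (l : List Mark) :
    (mergeSort l).val.Pairwise fun a b => a.angle ≤ b.angle := by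
  induction l using mergeSort.induct with
  | case1 l h ih1 ih2 =>
    rw [mergeSort, if_pos h]
    simp only [Timed.val_bind]
    exact merge_pairwise _ _ ih1 ih2
  | case2 l h =>
    rw [mergeSort, if_neg h]
    rcases l with _ | ⟨a, _ | ⟨b, l⟩⟩ <;> simp at h ⊢

/-- The larger half has a rounded logarithm smaller by one. Splitting and merging cost at most `5`
steps per element plus one; the remaining `2` per element absorb this one and the additive constants
of the two halves. -/
lemma mergeSort_cost_le (l : List Mark) :
    (mergeSort l).cost ≤ 7 * (l.length * Nat.clog 2 l.length) + 1 := by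
  induction l using mergeSort.induct with
  | case1 l h ih1 ih2 =>
    rw [mergeSort, if_pos h]
    simp only [Timed.cost_bind, tick_cost]
    have hm := merge_cost_le (mergeSort (l.take (l.length / 2))).val
      (mergeSort (l.drop (l.length / 2))).val
    rw [(mergeSort_perm _).length_eq, (mergeSort_perm _).length_eq, ← List.length_append,
      List.take_append_drop] at hm
    rw [List.length_take, min_eq_left (by omega)] at ih1
    rw [List.length_drop] at ih2
    have hc : Nat.clog 2 l.length = Nat.clog 2 ((l.length + 1) / 2) + 1 :=
      Nat.clog_of_two_le one_lt_two h
    set c := Nat.clog 2 ((l.length + 1) / 2)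
    have h1 : Nat.clog 2 (l.length / 2) ≤ c := Nat.clog_mono_right 2 (by omega)
    have h2 : Nat.clog 2 (l.length - l.length / 2) ≤ c := Nat.clog_mono_right 2 (by omega)
    have h3 : l.length / 2 * Nat.clog 2 (l.length / 2) +
        (l.length - l.length / 2) * Nat.clog 2 (l.length - l.length / 2) ≤ l.length * c := by
      calc _ ≤ l.length / 2 * c + (l.length - l.length / 2) * c := by gcongr
        _ = l.length * c := by rw [← add_mul]; congr 1; omega
    rw [hc, mul_add, mul_one]
    omega
  | case2 l h => rw [mergeSort, if_neg h]; simp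

end PolygonDistance
end

noncomputable section
namespace PolygonDistance

/-! ### Randomized computations -/

namespace RandTimed

variable {α β : Type}

lemma liftM_eq (t : Timed α) : (liftM t : RandTimed α) = RandTimed.lift t := rfl

lemma mem_runs_lift {t r : Timed α} : r ∈ (RandTimed.lift t).runs ↔ r = t :=
  PMF.mem_support_pure_iff _ _

lemma mem_runs_pure {a : α} {r : Timed α} : r ∈ (pure a : RandTimed α).runs ↔ r = pure a :=
  PMF.mem_support_pure_iff _ _

lemma mem_runs_bind {p : RandTimed α} {f : α → RandTimed β} {r : Timed β} :
    r ∈ (p >>= f).runs ↔ ∃ a ∈ p.runs, ∃ b ∈ (f a.val).runs, r = ⟨b.val, a.cost + b.cost⟩ := by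
  refine (PMF.mem_support_bind_iff _ _ _).trans (exists_congr fun a => and_congr_right fun _ => ?_)
  refine (PMF.mem_support_map_iff _ _ _).trans (exists_congr fun b => and_congr_right fun _ => ?_)
  exact eq_comm

lemma mem_runs_lift_bind {t : Timed α} {f : α → RandTimed β} {r : Timed β} :
    r ∈ (RandTimed.lift t >>= f).runs ↔ ∃ b ∈ (f t.val).runs, r = ⟨b.val, t.cost + b.cost⟩ := by
  rw [mem_runs_bind]
  simp only [mem_runs_lift, exists_eq_left]

lemma tsum_bind_mul {α β : Type} (p : PMF α) (g : α → PMF β) (h : β → ℝ≥0∞) :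
    ∑' b, p.bind g b * h b = ∑' a, p a * ∑' b, g a b * h b := by
  simp only [PMF.bind_apply, ← ENNReal.tsum_mul_right, ← ENNReal.tsum_mul_left, mul_assoc]
  exact ENNReal.tsum_comm

lemma tsum_pure_mul {α : Type} (a : α) (h : α → ℝ≥0∞) : ∑' b, PMF.pure a b * h b = h a := by
  rw [tsum_eq_single a]
  · simp
  · intro b hb
    rw [PMF.pure_apply, if_neg hb, zero_mul]

lemma tsum_map_mul {α β : Type} (p : PMF α) (f : α → β) (h : β → ℝ≥0∞) :
    ∑' b, p.map f b * h b = ∑' a, p a * h (f a) := by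
  rw [← PMF.bind_pure_comp, tsum_bind_mul]
  exact tsum_congr fun a => by rw [Function.comp_apply, tsum_pure_mul]

lemma tsum_mul_const_add {α : Type} (p : PMF α) (c : ℝ≥0∞) (h : α → ℝ≥0∞) :
    ∑' a, p a * (c + h a) = c + ∑' a, p a * h a := by
  simp only [mul_add]
  rw [ENNReal.tsum_add, ENNReal.tsum_mul_right, PMF.tsum_coe, one_mul]

lemma expectedCost_lift (t : Timed α) : (RandTimed.lift t).expectedCost = t.cost :=
  tsum_pure_mul _ _

lemma expectedCost_pure (a : α) : (pure a : RandTimed α).expectedCost = 0 :=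
  (tsum_pure_mul _ _).trans (by simp)

lemma expectedCost_bind (p : RandTimed α) (f : α → RandTimed β) :
    (p >>= f).expectedCost = p.expectedCost +
      ∑' a : Timed α, (show PMF (Timed α) from p) a * (f a.val).expectedCost := by
  have h : (p >>= f).expectedCost = ∑' a : Timed α, (show PMF (Timed α) from p) a *
      (a.cost + (f a.val).expectedCost) := by
    refine (tsum_bind_mul _ _ _).trans (tsum_congr fun a => ?_)
    congr 1
    refine (tsum_map_mul (f a.val) _ _).trans ?_
    simp only [Nat.cast_add]
    exact tsum_mul_const_add _ _ _
  rw [h]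
  simp only [mul_add]
  exact ENNReal.tsum_add

lemma expectedCost_lift_bind (t : Timed α) (f : α → RandTimed β) :
    (RandTimed.lift t >>= f).expectedCost = t.cost + (f t.val).expectedCost := by
  rw [expectedCost_bind, expectedCost_lift]
  congr 1
  exact tsum_pure_mul _ _

/-- Only the possible results of the first stage matter, so properties of all runs, such as the
length of a sorted list, may be used to bound the second stage. -/
lemma expectedCost_bind_le (p : RandTimed α) (f : α → RandTimed β) {c : ℝ≥0∞}
    (h : ∀ a ∈ p.runs, (f a.val).expectedCost ≤ c) :
    (p >>= f).expectedCost ≤ p.expectedCost + c := by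
  rw [expectedCost_bind]
  gcongr
  calc _ ≤ ∑' a : Timed α, (show PMF (Timed α) from p) a * c := by
        refine ENNReal.tsum_le_tsum fun a => ?_
        by_cases ha : (show PMF (Timed α) from p) a = 0
        · rw [ha]; simp
        · gcongr; exact h a ha
    _ = c := by rw [ENNReal.tsum_mul_right, PMF.tsum_coe, one_mul]

lemma expectedCost_randomIndex_bind (m : ℕ) (f : Fin (m + 1) → RandTimed β) :
    (randomIndex m >>= f).expectedCost =
      1 + (∑ i, (f i).expectedCost) / ((m + 1 : ℕ) : ℝ≥0∞) := by
  have h1 : (randomIndex m).expectedCost = 1 := by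
    refine (tsum_map_mul _ _ _).trans ?_
    simp only [Nat.cast_one, mul_one]
    exact PMF.tsum_coe _
  rw [expectedCost_bind, h1]
  congr 1
  refine (tsum_map_mul _ _ _).trans ?_
  simp only [PMF.uniformOfFintype_apply, Fintype.card_fin]
  rw [tsum_fintype, ← Finset.mul_sum, ENNReal.div_eq_inv_mul]

end RandTimed

/-! ### Quicksort -/

lemma partition_val (p : ℝ) (l : List Mark) : (partition p l).val =
    (l.filter fun m => m.angle < p, l.filter fun m => m.angle = p, l.filter fun m => p < m.angle) := by
  induction l with
  | nil => rfl
  | cons m l ih =>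
    rcases lt_trichotomy m.angle p with h | h | h
    · simp [partition, ih, h, h.ne, h.not_gt]
    · simp [partition, ih, h]
    · simp [partition, ih, h, h.ne', h.not_gt]

lemma partition_cost_le (p : ℝ) (l : List Mark) : (partition p l).cost ≤ 7 * l.length := by
  induction l with
  | nil => simp [partition]
  | cons m l ih =>
    simp only [partition, Timed.cost_bind, tick_cost, testLt_cost, RExpr.ops_lit, Timed.cost_ite,
      Timed.cost_pure, List.length_cons]
    split_ifs <;> omega

lemma filter_append_perm (p : ℝ) (l : List Mark) :
    (l.filter (fun m => m.angle < p) ++ l.filter (fun m => m.angle = p) ++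
      l.filter fun m => p < m.angle).Perm l := by
  induction l with
  | nil => simp
  | cons m l ih =>
    rcases lt_trichotomy m.angle p with h | h | h
    · simpa [h, h.ne, h.not_gt] using ih
    · simp only [h, lt_irrefl, decide_false, Bool.false_eq_true, not_false_eq_true,
        List.filter_cons_of_neg, decide_true, List.filter_cons_of_pos, List.append_assoc,
        List.cons_append]
      exact List.perm_middle.trans ((by simpa using ih : List.Perm _ _).cons m)
    · simp only [h, h.ne', h.not_gt, decide_false, Bool.false_eq_true, not_false_eq_true,
        List.filter_cons_of_neg, decide_true, List.filter_cons_of_pos]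
      exact List.perm_middle.trans (ih.cons m)

/-- The pivot belongs to neither outer part of the partition, so both are strictly shorter and the
bound for the depth suffices. -/
lemma quickSortAux_runs (k : ℕ) : ∀ l : List Mark, l.length ≤ k →
    ∀ r ∈ (quickSortAux k l).runs, r.val.Perm l ∧ r.val.Pairwise fun a b => a.angle ≤ b.angle := by
  induction k with
  | zero =>
    intro l hl r hr
    obtain rfl : l = [] := List.length_eq_zero_iff.1 (by omega)
    rw [quickSortAux, RandTimed.mem_runs_pure] at hr
    subst hr
    simp
  | succ k ih =>
    intro l hl r hr
    cases l with
    | nil =>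
      rw [quickSortAux, RandTimed.liftM_eq, RandTimed.mem_runs_lift_bind] at hr
      obtain ⟨b, hb, rfl⟩ := hr
      rw [RandTimed.mem_runs_pure] at hb
      subst hb
      simp
    | cons m l =>
      rw [quickSortAux, RandTimed.mem_runs_bind] at hr
      obtain ⟨i, -, b, hb, rfl⟩ := hr
      simp only [RandTimed.liftM_eq] at hb
      rw [RandTimed.mem_runs_lift_bind, partition_val] at hb
      obtain ⟨b, hb, rfl⟩ := hb
      rw [RandTimed.mem_runs_bind] at hb
      obtain ⟨u, hu, b, hb, rfl⟩ := hb
      rw [RandTimed.mem_runs_bind] at hb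
      obtain ⟨v', hv', b, hb, rfl⟩ := hb
      rw [RandTimed.mem_runs_lift_bind] at hb
      obtain ⟨b, hb, rfl⟩ := hb
      rw [RandTimed.mem_runs_pure] at hb
      subst hb
      dsimp only at hu hv'
      set p := ((m :: l).get i.val).angle
      have hmem : (m :: l).get i.val ∈ m :: l := List.get_mem _ _
      have h1 := ih _ (by
        have := List.length_filter_lt_length_iff_exists (l := m :: l)
          (p := fun a => decide (a.angle < p)) |>.2 ⟨_, hmem, by simp [p]⟩
        omega) u hu
      have h2 := ih _ (by
        have := List.length_filter_lt_length_iff_exists (l := m :: l)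
          (p := fun a => decide (p < a.angle)) |>.2 ⟨_, hmem, by simp [p]⟩
        omega) v' hv'
      have m1 : ∀ a ∈ u.val, a.angle < p := fun a ha => by
        have := h1.1.mem_iff.1 ha
        simpa using (List.mem_filter.1 this).2
      have m2 : ∀ a ∈ (m :: l).filter (fun a => a.angle = p), a.angle = p := fun a ha => by
        simpa using (List.mem_filter.1 ha).2
      have m3 : ∀ a ∈ v'.val, p < a.angle := fun a ha => by
        have := h2.1.mem_iff.1 ha
        simpa using (List.mem_filter.1 this).2
      refine ⟨((h1.1.append_right _).append h2.1).trans (filter_append_perm p _), ?_⟩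
      show ((u.val ++ _ ++ v'.val : List Mark)).Pairwise _
      rw [List.pairwise_append, List.pairwise_append]
      refine ⟨⟨h1.2, ?_, fun a ha b hb => (m1 a ha).le.trans (m2 b hb).ge⟩, h2.2, ?_⟩
      · rw [List.pairwise_iff_forall_sublist]
        intro a b hab
        have ha := m2 a (hab.subset (by simp))
        have hb := m2 b (hab.subset (by simp))
        exact (ha.trans hb.symm).le
      · intro a ha b hb
        rcases List.mem_append.1 ha with ha | ha
        · exact (m1 a ha).le.trans (m3 b hb).le
        · exact (m2 a ha).le.trans (m3 b hb).le

/-- A bound for the expected number of steps of Quicksort. -/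
def quickSortBound (N : ℕ) : ℝ := 16 * ((N + 1) * (harmonic N : ℝ)) + 1

lemma quickSortBound_nonneg (N : ℕ) : 0 ≤ quickSortBound N := by
  have : (0 : ℝ) ≤ harmonic N := by
    unfold harmonic; push_cast; positivity
  unfold quickSortBound; positivity

lemma quickSortBound_mono : Monotone quickSortBound := by
  refine monotone_nat_of_le_succ fun N => ?_
  have h0 : (0 : ℝ) ≤ harmonic N := by
    unfold harmonic; push_cast; positivity
  unfold quickSortBound
  rw [harmonic_succ]
  push_cast
  have : (0 : ℝ) ≤ ((N : ℝ) + 1)⁻¹ := by positivity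
  gcongr <;> linarith

lemma sum_quickSortBound (N : ℕ) : ∑ k ∈ Finset.range N, quickSortBound k =
    16 * ((N : ℝ) * (N + 1) / 2 * (harmonic N : ℝ) - N * (N + 3) / 4) + N := by
  induction N with
  | zero => simp
  | succ N ih =>
    rw [Finset.sum_range_succ, ih, quickSortBound, harmonic_succ]
    push_cast
    have : (N : ℝ) + 1 ≠ 0 := by positivity
    field_simp
    ring

/-- The classical recurrence. Each element costs `8` steps, `7` in the partition and `1` in the
concatenation; the factor `16 = 2 * 8` in the bound makes the harmonic and the linear terms cancel,
and the slack is the constant `22`. -/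
lemma quickSortBound_rec (N : ℕ) :
    8 * ((N : ℝ) + 1) + 1 + 2 * (∑ k ∈ Finset.range (N + 1), quickSortBound k) / ((N : ℝ) + 1) ≤
      quickSortBound (N + 1) := by
  rw [sum_quickSortBound, quickSortBound]
  push_cast
  have : (0 : ℝ) < (N : ℝ) + 1 := by positivity
  rw [← sub_nonneg]
  have e : 16 * (((N : ℝ) + 1 + 1) * (harmonic (N + 1) : ℝ)) + 1 - (8 * ((N : ℝ) + 1) + 1 +
      2 * (16 * (((N : ℝ) + 1) * (N + 1 + 1) / 2 * (harmonic (N + 1) : ℝ) -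
        (N + 1) * (N + 1 + 3) / 4) + (N + 1)) / ((N : ℝ) + 1)) = 22 := by
    field_simp
    ring
  rw [e]; norm_num

/-- The number of entries that precede a given one. -/
lemma length_filter_eq_card (l : List Mark) (q : Mark → Prop) [DecidablePred q] :
    (l.filter q).length = (Finset.univ.filter fun i => q (l.get i)).card := by
  conv_lhs => rw [← List.map_get_finRange l, List.filter_map, List.length_map]
  rfl

/-- Arrange the pivots by angle: the one of rank `k` has at most `k` entries strictly below and at
most `length - 1 - k` strictly above. Equal angles only shorten the parts, and `f` is monotone. -/
lemma sum_bound_le (l : List Mark) {f : ℕ → ℝ} (hf : Monotone f) :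
    ∑ i : Fin l.length, (f (l.filter fun m => m.angle < (l.get i).angle).length +
      f (l.filter fun m => (l.get i).angle < m.angle).length) ≤
    2 * ∑ k ∈ Finset.range l.length, f k := by
  set a : Fin l.length → ℝ := fun i => (l.get i).angle with ha
  set σ := Tuple.sort a
  have hmono : Monotone (a ∘ σ) := Tuple.monotone_sort a
  rw [← Equiv.sum_comp σ]
  have h1 : ∀ k, (l.filter fun m => m.angle < (l.get (σ k)).angle).length ≤ k.val := by
    intro k
    rw [length_filter_eq_card, ← Fin.card_Iio k, ← Finset.card_map (s := Finset.Iio k) σ.toEmbedding]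
    refine Finset.card_le_card fun j hj => ?_
    simp only [Finset.mem_filter, Finset.mem_univ, true_and] at hj
    rw [Finset.mem_map_equiv, Finset.mem_Iio]
    by_contra! hk
    have := hmono hk
    simp only [Function.comp_apply, Equiv.apply_symm_apply] at this
    exact this.not_gt hj
  have h2 : ∀ k, (l.filter fun m => (l.get (σ k)).angle < m.angle).length ≤ (Fin.rev k).val := by
    intro k
    have : (Fin.rev k).val = (Finset.Ioi k).card := by rw [Fin.card_Ioi, Fin.val_rev]; omega
    rw [length_filter_eq_card, this, ← Finset.card_map (s := Finset.Ioi k) σ.toEmbedding]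
    refine Finset.card_le_card fun j hj => ?_
    simp only [Finset.mem_filter, Finset.mem_univ, true_and] at hj
    rw [Finset.mem_map_equiv, Finset.mem_Ioi]
    by_contra! hk
    have := hmono hk
    simp only [Function.comp_apply, Equiv.apply_symm_apply] at this
    exact this.not_gt hj
  calc _ ≤ ∑ k : Fin l.length, (f k.val + f (Fin.rev k).val) :=
        Finset.sum_le_sum fun k _ => add_le_add (hf (h1 k)) (hf (h2 k))
    _ = _ := by
        have := Equiv.sum_comp (Fin.revPerm (n := l.length)) fun k => f k.val
        simp only [Fin.revPerm_apply] at this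
        rw [Finset.sum_add_distrib, this, Finset.sum_range, two_mul]

/-- Averaging over the pivot gives the recurrence of `quickSortBound_rec`. The list may be longer
than the depth, since stopping at depth `0` is free. -/
lemma quickSortAux_expectedCost_le (k : ℕ) : ∀ l : List Mark,
    (quickSortAux k l).expectedCost ≤ ENNReal.ofReal (quickSortBound l.length) := by
  induction k with
  | zero =>
    intro l
    rw [quickSortAux, RandTimed.expectedCost_pure]
    exact bot_le
  | succ k ih =>
    intro l
    cases l with
    | nil =>
      rw [quickSortAux, RandTimed.liftM_eq, RandTimed.expectedCost_lift_bind,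
        RandTimed.expectedCost_pure]
      simp [quickSortBound]
    | cons m l =>
      rw [quickSortAux, RandTimed.expectedCost_randomIndex_bind]
      -- Separates the average over the pivots from the cost for a given pivot.
      have key : ∀ f : Fin (m :: l).length → RandTimed (List Mark),
          (∀ i, (f i).expectedCost ≤ ENNReal.ofReal (8 * ((l.length : ℝ) + 1) +
            (quickSortBound ((m :: l).filter fun a => a.angle < ((m :: l).get i).angle).length +
            quickSortBound ((m :: l).filter fun a => ((m :: l).get i).angle < a.angle).length))) →
          1 + (∑ i, (f i).expectedCost) / ((l.length + 1 : ℕ) : ℝ≥0∞) ≤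
            ENNReal.ofReal (quickSortBound (m :: l).length) := by
        intro f hf
        have hN : (0 : ℝ) < ((l.length + 1 : ℕ) : ℝ) := by positivity
        have hs : _ ≤ 2 * ∑ k ∈ Finset.range (l.length + 1), quickSortBound k :=
          sum_bound_le (m :: l) quickSortBound_mono
        have hnn : ∀ i : Fin (m :: l).length, 0 ≤ 8 * ((l.length : ℝ) + 1) +
            (quickSortBound ((m :: l).filter fun a => a.angle < ((m :: l).get i).angle).length +
            quickSortBound ((m :: l).filter fun a => ((m :: l).get i).angle < a.angle).length) :=
          fun i => add_nonneg (by positivity)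
            (add_nonneg (quickSortBound_nonneg _) (quickSortBound_nonneg _))
        calc _ ≤ 1 + (∑ i, ENNReal.ofReal (8 * ((l.length : ℝ) + 1) +
            (quickSortBound ((m :: l).filter fun a => a.angle < ((m :: l).get i).angle).length +
            quickSortBound ((m :: l).filter fun a => ((m :: l).get i).angle < a.angle).length))) /
              ((l.length + 1 : ℕ) : ℝ≥0∞) := by
              gcongr with i
              exact hf i
          _ = ENNReal.ofReal (1 + (∑ i, (8 * ((l.length : ℝ) + 1) +
            (quickSortBound ((m :: l).filter fun a => a.angle < ((m :: l).get i).angle).length +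
            quickSortBound ((m :: l).filter fun a => ((m :: l).get i).angle < a.angle).length))) /
              ((l.length + 1 : ℕ) : ℝ)) := by
              rw [ENNReal.ofReal_add zero_le_one
                (div_nonneg (Finset.sum_nonneg fun i _ => hnn i) hN.le),
                ENNReal.ofReal_div_of_pos hN, ENNReal.ofReal_sum_of_nonneg fun i _ => hnn i,
                ENNReal.ofReal_natCast, ENNReal.ofReal_one]
          _ ≤ _ := by
              refine ENNReal.ofReal_le_ofReal (le_trans ?_ (quickSortBound_rec l.length))
              rw [Finset.sum_add_distrib]
              rw [show ∑ _ : Fin (m :: l).length, 8 * ((l.length : ℝ) + 1) =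
                (l.length + 1) * (8 * ((l.length : ℝ) + 1)) by simp,
                show ((l.length + 1 : ℕ) : ℝ) = (l.length : ℝ) + 1 by push_cast; rfl, add_div]
              have hN' : (0 : ℝ) < (l.length : ℝ) + 1 := by positivity
              rw [mul_div_cancel_left₀ _ hN'.ne']
              have := div_le_div_of_nonneg_right hs hN'.le
              linarith
      refine key _ fun i => ?_
      simp only [RandTimed.liftM_eq, RandTimed.expectedCost_lift_bind, partition_val]
      have hc : ((partition ((m :: l).get i).angle (m :: l)).cost : ℝ≥0∞) ≤
          ENNReal.ofReal (7 * ((l.length : ℝ) + 1)) := by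
        rw [← ENNReal.ofReal_natCast]
        refine ENNReal.ofReal_le_ofReal ?_
        have := partition_cost_le ((m :: l).get i).angle (m :: l)
        rw [List.length_cons] at this
        exact_mod_cast this
      refine (add_le_add hc (RandTimed.expectedCost_bind_le _ _ (c := ENNReal.ofReal
          (quickSortBound ((m :: l).filter fun a => ((m :: l).get i).angle < a.angle).length) +
        ENNReal.ofReal ((l.length : ℝ) + 1)) fun a _ => ?_)).trans ?_
      · refine (RandTimed.expectedCost_bind_le _ _ (c := ENNReal.ofReal ((l.length : ℝ) + 1))
          fun b _ => ?_).trans (add_le_add_left (ih _) _)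
        rw [RandTimed.expectedCost_lift_bind, RandTimed.expectedCost_pure, add_zero, tick_cost,
          ← ENNReal.ofReal_natCast]
        push_cast
        exact le_rfl
      · refine (add_le_add_right (add_le_add_left (ih _) _) _).trans ?_
        rw [← ENNReal.ofReal_add (quickSortBound_nonneg _) (by positivity),
          ← ENNReal.ofReal_add (quickSortBound_nonneg _)
            (add_nonneg (quickSortBound_nonneg _) (by positivity)),
          ← ENNReal.ofReal_add (by positivity) (add_nonneg (quickSortBound_nonneg _)
            (add_nonneg (quickSortBound_nonneg _) (by positivity)))]
        refine ENNReal.ofReal_le_ofReal ?_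
        linarith

end PolygonDistance
end

noncomputable section
namespace PolygonDistance

/-! ### Algorithm 2 -/

section
variable {P A B : Plane}

/-- Dividing by `B 1 - A 1` absorbs the orientation of the edge, so one comparison of abscissas
serves for rising and falling edges. For a horizontal edge the quotient is meaningless, but the
level condition already fails. -/
lemma rayCross_ne_zero_iff (A B Q : Plane) : rayCross A B Q ≠ 0 ↔
    ((A 1 < Q 1 ∧ Q 1 ≤ B 1) ∨ (B 1 < Q 1 ∧ Q 1 ≤ A 1)) ∧
      Q 0 < A 0 + (B 0 - A 0) / (B 1 - A 1) * (Q 1 - A 1) := by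
  have hx : (Q 0 < A 0 + (B 0 - A 0) / (B 1 - A 1) * (Q 1 - A 1) ↔
      0 < cross A B Q / (B 1 - A 1)) ∨ B 1 - A 1 = 0 := by
    by_cases h : B 1 - A 1 = 0
    · exact .inr h
    · left
      rw [← sub_pos]
      have : A 0 + (B 0 - A 0) / (B 1 - A 1) * (Q 1 - A 1) - Q 0 = cross A B Q / (B 1 - A 1) := by
        unfold cross; field_simp; ring
      rw [this]
  unfold rayCross
  rcases lt_trichotomy (A 1) (B 1) with h | h | h
  · rw [hx.resolve_right (by linarith), div_pos_iff_of_pos_right (by linarith)]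
    have : ¬ (B 1 < Q 1 ∧ Q 1 ≤ A 1) := fun h' => by linarith [h'.1, h'.2]
    split_ifs <;> simp only [ne_eq, one_ne_zero, neg_eq_zero, not_true_eq_false, not_false_eq_true,
      true_iff, false_iff] <;> tauto
  · have h1 : ¬ (B 1 < Q 1 ∧ Q 1 ≤ A 1) := fun h' => by linarith [h'.1, h'.2]
    have h2 : ¬ (A 1 < Q 1 ∧ Q 1 ≤ B 1) := fun h' => by linarith [h'.1, h'.2]
    rw [if_neg fun h' => h2 ⟨h'.1, h'.2.1⟩, if_neg fun h' => h1 ⟨h'.1, h'.2.1⟩]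
    simp only [h1, h2, ne_eq, not_true_eq_false, or_self, false_and]
  · have h0 : 0 < cross A B Q / (B 1 - A 1) ↔ cross A B Q < 0 := by
      rw [← not_le, div_nonpos_iff]
      constructor
      · intro h'
        by_contra! h''
        exact h' (.inl ⟨h'', by linarith⟩)
      · rintro h' (⟨h1, h2⟩ | ⟨h1, h2⟩) <;> linarith
    rw [hx.resolve_right (by linarith), h0]
    have : ¬ (A 1 < Q 1 ∧ Q 1 ≤ B 1) := fun h' => by linarith [h'.1, h'.2]
    split_ifs <;> simp only [ne_eq, one_ne_zero, neg_eq_zero, not_true_eq_false, not_false_eq_true,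
      true_iff, false_iff] <;> tauto

lemma mem_segment_iff_along {R : Plane} :
    R ∈ segment ℝ A B ↔ ∃ t, 0 ≤ t ∧ t ≤ 1 ∧ R = along A B t := by
  constructor
  · intro h
    exact mem_segment_along zero_le_one (by simpa using h)
  · rintro ⟨t, h0, h1, rfl⟩
    simpa using along_mem_segment (A := A) (B := B) h0 h1

lemma infDist_eq_of_forall {s : Set Plane} {R : Plane} (hR : R ∈ s)
    (h : ∀ Q ∈ s, dist P R ≤ dist P Q) : Metric.infDist P s = dist P R :=
  le_antisymm (Metric.infDist_le_dist_of_mem hR) ((Metric.le_infDist ⟨R, hR⟩).2 fun Q hQ => h Q hQ)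

lemma foot_le_dist (P : Plane) (hAB : A ≠ B) (t : ℝ) :
    dist (along A B t) P ^ 2 = dist (along A B (dotProd A P A B / dotProd A B A B)) P ^ 2 +
      dotProd A B A B * (t - dotProd A P A B / dotProd A B A B) ^ 2 := by
  have ha := (dotProd_self_pos hAB).ne'
  have hs : dotProd P A A B = -dotProd A P A B := by unfold dotProd; ring
  rw [dist_along_sq, dist_along_sq, hs]
  field_simp
  ring

/-- Along the line the distance from `P` increases with the distance of the parameter from that of
the foot `t₀`. The nearest point is the foot if it is on the segment, and otherwise the end closer
to it. -/
lemma infDist_segment (hAB : A ≠ B) : Metric.infDist P (segment ℝ A B) =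
    if 0 ≤ dotProd A P A B / dotProd A B A B ∧ dotProd A P A B / dotProd A B A B ≤ 1 then
      dist P (along A B (dotProd A P A B / dotProd A B A B))
    else min (dist P A) (dist P B) := by
  have ha := dotProd_self_pos hAB
  have hf := foot_le_dist P hAB
  set t₀ := dotProd A P A B / dotProd A B A B
  have hle : ∀ s t, (s - t₀) ^ 2 ≤ (t - t₀) ^ 2 → dist P (along A B s) ≤ dist P (along A B t) := by
    intro s t h
    rw [dist_comm P, dist_comm P, ← sq_le_sq₀ dist_nonneg dist_nonneg, hf s, hf t]
    gcongr
  split_ifs with h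
  · refine infDist_eq_of_forall (mem_segment_iff_along.2 ⟨t₀, h.1, h.2, rfl⟩) fun Q hQ => ?_
    obtain ⟨t, -, -, rfl⟩ := mem_segment_iff_along.1 hQ
    exact hle _ _ (by rw [sub_self]; nlinarith [sq_nonneg (t - t₀)])
  · rw [not_and_or, not_le, not_le] at h
    rcases h with h | h
    · have h1 := hle 0 1 (by nlinarith)
      rw [along_zero, along_one] at h1
      rw [min_eq_left h1]
      refine infDist_eq_of_forall (left_mem_segment _ _ _) fun Q hQ => ?_
      obtain ⟨t, h0, -, rfl⟩ := mem_segment_iff_along.1 hQ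
      simpa using hle 0 t (by nlinarith)
    · have h1 := hle 1 0 (by nlinarith)
      rw [along_zero, along_one] at h1
      rw [min_eq_right h1]
      refine infDist_eq_of_forall (right_mem_segment _ _ _) fun Q hQ => ?_
      obtain ⟨t, -, h0, rfl⟩ := mem_segment_iff_along.1 hQ
      simpa using hle 1 t (by nlinarith)

lemma dotProd_along_nonpos_iff (hAB : A ≠ B) (t : ℝ) :
    dotProd (along A B t) A (along A B t) B ≤ 0 ↔ 0 ≤ t ∧ t ≤ 1 := by
  have ha := dotProd_self_pos hAB
  rw [dotProd_along]
  constructor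
  · intro h
    have : 0 ≤ t * (1 - t) := by nlinarith
    constructor <;> nlinarith
  · rintro ⟨h1, h2⟩
    nlinarith [mul_nonneg h1 (sub_nonneg.2 h2)]

open Classical in
lemma algorithm2Step_val (hAB : A ≠ B) (s : PolygonData) : (algorithm2Step P A B s).val =
    ⟨s.crossingNumber + (if rayCross A B P ≠ 0 then 1 else 0), s.area + shoelace A B / 2,
      min s.dMin ((Metric.infDist P (segment ℝ A B) : ℝ) : EReal), max s.dMax (dist P A)⟩ := by
  rw [infDist_segment hAB]
  simp only [rayCross_ne_zero_iff]
  unfold algorithm2Step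
  have e : 2⁻¹ * shoelace A B = shoelace A B / 2 := by ring
  have e' : ((min (dist P A) (dist P B) : ℝ) : EReal) = min (dist P A : EReal) (dist P B) :=
    EReal.coe_strictMono.monotone.map_min
  by_cases h1 : (A 1 < P 1 ∧ P 1 ≤ B 1) ∨ (B 1 < P 1 ∧ P 1 ≤ A 1) <;>
  by_cases h2 : P 0 < A 0 + (B 0 - A 0) / (B 1 - A 1) * (P 1 - A 1) <;>
  by_cases h3 : 0 ≤ dotProd A P A B / dotProd A B A B ∧ dotProd A P A B / dotProd A B A B ≤ 1 <;>
  simp [h1, h2, h3, e, e', pointAt_eq_along, -pointAt_val, dotProd_along_nonpos_iff hAB]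

end

section
variable {n : ℕ} [NeZero n] {S : Fin n → Plane} {P : Plane}

/-- Counting crossings without signs agrees with the signed count modulo `2`. The extremal distances
are described by the inequalities that define a minimum and a maximum, so the initial values `⊤` and
`0` do no harm. -/
lemma algorithm2_loop (hS : IsSimplePolygon S) (P : Plane) (L : List (Fin n)) :
    ∀ s : PolygonData, ∃ D : PolygonData,
      (forLoop (fun s i => algorithm2Step P (S i) (S (i + 1)) s) L s).val = D ∧
      D.area = s.area + (L.map fun i => shoelace (S i) (S (i + 1)) / 2).sum ∧
      Even ((D.crossingNumber : ℤ) - s.crossingNumber -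
        (L.map fun i => rayCross (S i) (S (i + 1)) P).sum) ∧
      (∀ x, x ≤ D.dMin ↔ x ≤ s.dMin ∧
        ∀ i ∈ L, x ≤ ((Metric.infDist P (segment ℝ (S i) (S (i + 1))) : ℝ) : EReal)) ∧
      ∀ x, D.dMax ≤ x ↔ s.dMax ≤ x ∧ ∀ i ∈ L, dist P (S i) ≤ x := by
  induction L with
  | nil => exact fun s => ⟨s, by simp [forLoop]⟩
  | cons i L ih =>
    intro s
    obtain ⟨D, hD, h1, h2, h3, h4⟩ := ih (algorithm2Step P (S i) (S (i + 1)) s).val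
    refine ⟨D, by rw [forLoop, Timed.val_bind, Timed.val_bind, hD], ?_, ?_, ?_, ?_⟩
    all_goals rw [algorithm2Step_val (hS.ne_succ i)] at h1 h2 h3 h4
    · rw [h1]; simp [add_assoc]
    · have hr : rayCross (S i) (S (i + 1)) P = 0 ∨ rayCross (S i) (S (i + 1)) P = 1 ∨
          rayCross (S i) (S (i + 1)) P = -1 := by
        unfold rayCross; split_ifs <;> simp
      rw [List.map_cons, List.sum_cons]
      dsimp only at h2
      set r := (L.map fun i => rayCross (S i) (S (i + 1)) P).sum
      rcases hr with hr | hr | hr <;> rw [hr] at h2 ⊢ <;> push_cast at h2 <;>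
        obtain ⟨k, hk⟩ := h2
      · exact ⟨k, by simp at hk; omega⟩
      · exact ⟨k, by omega⟩
      · exact ⟨k + 1, by omega⟩
    · intro x
      rw [h3]
      simp [and_assoc]
    · intro x
      rw [h4]
      simp [and_assoc]

lemma algorithm2_area (hS : IsSimplePolygon S) (P : Plane) :
    (algorithm2 P S).val.area = signedArea S := by
  obtain ⟨D, hD, h, -⟩ := algorithm2_loop hS P (List.finRange n) ⟨0, 0, ⊤, 0⟩
  rw [algorithm2, hD, h, signedArea, Fin.sum_univ_def, zero_add]

lemma algorithm2_crossingNumber (hS : IsSimplePolygon S) (P : Plane) :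
    Even (((algorithm2 P S).val.crossingNumber : ℤ) - winding S P) := by
  obtain ⟨D, hD, -, h, -⟩ := algorithm2_loop hS P (List.finRange n) ⟨0, 0, ⊤, 0⟩
  rw [algorithm2, hD, winding, Fin.sum_univ_def]
  simpa using h

lemma odd_crossingNumber_iff (hS : IsSimplePolygon S) (hw : PositivelyOriented S) (P : Plane) :
    Odd (algorithm2 P S).val.crossingNumber ↔ winding S P = 1 := by
  have h := algorithm2_crossingNumber hS P
  rw [← Int.odd_coe_nat]
  rcases hw.winding_eq P with h0 | h0 <;> rw [h0] at h ⊢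
  · rw [sub_zero] at h
    simpa using h
  · have := h.add_odd odd_one
    simpa using this

lemma algorithm2_dMin (hS : IsSimplePolygon S) (P : Plane) :
    (algorithm2 P S).val.dMin = ((Metric.infDist P (boundary S) : ℝ) : EReal) := by
  obtain ⟨D, hD, -, -, h, -⟩ := algorithm2_loop hS P (List.finRange n) ⟨0, 0, ⊤, 0⟩
  rw [algorithm2, hD]
  simp only [le_top, true_and, List.mem_finRange, forall_const] at h
  have hne : (boundary S).Nonempty := ⟨S 0, segment_subset_boundary S 0 (left_mem_segment _ _ _)⟩
  apply le_antisymm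
  · obtain ⟨R, hR, e⟩ := (isCompact_boundary S).exists_infDist_eq_dist hne P
    obtain ⟨i, hi⟩ := Set.mem_iUnion.1 hR
    refine ((h _).1 le_rfl i).trans ?_
    rw [e]
    exact_mod_cast Metric.infDist_le_dist_of_mem hi
  · refine (h _).2 fun i => ?_
    exact_mod_cast Metric.infDist_le_infDist_of_subset (segment_subset_boundary S i)
      ⟨_, left_mem_segment _ _ _⟩

/-- A closed disk about `P` that contains the vertices contains the edges by convexity, so the
vertices suffice. -/
lemma algorithm2_dMax (hS : IsSimplePolygon S) (P : Plane) :
    IsGreatest ((fun Q => dist P Q) '' boundary S) (algorithm2 P S).val.dMax := by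
  obtain ⟨D, hD, -, -, -, h⟩ := algorithm2_loop hS P (List.finRange n) ⟨0, 0, ⊤, 0⟩
  rw [algorithm2, hD]
  simp only [List.mem_finRange, forall_const] at h
  obtain ⟨i, hi⟩ := Finite.exists_max fun i => dist P (S i)
  have hle := ((h _).1 le_rfl).2
  have e : D.dMax = dist P (S i) := le_antisymm ((h _).2 ⟨dist_nonneg, hi⟩) (hle i)
  refine ⟨⟨S i, segment_subset_boundary S i (left_mem_segment _ _ _), e.symm⟩, ?_⟩
  rintro _ ⟨Q, hQ, rfl⟩
  obtain ⟨j, hj⟩ := Set.mem_iUnion.1 hQ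
  have := (convex_closedBall P D.dMax).segment_subset (x := S j) (y := S (j + 1))
    (by simpa [dist_comm] using hle j) (by simpa [dist_comm] using hle (j + 1)) hj
  simpa [dist_comm] using this

lemma dMin_eq_zero_iff (hS : IsSimplePolygon S) (P : Plane) :
    (algorithm2 P S).val.dMin = 0 ↔ P ∈ boundary S := by
  have hne : (boundary S).Nonempty := ⟨S 0, segment_subset_boundary S 0 (left_mem_segment _ _ _)⟩
  rw [algorithm2_dMin hS, (isCompact_boundary S).isClosed.mem_iff_infDist_zero hne]
  exact_mod_cast Iff.rfl

end

/-! ### Step counts of the deterministic loops -/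

lemma forLoop_cost_le {ι σ : Type} {body : σ → ι → Timed σ} {K : ℕ}
    (h : ∀ s i, (body s i).cost ≤ K) (L : List ι) :
    ∀ s, (forLoop body L s).cost ≤ (K + 1) * L.length := by
  induction L with
  | nil => intro s; simp [forLoop]
  | cons i L ih =>
    intro s
    rw [forLoop]
    simp only [Timed.cost_bind, tick_cost, List.length_cons]
    have h1 := h s i
    have h2 := ih (body s i).val
    rw [mul_add, mul_one]
    omega

lemma algorithm2Step_cost_le (P A B : Plane) (s : PolygonData) :
    (algorithm2Step P A B s).cost ≤ 219 := by
  simp only [algorithm2Step, Timed.cost_bind, Timed.cost_ite, RExpr.cost_run, testLt_cost,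
    testLe_cost, RExpr.ops_lit, RExpr.ops_add, RExpr.ops_sub, RExpr.ops_mul, RExpr.ops_div,
    RExpr.ops_zero, xOf_ops, yOf_ops, dot_ops, len_ops, segmentIntegral_ops, tick_cost,
    Timed.cost_pure, pointAt_cost]
  split_ifs <;> simp

lemma algorithm2_cost_le {n : ℕ} [NeZero n] (P : Plane) (S : Fin n → Plane) :
    (algorithm2 P S).cost ≤ 220 * n := by
  have := forLoop_cost_le (K := 219) (body := fun s i => algorithm2Step P (S i) (S (i + 1)) s)
    (fun s i => algorithm2Step_cost_le _ _ _ _) (List.finRange n) ⟨0, 0, ⊤, 0⟩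
  rw [algorithm2]
  simpa using this

lemma algorithm1_cost_le (A B P : Plane) (d : ℝ) : (algorithm1 A B P d).cost ≤ 300 := by
  simp only [algorithm1, Timed.cost_bind, Timed.cost_ite, RExpr.cost_run, testLt_cost,
    testLe_cost, testEq_cost, RExpr.ops_lit, RExpr.ops_add, RExpr.ops_sub, RExpr.ops_mul,
    RExpr.ops_div, RExpr.ops_neg, RExpr.ops_sqrt, RExpr.ops_zero, dot_ops, Timed.cost_pure, pointAt_cost]
  split_ifs <;> simp

lemma algorithm1_length_le (A B P : Plane) (d : ℝ) : (algorithm1 A B P d).val.length ≤ 2 := by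
  simp only [algorithm1, Timed.val_bind, Timed.val_ite, Timed.val_pure]
  split_ifs <;> simp

lemma firstOther_cost_le (A : Plane) (l : List Plane) : (firstOther A l).cost ≤ 7 * l.length := by
  induction l with
  | nil => simp [firstOther]
  | cons I l ih =>
    simp only [firstOther, Timed.cost_bind, tick_cost, samePoint_cost, Timed.cost_ite,
      Timed.cost_pure, List.length_cons]
    split_ifs <;> omega

lemma algorithm3_cost_le (P B C : Plane) (isIn : Bool) : (algorithm3 P B C isIn).cost ≤ 100 := by
  simp only [algorithm3, tangentAt, Timed.cost_bind, Timed.cost_ite, testLt_cost,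
    testLe_cost, testEq_cost, RExpr.ops_add, RExpr.ops_sub, RExpr.ops_mul,
    RExpr.ops_div, xOf_ops, yOf_ops, Timed.cost_pure]
  split_ifs <;> simp

lemma addVertex_cost_le (P B C : Plane) (isIn arc : Bool) (s : Scan) :
    (addVertex P B C isIn arc s).cost ≤ 102 := by
  have := algorithm3_cost_le P B C isIn
  simp only [addVertex, addMark, Timed.cost_bind, Timed.cost_ite, tick_cost, Timed.cost_pure]
  split_ifs <;> omega

lemma addSegment_cost (A B : Plane) (s : Scan) : (addSegment A B s).cost = 11 := rfl

lemma addMark_cost (I : Plane) (b : Bool) (s : Scan) : (addMark I b s).cost = 2 := rfl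

lemma position_cost_le (A B I : Plane) : (position A B I).cost ≤ 10 := by
  simp only [position, Timed.cost_bind, Timed.cost_ite, RExpr.cost_run, testEq_cost, RExpr.ops_sub,
    RExpr.ops_div, xOf_ops, yOf_ops]
  split_ifs <;> simp

lemma scanEdge_cost_le (P : Plane) (d : ℝ) (A B C : Plane) (s : Scan) :
    (scanEdge P d A B C s).cost ≤ 549 := by
  have h1 := algorithm1_cost_le A B P d
  have h2 := firstOther_cost_le A (algorithm1 A B P d).val
  have h3 := algorithm1_length_le A B P d
  have hv := addVertex_cost_le P B C
  unfold scanEdge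
  generalize algorithm1 A B P d = t at *
  simp only [Timed.cost_bind, Timed.cost_ite, testLt_cost, testLe_cost, RExpr.ops_lit, len_ops]
  rcases hl : t.val with _ | ⟨I, _ | ⟨J, _ | ⟨K, l⟩⟩⟩
  all_goals
    rw [hl] at h2 h3
    simp only [List.length_cons, List.length_nil] at h2 h3
    rcases hf : (firstOther A t.val).val with _ | I'
    all_goals
      rw [hl] at hf
      simp only [hf, addSegment_cost, addMark_cost, Timed.cost_bind, Timed.cost_pure,
        testLe_cost, RExpr.ops_lit, samePoint_cost]
      have p1 := position_cost_le A B
      split_ifs <;> (try grw [hv]) <;> (try grw [p1]) <;> (try grw [p1]) <;> omega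

lemma scan_cost_le {n : ℕ} [NeZero n] (P : Plane) (S : Fin n → Plane) (d : ℝ) :
    (scan P S d).cost ≤ 550 * n := by
  have := forLoop_cost_le (K := 549)
    (body := fun s i => scanEdge P d (S i) (S (i + 1)) (S (i + 1 + 1)) s)
    (fun s i => scanEdge_cost_le _ _ _ _ _ _) (List.finRange n) ⟨0, []⟩
  rw [scan]
  simpa using this

lemma angleOf_cost_le (P : Plane) (d : ℝ) (I : Plane) : (angleOf P d I).cost ≤ 11 := by
  simp only [angleOf, Timed.cost_bind, Timed.cost_ite, RExpr.cost_run, testLe_cost, RExpr.ops_sub,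
    RExpr.ops_div, RExpr.ops_arccos, RExpr.ops_lit, xOf_ops, yOf_ops]
  split_ifs <;> simp

lemma computeAngles_cost_le (P : Plane) (d : ℝ) (l : List (Plane × Bool)) :
    (computeAngles P d l).cost ≤ 12 * l.length := by
  induction l with
  | nil => simp [computeAngles]
  | cons m l ih =>
    have := angleOf_cost_le P d m.1
    simp only [computeAngles, Timed.cost_bind, tick_cost, Timed.cost_pure, List.length_cons]
    omega

lemma addArc_cost_le (P : Plane) (d : ℝ) (A B : Mark) (ℓ : ℝ) : (addArc P d A B ℓ).cost ≤ 50 := by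
  simp only [addArc, arcIntegral, Timed.cost_bind, Timed.cost_ite, RExpr.cost_run, testLe_cost,
    RExpr.ops_sub, RExpr.ops_mul, RExpr.ops_add, RExpr.ops_lit, xOf_ops, yOf_ops, tick_cost,
    Timed.cost_pure]
  split_ifs <;> simp

lemma addArcs_cost_le (P : Plane) (d : ℝ) (first : Mark) (l : List Mark) :
    ∀ ℓ, (addArcs P d first l ℓ).cost ≤ 50 * l.length := by
  induction l with
  | nil => intro ℓ; simp [addArcs]
  | cons A l ih =>
    intro ℓ
    cases l with
    | nil => simpa [addArcs] using addArc_cost_le P d A first ℓ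
    | cons B l =>
      have h1 := addArc_cost_le P d A B ℓ
      have h2 := ih (addArc P d A B ℓ).val
      simp only [addArcs, Timed.cost_bind, List.length_cons] at h2 ⊢
      omega

end PolygonDistance
end

noncomputable section
namespace PolygonDistance

/-! ### Algorithm 4 -/

/-- The event that the distance is at most `d` is a closed ball. Measurability of this ball is
enough to evaluate the conditional probability, and `A` may be any set. -/
lemma distanceCDF_eq {E : Type*} [NormedAddCommGroup E] [MeasurableSpace E] [BorelSpace E]
    {μ : Measure E} {A : Set E} (h0 : μ A ≠ 0) (ht : μ A ≠ ∞) (P : E) (d : ℝ) :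
    distanceCDF μ A P d = μ.real (A ∩ Metric.closedBall P d) / μ.real A := by
  have := ProbabilityTheory.cond_isProbabilityMeasure_of_finite h0 ht
  have hm : Measurable fun X => dist X P := by
    exact (continuous_id.dist continuous_const).measurable
  have := Measure.isProbabilityMeasure_map (μ := ProbabilityTheory.cond μ A) hm.aemeasurable
  rw [distanceCDF, ProbabilityTheory.cdf_eq_real, measureReal_def,
    Measure.map_apply hm measurableSet_Iic]
  have e : (fun X => dist X P) ⁻¹' Set.Iic d = Metric.closedBall P d := by
    ext; simp
  rw [e, ProbabilityTheory.cond_apply' Metric.isClosed_closedBall.measurableSet,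
    ENNReal.toReal_mul, ENNReal.toReal_inv, measureReal_def, measureReal_def, div_eq_inv_mul]

/-- Every run of the procedure sorts its input by ascending angle. -/
def CorrectSort (sort : List Mark → RandTimed (List Mark)) : Prop :=
  ∀ l, ∀ r ∈ (sort l).runs, r.val.Perm l ∧ r.val.Pairwise fun a b => a.angle ≤ b.angle

lemma correctSort_mergeSort : CorrectSort fun l => RandTimed.lift (mergeSort l) := by
  intro l r hr
  rw [RandTimed.mem_runs_lift] at hr
  subst hr
  exact ⟨mergeSort_perm l, mergeSort_pairwise l⟩

lemma correctSort_quickSort : CorrectSort quickSort :=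
  fun l r hr => quickSortAux_runs l.length l le_rfl r hr

section
variable {n : ℕ} [NeZero n] {S : Fin n → Plane} {P : Plane} {d : ℝ}
  {sort : List Mark → RandTimed (List Mark)}

lemma computeAngles_length (P : Plane) (d : ℝ) (l : List (Plane × Bool)) :
    (computeAngles P d l).val.length = l.length := by
  rw [computeAngles_val, List.length_map]

lemma marks_length_le (hS : IsSimplePolygon S) (P : Plane) (hd : 0 ≤ d) :
    (scan P S d).val.marks.length ≤ 2 * n := by
  obtain ⟨X, Y, new, h⟩ := exists_scanResult hS P hd
  exact h.length_le

/-- The runs of Algorithm 4: value and step count. -/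
lemma algorithm4_runs (hS : IsSimplePolygon S) (hw : PositivelyOriented S) (hd : 0 ≤ d)
    (hsort : CorrectSort sort) {c : ℕ} (hc : Odd c ↔ winding S P = 1) {L : ℝ}
    (hL : L = signedArea S) {r : Timed Output} (hr : r ∈ (algorithm4 sort P S c L d).runs) :
    r.val.area = volume.real (planeRegion S ∩ Metric.closedBall P d) ∧
      r.val.cdf = r.val.area / volume.real (planeRegion S) ∧
      ∀ T, (∀ l, l.length ≤ 2 * n → ∀ q ∈ (sort l).runs, q.cost ≤ T) → r.cost ≤ 700 * n + T := by
  have hpos := hS.volume_pos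
  have hA := hw.signedArea_eq hS
  have hn : 1 ≤ n := NeZero.one_le
  have hscan := scan_cost_le P S d
  rw [algorithm4, RandTimed.liftM_eq, RandTimed.mem_runs_lift_bind] at hr
  obtain ⟨r, hr, rfl⟩ := hr
  rw [RandTimed.liftM_eq, RandTimed.mem_runs_lift_bind] at hr
  obtain ⟨r, hr, rfl⟩ := hr
  dsimp only [tick_cost] at *
  rcases hm : (scan P S d).val.marks with _ | ⟨m, ms⟩
  · simp only [hm] at hr
    have key := area_of_marks_eq_nil hS hw hd hm
    rw [RandTimed.liftM_eq, RandTimed.mem_runs_lift_bind] at hr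
    obtain ⟨r, hr, rfl⟩ := hr
    rw [testEq_cost]
    by_cases hI : (scan P S d).val.integral = L
    · rw [if_pos (by simpa using hI), RandTimed.mem_runs_pure] at hr
      subst hr
      -- The area of the region is positive, so the line integral cannot be both `0` and `L`.
      have hv := (key.resolve_left fun h => by rw [h.1, hL, hA] at hI; linarith).2
      refine ⟨?_, ?_, fun T _ => ?_⟩
      · rw [hv, ← hL, ← hI]; rfl
      · rw [Timed.val_pure, ← hA, hI, hL, div_self]
        rw [hA]; exact hpos.ne'
      · simp only [RExpr.ops_lit, Timed.cost_pure]; omega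
    · rw [if_neg (by simpa using hI)] at hr
      -- Otherwise the open disk does not meet the boundary in an essential way, and its part in the
      -- region has the area of the disk times the winding number of the center.
      have hv := (key.resolve_right fun h => hI (h.1.trans hL.symm)).2
      by_cases hodd : c % 2 = 1
      · rw [if_pos hodd, RandTimed.mem_runs_lift_bind] at hr
        obtain ⟨r, hr, rfl⟩ := hr
        rw [RandTimed.liftM_eq, RandTimed.mem_runs_lift_bind] at hr
        obtain ⟨r, hr, rfl⟩ := hr
        rw [RandTimed.liftM_eq, RandTimed.mem_runs_lift_bind] at hr
        obtain ⟨r, hr, rfl⟩ := hr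
        rw [RandTimed.mem_runs_pure] at hr
        subst hr
        rw [hc.1 (Nat.odd_iff.2 hodd)] at hv
        refine ⟨?_, ?_, fun T _ => ?_⟩
        · rw [hv]; simp; ring
        · simp [hL, hA]
        · simp; omega
      · rw [if_neg hodd, RandTimed.mem_runs_lift_bind] at hr
        obtain ⟨r, hr, rfl⟩ := hr
        rw [RandTimed.mem_runs_pure] at hr
        subst hr
        have h0 : winding S P = 0 :=
          (hw.winding_eq P).resolve_right fun h => hodd (Nat.odd_iff.1 (hc.2 h))
        rw [h0] at hv
        refine ⟨?_, ?_, fun T _ => ?_⟩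
        · rw [hv]; simp
        · simp
        · simp; omega
  · simp only [hm] at hr
    rw [← hm, RandTimed.liftM_eq, RandTimed.mem_runs_lift_bind] at hr
    obtain ⟨r, hr, rfl⟩ := hr
    rw [RandTimed.mem_runs_bind] at hr
    obtain ⟨q, hq, r, hr, rfl⟩ := hr
    obtain ⟨hp, hs⟩ := hsort _ _ hq
    obtain ⟨first, t, hft, hv⟩ := addArcs_of_sorted hS hw hd (by simp [hm]) hp hs
    have hlen := hp.length_eq
    have hmn := marks_length_le hS P hd
    have hang := computeAngles_cost_le P d (scan P S d).val.marks
    have harc := addArcs_cost_le P d first q.val (scan P S d).val.integral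
    rw [computeAngles_length] at hlen
    simp only [hft] at hr
    rw [← hft, RandTimed.liftM_eq, RandTimed.mem_runs_lift_bind] at hr
    obtain ⟨r, hr, rfl⟩ := hr
    rw [RandTimed.liftM_eq, RandTimed.mem_runs_lift_bind] at hr
    obtain ⟨r, hr, rfl⟩ := hr
    rw [RandTimed.mem_runs_pure] at hr
    subst hr
    refine ⟨hv, ?_, fun T hT => ?_⟩
    · simp [hL, hA]
    · have := hT _ (by rwa [computeAngles_length]) q hq
      simp
      omega

lemma algorithm4_expectedCost_le (hS : IsSimplePolygon S) (hd : 0 ≤ d) (c : ℕ) (L : ℝ) {T : ℝ≥0∞}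
    (hT : ∀ l, l.length ≤ 2 * n → (sort l).expectedCost ≤ T) (hsort : CorrectSort sort) :
    (algorithm4 sort P S c L d).expectedCost ≤ (700 * n : ℕ) + T := by
  have hn : 1 ≤ n := NeZero.one_le
  have hscan := scan_cost_le P S d
  -- Pays `a` deterministic steps out of the budget `k` and leaves `b` for the rest; the cost `T` of
  -- sorting is kept apart.
  have conv {a b k : ℕ} {x : ℝ≥0∞} (hx : x ≤ b + T) (h : a + b ≤ k) : (a : ℝ≥0∞) + x ≤ k + T := by
    calc (a : ℝ≥0∞) + x ≤ a + (b + T) := by gcongr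
      _ = (a + b : ℕ) + T := by push_cast; ring
      _ ≤ _ := by gcongr
  have conv0 {a : ℕ} : ((a : ℕ) : ℝ≥0∞) + 0 ≤ a + T := by gcongr; exact bot_le
  rw [algorithm4, RandTimed.liftM_eq, RandTimed.expectedCost_lift_bind]
  refine conv (b := 150 * n) ?_ (by omega)
  rw [RandTimed.liftM_eq, RandTimed.expectedCost_lift_bind, tick_cost]
  refine conv (b := 149 * n) ?_ (by omega)
  rcases hm : (scan P S d).val.marks with _ | ⟨m, ms⟩
  · simp only
    rw [RandTimed.liftM_eq, RandTimed.expectedCost_lift_bind, testEq_cost]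
    refine conv (b := 10) ?_ (by simp; omega)
    split_ifs
    · rw [RandTimed.expectedCost_pure]; exact bot_le
    · rw [RandTimed.expectedCost_lift_bind]
      simp only [RandTimed.liftM_eq]
      rw [RandTimed.expectedCost_lift_bind, RandTimed.expectedCost_lift_bind,
        RandTimed.expectedCost_pure]
      refine le_trans ?_ le_self_add
      simp
      norm_num
    · rw [RandTimed.expectedCost_lift_bind, RandTimed.expectedCost_pure]
      refine le_trans ?_ le_self_add
      simp
  · simp only
    rw [← hm, RandTimed.liftM_eq, RandTimed.expectedCost_lift_bind]
    have hmn := marks_length_le hS P hd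
    have hang := computeAngles_cost_le P d (scan P S d).val.marks
    refine conv (b := 100 * n + 3) ?_ (by omega)
    have hk := hT (computeAngles P d (scan P S d).val.marks).val (by rwa [computeAngles_length])
    rw [add_comm]
    refine (RandTimed.expectedCost_bind_le _ _ (c := (100 * n + 3 : ℕ)) fun q hq => ?_).trans
      (by gcongr)
    have hlen := (hsort _ _ hq).1.length_eq
    rw [computeAngles_length] at hlen
    rcases hl : q.val with _ | ⟨first, t⟩
    · simp only
      rw [RandTimed.liftM_eq, RandTimed.expectedCost_lift_bind, RandTimed.liftM_eq,
        RandTimed.expectedCost_lift_bind, RandTimed.expectedCost_pure]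
      simp only [Timed.cost_pure, RExpr.cost_run, RExpr.ops_div, RExpr.ops_lit]
      norm_cast
      omega
    · simp only
      have harc := addArcs_cost_le P d first q.val (scan P S d).val.integral
      rw [← hl, RandTimed.liftM_eq, RandTimed.expectedCost_lift_bind, RandTimed.liftM_eq,
        RandTimed.expectedCost_lift_bind, RandTimed.expectedCost_pure]
      simp only [RExpr.cost_run, RExpr.ops_div, RExpr.ops_lit]
      norm_cast
      omega

end

end PolygonDistance
end

noncomputable section
namespace PolygonDistance

/-! ### Bounds of the form `C n log n` -/

lemma one_le_log {n : ℕ} (hn : 3 ≤ n) : 1 ≤ Real.log n := by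
  rw [Real.le_log_iff_exp_le (by positivity)]
  have : (3 : ℝ) ≤ n := by exact_mod_cast hn
  linarith [Real.exp_one_lt_d9]

/-- A power of two with exponent one less than the rounded logarithm is below `2 * n`. Taking
logarithms, with `log 2 > 0.69` and `1 ≤ log n` for `n ≥ 3`, absorbs the constants. -/
lemma clog_le {n : ℕ} (hn : 3 ≤ n) : (Nat.clog 2 (2 * n) : ℝ) ≤ 4 * Real.log n := by
  have h1 := Nat.pow_pred_clog_lt_self one_lt_two (x := 2 * n) (by omega)
  have h2 : 0 < Nat.clog 2 (2 * n) := Nat.clog_pos one_lt_two (by omega)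
  obtain ⟨k, hk⟩ := Nat.exists_eq_succ_of_ne_zero h2.ne'
  rw [hk, Nat.pred_succ] at h1
  have hlog := one_le_log hn
  have hn0 : (0 : ℝ) < n := by positivity
  have h3 : (k : ℝ) * Real.log 2 ≤ Real.log 2 + Real.log n := by
    rw [← Real.log_mul two_ne_zero hn0.ne', ← Real.log_pow]
    refine Real.log_le_log (by positivity) ?_
    exact_mod_cast h1.le
  rw [hk]
  push_cast
  have := Real.log_two_gt_d9
  have := Real.log_two_lt_d9
  have hk0 : (0 : ℝ) ≤ k := by positivity
  nlinarith

lemma mergeSort_cost_le_of_length_le {n : ℕ} (l : List Mark) (hl : l.length ≤ 2 * n) :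
    (mergeSort l).cost ≤ 7 * (2 * n * Nat.clog 2 (2 * n)) + 1 := by
  refine (mergeSort_cost_le l).trans ?_
  gcongr

lemma mergeSort_total_le {n : ℕ} (hn : 3 ≤ n) {k : ℕ}
    (hk : k ≤ 2000 * n + (7 * (2 * n * Nat.clog 2 (2 * n)) + 1)) :
    (k : ℝ) ≤ 3000 * (n * Real.log n) := by
  have h1 := one_le_log hn
  have h2 := clog_le hn
  have hn0 : (3 : ℝ) ≤ n := by exact_mod_cast hn
  have h3 : (k : ℝ) ≤ 2000 * n + (7 * (2 * n * Nat.clog 2 (2 * n)) + 1) := by exact_mod_cast hk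
  have h4 : (n : ℝ) ≤ n * Real.log n := by nlinarith
  have h5 : (n : ℝ) * Nat.clog 2 (2 * n) ≤ n * (4 * Real.log n) := by gcongr
  nlinarith

lemma quickSort_expectedCost_le {n : ℕ} (l : List Mark) (hl : l.length ≤ 2 * n) :
    (quickSort l).expectedCost ≤ ENNReal.ofReal (quickSortBound (2 * n)) :=
  (quickSortAux_expectedCost_le _ l).trans (ENNReal.ofReal_le_ofReal (quickSortBound_mono hl))

/-- For `n ≥ 3` the harmonic number of `2 * n` is at most `1 + log 2 + log n ≤ 3 * log n`, and `2 *
n + 1 ≤ 3 * n`; the bound for Quicksort is then far below the margin left by the linear part. -/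
lemma quickSort_total_le {n : ℕ} (hn : 3 ≤ n) {k : ℕ} (hk : k ≤ 2000 * n) {x : ℝ≥0∞}
    (hx : x ≤ (k : ℝ≥0∞) + ENNReal.ofReal (quickSortBound (2 * n))) :
    x ≤ ENNReal.ofReal (3000 * (n * Real.log n)) := by
  refine hx.trans ?_
  rw [← ENNReal.ofReal_natCast, ← ENNReal.ofReal_add (by positivity) (quickSortBound_nonneg _)]
  refine ENNReal.ofReal_le_ofReal ?_
  have h1 := one_le_log hn
  have hn0 : (3 : ℝ) ≤ n := by exact_mod_cast hn
  have h2 := harmonic_le_one_add_log (2 * n)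
  push_cast at h2
  rw [Real.log_mul two_ne_zero (by positivity)] at h2
  have := Real.log_two_lt_d9
  have hk' : (k : ℝ) ≤ 2000 * n := by exact_mod_cast hk
  have h3 : ((harmonic (2 * n) : ℚ) : ℝ) ≤ 3 * Real.log n := by linarith
  have h4 : (n : ℝ) ≤ n * Real.log n := by nlinarith
  unfold quickSortBound
  push_cast
  have h5 : (2 * (n : ℝ) + 1) * ((harmonic (2 * n) : ℚ) : ℝ) ≤ (3 * n) * (3 * Real.log n) := by
    have : (0 : ℝ) ≤ Real.log n := by linarith
    calc _ ≤ (2 * (n : ℝ) + 1) * (3 * Real.log n) := by gcongr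
      _ ≤ _ := by gcongr; linarith
  nlinarith

/-! ### The plane algorithm -/

section
variable {n : ℕ} [NeZero n] {S : Fin n → Plane} {d : ℝ}
  {sort : List Mark → RandTimed (List Mark)}

lemma planeAlgorithm_runs (hS : IsSimplePolygon S) (hw : PositivelyOriented S) (P : Plane)
    (hd : 0 ≤ d) (hsort : CorrectSort sort) {r : Timed Output}
    (hr : r ∈ (planeAlgorithm sort P S d).runs) :
    r.val.area = volume.real (planeRegion S ∩ Metric.closedBall P d) ∧
      r.val.cdf = r.val.area / volume.real (planeRegion S) ∧
      ∀ T, (∀ l, l.length ≤ 2 * n → ∀ q ∈ (sort l).runs, q.cost ≤ T) → r.cost ≤ 920 * n + T := by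
  rw [planeAlgorithm, RandTimed.liftM_eq, RandTimed.mem_runs_lift_bind] at hr
  obtain ⟨r, hr, rfl⟩ := hr
  obtain ⟨h1, h2, h3⟩ := algorithm4_runs hS hw hd hsort (odd_crossingNumber_iff hS hw P)
    (algorithm2_area hS P) hr
  refine ⟨h1, h2, fun T hT => ?_⟩
  have := h3 T hT
  have := algorithm2_cost_le P S
  dsimp only
  omega

lemma planeAlgorithm_expectedCost_le (hS : IsSimplePolygon S) (P : Plane) (hd : 0 ≤ d)
    (hsort : CorrectSort sort) {T : ℝ≥0∞}
    (hT : ∀ l, l.length ≤ 2 * n → (sort l).expectedCost ≤ T) :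
    (planeAlgorithm sort P S d).expectedCost ≤ (920 * n : ℕ) + T := by
  rw [planeAlgorithm, RandTimed.liftM_eq, RandTimed.expectedCost_lift_bind]
  have h1 := algorithm4_expectedCost_le hS hd (algorithm2 P S).val.crossingNumber
    (algorithm2 P S).val.area hT hsort (P := P)
  have h2 : ((algorithm2 P S).cost : ℝ≥0∞) ≤ (220 * n : ℕ) := by
    exact_mod_cast algorithm2_cost_le P S
  calc _ ≤ ((220 * n : ℕ) : ℝ≥0∞) + ((700 * n : ℕ) + T) := add_le_add h2 h1
    _ = _ := by push_cast; ring

lemma volume_planeRegion_ne_top (hw : PositivelyOriented S) : volume (planeRegion S) ≠ ∞ :=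
  hw.isBounded.measure_lt_top.ne

lemma volume_planeRegion_ne_zero (hS : IsSimplePolygon S) : volume (planeRegion S) ≠ 0 := by
  intro h
  have := hS.volume_pos
  rw [measureReal_def, h] at this
  simp at this

/-- The assertions about Algorithm 2 in the plane. -/
lemma algorithm2_correct (hS : IsSimplePolygon S) (hw : PositivelyOriented S) (P : Plane) :
    0 < volume.real (planeRegion S) ∧
      (algorithm2 P S).val.area = volume.real (planeRegion S) ∧
      (algorithm2 P S).val.dMin = ((Metric.infDist P (boundary S) : ℝ) : EReal) ∧
      IsGreatest ((fun Q => dist P Q) '' boundary S) (algorithm2 P S).val.dMax ∧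
      (P ∈ boundary S ↔ (algorithm2 P S).val.dMin = 0) ∧
      (P ∉ boundary S →
        (P ∈ interior (planeRegion S) ↔ Odd (algorithm2 P S).val.crossingNumber)) ∧
      (P ∈ planeRegion S ↔
        Odd (algorithm2 P S).val.crossingNumber ∨ (algorithm2 P S).val.dMin = 0) := by
  refine ⟨hS.volume_pos, (algorithm2_area hS P).trans (hw.signedArea_eq hS), algorithm2_dMin hS P,
    algorithm2_dMax hS P, (dMin_eq_zero_iff hS P).symm, fun hP => ?_, ?_⟩
  · rw [odd_crossingNumber_iff hS hw, hw.mem_interior_iff hP]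
  · rw [odd_crossingNumber_iff hS hw, dMin_eq_zero_iff hS]
    by_cases hP : P ∈ boundary S
    · exact ⟨fun _ => .inr hP, fun _ => Or.inl hP⟩
    · rw [hw.mem_region_iff P hP]
      simp [hP]

end

end PolygonDistance
end

noncomputable section
namespace PolygonDistance

/-! ### A plane of three-space -/

/-- The point with coordinates `p` in the frame `(O, u, v)`. -/
def framePoint (O u v : Space) (p : Plane) : Space := O + (p 0 • u + p 1 • v)

/-- `(O, u, v)` is an orthonormal frame of the affine plane `F`. -/
structure IsFrame (F : AffineSubspace ℝ Space) (O u v : Space) : Prop where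
  mem : O ∈ F
  left : inner ℝ u u = (1 : ℝ)
  right : inner ℝ v v = (1 : ℝ)
  orthogonal : inner ℝ u v = (0 : ℝ)
  direction_eq : F.direction = Submodule.span ℝ {u, v}

/-- The coordinates of the orthogonal projection in the frame `(O, u, v)`. -/
def coordsIn (O u v Q : Space) : Plane := !₂[inner ℝ (Q - O) u, inner ℝ (Q - O) v]

namespace IsFrame

variable {F : AffineSubspace ℝ Space} {O u v : Space} (h : IsFrame F O u v)
include h

lemma neg_right : IsFrame F O u (-v) where
  mem := h.mem
  left := h.left
  right := by rw [inner_neg_neg, h.right]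
  orthogonal := by rw [inner_neg_right, h.orthogonal, neg_zero]
  direction_eq := by
    rw [h.direction_eq]
    ext x
    simp only [Submodule.mem_span_pair]
    constructor
    · rintro ⟨a, b, rfl⟩; exact ⟨a, -b, by simp⟩
    · rintro ⟨a, b, rfl⟩; exact ⟨a, -b, by simp⟩

lemma mem_iff (Q : Space) : Q ∈ F ↔ ∃ p, framePoint O u v p = Q := by
  rw [← AffineSubspace.vsub_right_mem_direction_iff_mem h.mem, h.direction_eq,
    Submodule.mem_span_pair]
  constructor
  · rintro ⟨a, b, e⟩
    refine ⟨!₂[a, b], ?_⟩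
    simp only [framePoint]
    simp [e]
  · rintro ⟨p, rfl⟩
    exact ⟨p 0, p 1, by simp [framePoint]⟩

lemma inner_self_comb (a b : ℝ) : inner ℝ (a • u + b • v) (a • u + b • v) = a ^ 2 + b ^ 2 := by
  have h' : inner ℝ v u = (0 : ℝ) := by rw [real_inner_comm, h.orthogonal]
  simp only [inner_add_left, inner_add_right, real_inner_smul_left, real_inner_smul_right, h.left,
    h.right, h.orthogonal, h']
  ring

lemma isometry : Isometry (framePoint O u v) := by
  refine Isometry.of_dist_eq fun p q => ?_
  have e : framePoint O u v p - framePoint O u v q = (p 0 - q 0) • u + (p 1 - q 1) • v := by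
    unfold framePoint; module
  rw [← sq_eq_sq₀ dist_nonneg dist_nonneg, dist_sq_eq, dist_eq_norm, e, ← real_inner_self_eq_norm_sq,
    h.inner_self_comb]

lemma inner_framePoint (p : Plane) : inner ℝ (framePoint O u v p - O) u = p 0 ∧
    inner ℝ (framePoint O u v p - O) v = p 1 := by
  have h' : inner ℝ v u = (0 : ℝ) := by rw [real_inner_comm, h.orthogonal]
  simp only [framePoint, add_sub_cancel_left, inner_add_left, real_inner_smul_left, h.left, h.right,
    h.orthogonal, h']
  constructor <;> ring

lemma framePoint_coordsIn {Q : Space} (hQ : Q ∈ F) : framePoint O u v (coordsIn O u v Q) = Q := by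
  obtain ⟨p, rfl⟩ := (h.mem_iff Q).1 hQ
  congr 1
  exact plane_ext (h.inner_framePoint p).1 (h.inner_framePoint p).2

lemma inner_sub_coordsIn (P : Space) :
    inner ℝ (P - framePoint O u v (coordsIn O u v P)) u = (0 : ℝ) ∧
      inner ℝ (P - framePoint O u v (coordsIn O u v P)) v = (0 : ℝ) := by
  have h1 := h.inner_framePoint (coordsIn O u v P)
  have e : P - framePoint O u v (coordsIn O u v P) =
      (P - O) - (framePoint O u v (coordsIn O u v P) - O) := by abel
  rw [e, inner_sub_left _ _ u, inner_sub_left _ _ v, h1.1, h1.2]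
  simp [coordsIn]

lemma orthogonalProjection_eq [Nonempty F] [F.direction.HasOrthogonalProjection] (P : Space) :
    (EuclideanGeometry.orthogonalProjection F P : Space) =
      framePoint O u v (coordsIn O u v P) := by
  set Q := framePoint O u v (coordsIn O u v P)
  have hQ : Q ∈ F := (h.mem_iff Q).2 ⟨_, rfl⟩
  have hort : P - Q ∈ F.directionᗮ := by
    rw [h.direction_eq, Submodule.mem_orthogonal']
    intro x hx
    obtain ⟨a, b, rfl⟩ := Submodule.mem_span_pair.1 hx
    have := h.inner_sub_coordsIn P
    rw [inner_add_right, real_inner_smul_right, real_inner_smul_right, this.1, this.2]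
    ring
  have := EuclideanGeometry.orthogonalProjection_vadd_eq_self hQ hort
  rw [vadd_eq_add, sub_add_cancel] at this
  rw [this]

/-- Pythagoras: the segment from `P` to its projection is orthogonal to both axes. -/
lemma dist_framePoint_sq (P : Space) (p : Plane) : dist (framePoint O u v p) P ^ 2 =
    dist p (coordsIn O u v P) ^ 2 + dist P (framePoint O u v (coordsIn O u v P)) ^ 2 := by
  have h0 := h.inner_sub_coordsIn P
  set c := coordsIn O u v P
  have e : P - framePoint O u v p = (P - framePoint O u v c) +
      ((c 0 - p 0) • u + (c 1 - p 1) • v) := by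
    unfold framePoint; module
  rw [dist_comm, dist_eq_norm, e, norm_add_sq_real, inner_add_right, real_inner_smul_right,
    real_inner_smul_right, h0.1, h0.2, ← real_inner_self_eq_norm_sq (_ • u + _), h.inner_self_comb,
    dist_sq_eq, dist_eq_norm]
  ring

end IsFrame

lemma framePoint_image_segment (O u v : Space) (A B : Plane) : framePoint O u v '' segment ℝ A B =
    segment ℝ (framePoint O u v A) (framePoint O u v B) := by
  ext R
  constructor
  · rintro ⟨Q, ⟨a, b, ha, hb, hab, rfl⟩, rfl⟩
    refine ⟨a, b, ha, hb, hab, ?_⟩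
    have : b = 1 - a := by linarith
    subst this
    simp only [framePoint, PiLp.add_apply, PiLp.smul_apply, smul_eq_mul]
    module
  · rintro ⟨a, b, ha, hb, hab, rfl⟩
    refine ⟨a • A + b • B, ⟨a, b, ha, hb, hab, rfl⟩, ?_⟩
    have : b = 1 - a := by linarith
    subst this
    simp only [framePoint, PiLp.add_apply, PiLp.smul_apply, smul_eq_mul]
    module

lemma framePoint_image_boundary {n : ℕ} [NeZero n] (O u v : Space) (S : Fin n → Plane) :
    framePoint O u v '' boundary S = boundary fun i => framePoint O u v (S i) := by
  rw [boundary, boundary, Set.image_iUnion]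
  exact Set.iUnion_congr fun i => framePoint_image_segment O u v _ _

section
variable {n : ℕ} [NeZero n] {F : AffineSubspace ℝ Space} {O u v : Space} (h : IsFrame F O u v)
  {S : Fin n → Plane}
include h

lemma IsFrame.isSimplePolygon (hV : IsSimplePolygon fun i => framePoint O u v (S i)) :
    IsSimplePolygon S where
  three_le := hV.three_le
  injective := fun i j hij => hV.injective (congrArg _ hij)
  inter_subset := by
    intro i j hij Q hQ
    have hi := h.isometry.injective
    have hm : ∀ i, Q ∈ segment ℝ (S i) (S (i + 1)) → framePoint O u v Q ∈
        segment ℝ (framePoint O u v (S i)) (framePoint O u v (S (i + 1))) := fun i hQ => by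
      rw [← framePoint_image_segment]; exact Set.mem_image_of_mem _ hQ
    have := hV.inter_subset i j hij ⟨hm i hQ.1, hm j hQ.2⟩
    simpa [hi.eq_iff] using this

lemma IsFrame.image_compl : framePoint O u v '' (Set.univ \ boundary S) =
    (F : Set Space) \ boundary fun i => framePoint O u v (S i) := by
  rw [Set.image_sdiff h.isometry.injective, framePoint_image_boundary, Set.image_univ]
  congr 1
  ext Q
  exact (h.mem_iff Q).symm

/-- The frame map is a homeomorphism onto `F`, so connected sets correspond in both directions, and
components are maximal connected sets. -/
lemma IsFrame.image_connectedComponentIn {Q : Plane} (hQ : Q ∈ Set.univ \ boundary S) :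
    framePoint O u v '' connectedComponentIn (Set.univ \ boundary S) Q =
      connectedComponentIn ((F : Set Space) \ boundary fun i => framePoint O u v (S i))
        (framePoint O u v Q) := by
  have hφ := h.isometry
  apply Set.Subset.antisymm
  · refine (isPreconnected_connectedComponentIn.image _
      hφ.continuous.continuousOn).subset_connectedComponentIn
      (Set.mem_image_of_mem _ (mem_connectedComponentIn hQ)) ?_
    rw [← h.image_compl]
    exact Set.image_mono (connectedComponentIn_subset _ _)
  · set C := connectedComponentIn ((F : Set Space) \ boundary fun i => framePoint O u v (S i))
        (framePoint O u v Q)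
    have hC : C ⊆ framePoint O u v '' (Set.univ \ boundary S) := by
      rw [h.image_compl]; exact connectedComponentIn_subset _ _
    have e : framePoint O u v '' (framePoint O u v ⁻¹' C) = C :=
      Set.image_preimage_eq_of_subset (hC.trans (Set.image_subset_range _ _))
    have hpre : IsPreconnected (framePoint O u v ⁻¹' C) := by
      rw [← hφ.isEmbedding.isInducing.isPreconnected_image, e]
      exact isPreconnected_connectedComponentIn
    rw [← e]
    refine Set.image_mono (hpre.subset_connectedComponentIn ?_ ?_)
    · refine mem_connectedComponentIn ?_
      rw [← h.image_compl]
      exact Set.mem_image_of_mem _ hQ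
    · intro R hR
      obtain ⟨R', hR', e'⟩ := hC hR
      rwa [← hφ.injective e']

/-- An isometry preserves boundedness of components both ways, so the region formed within `F` is
the image of the region in the plane. -/
lemma IsFrame.image_planeRegion : framePoint O u v '' planeRegion S =
    region (F : Set Space) fun i => framePoint O u v (S i) := by
  have hφ := h.isometry
  rw [planeRegion, region, region, Set.image_union, framePoint_image_boundary]
  congr 1
  ext R
  constructor
  · rintro ⟨Q, ⟨hQ, hb⟩, rfl⟩
    refine ⟨?_, ?_⟩
    · rw [← h.image_compl]; exact Set.mem_image_of_mem _ hQ
    · rw [← h.image_connectedComponentIn hQ]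
      exact hφ.lipschitz.isBounded_image hb
  · rintro ⟨hR, hb⟩
    rw [← h.image_compl] at hR
    obtain ⟨Q, hQ, rfl⟩ := hR
    refine ⟨Q, ⟨hQ, ?_⟩, rfl⟩
    rw [← h.image_connectedComponentIn hQ] at hb
    have := hφ.antilipschitz.isBounded_preimage hb
    rwa [Set.preimage_image_eq _ hφ.injective] at this

/-- The Euclidean Hausdorff measure is invariant under isometries and normalized to be Lebesgue
measure on the plane. -/
lemma IsFrame.area_image (A : Set Plane) :
    (μHE[2] : Measure Space) (framePoint O u v '' A) = volume A := by
  rw [h.isometry.euclideanHausdorffMeasure_image, EuclideanSpace.euclideanHausdorffMeasure_eq_volume]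

lemma IsFrame.image_inter_closedBall (A : Set Plane) (P : Space) {d : ℝ} (hd : 0 ≤ d)
    (hle : dist P (framePoint O u v (coordsIn O u v P)) ^ 2 ≤ d ^ 2) :
    framePoint O u v '' A ∩ Metric.closedBall P d =
      framePoint O u v '' (A ∩ Metric.closedBall (coordsIn O u v P)
        (Real.sqrt (d ^ 2 - dist P (framePoint O u v (coordsIn O u v P)) ^ 2))) := by
  have key : ∀ p, dist (framePoint O u v p) P ≤ d ↔ dist p (coordsIn O u v P) ≤
      Real.sqrt (d ^ 2 - dist P (framePoint O u v (coordsIn O u v P)) ^ 2) := by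
    intro p
    rw [Real.le_sqrt dist_nonneg (by linarith), ← sq_le_sq₀ dist_nonneg hd, h.dist_framePoint_sq]
    constructor <;> intro <;> linarith
  ext Q
  constructor
  · rintro ⟨⟨p, hp, rfl⟩, hQ⟩
    exact ⟨p, ⟨hp, (key p).1 hQ⟩, rfl⟩
  · rintro ⟨p, ⟨hp, hQ⟩, rfl⟩
    exact ⟨⟨p, hp, rfl⟩, (key p).2 hQ⟩

lemma IsFrame.inter_closedBall_eq_empty {A : Set Space} (hA : A ⊆ F) (P : Space) {d : ℝ}
    (hd : 0 ≤ d) (hlt : d ^ 2 < dist P (framePoint O u v (coordsIn O u v P)) ^ 2) :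
    A ∩ Metric.closedBall P d = ∅ := by
  rw [Set.eq_empty_iff_forall_notMem]
  rintro Q ⟨hQ, hQd⟩
  obtain ⟨p, rfl⟩ := (h.mem_iff Q).1 (hA hQ)
  have h1 := h.dist_framePoint_sq P p
  have h2 : dist (framePoint O u v p) P ^ 2 ≤ d ^ 2 := by
    rw [sq_le_sq₀ dist_nonneg hd]; exact hQd
  nlinarith [sq_nonneg (dist p (coordsIn O u v P))]

end

lemma segment_subset_affineSubspace {F : AffineSubspace ℝ Space} {A B : Space} (hA : A ∈ F)
    (hB : B ∈ F) : segment ℝ A B ⊆ F :=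
  F.convex.segment_subset hA hB

lemma region_subset {n : ℕ} [NeZero n] {F : AffineSubspace ℝ Space} {V : Fin n → Space}
    (hV : ∀ i, V i ∈ F) : region (F : Set Space) V ⊆ F := by
  rintro Q (hQ | hQ)
  · obtain ⟨i, hi⟩ := Set.mem_iUnion.1 hQ
    exact segment_subset_affineSubspace (hV i) (hV (i + 1)) hi
  · exact hQ.1.1

end PolygonDistance
end

noncomputable section
namespace PolygonDistance

/-! ### The algorithm for a polygon in three-space -/

lemma space_ext {a b : Space} (h0 : a 0 = b 0) (h1 : a 1 = b 1) (h2 : a 2 = b 2) : a = b := by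
  ext i
  fin_cases i
  · exact h0
  · exact h1
  · exact h2

lemma subSmul_val (a : Space) (t : ℝ) (b : Space) : (subSmul a t b).val = a - t • b :=
  space_ext (by simp [subSmul]) (by simp [subSmul]) (by simp [subSmul])

lemma dot3_eval (a b : Space) : (dot3 a b).eval = inner ℝ a b := by
  simp only [dot3, RExpr.eval_add, RExpr.eval_mul, RExpr.eval_lit, PiLp.inner_apply,
    Fin.sum_univ_three, RCLike.inner_apply, conj_trivial]
  ring

lemma normalize_val (a : Space) : (normalize a).val = ‖a‖⁻¹ • a := by
  have : ((RExpr.sqrt (dot3 a a)).run).val = ‖a‖ := by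
    rw [RExpr.val_run, RExpr.eval_sqrt, dot3_eval, norm_eq_sqrt_real_inner]
  exact space_ext (by simp [normalize, dot3_eval, div_eq_inv_mul])
    (by simp [normalize, dot3_eval, div_eq_inv_mul])
    (by simp [normalize, dot3_eval, div_eq_inv_mul])

lemma frameCoords_val (O u v Q : Space) : (frameCoords O u v Q).val = coordsIn O u v Q := by
  simp [frameCoords, coordsIn, dot3_eval, subSmul_val]

lemma reflect_coordsIn (O u v Q : Space) :
    (reflect (coordsIn O u v Q)).val = coordsIn O u (-v) Q := by
  simp [reflect, coordsIn]

/-- Linear independence keeps both vectors that are normalized from being zero. The axes lie in the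
direction of `F` and span it by a count of dimensions. -/
lemma isFrame_gramSchmidt {F : AffineSubspace ℝ Space} {A B C : Space}
    (hF : Module.finrank ℝ F.direction = 2) (hA : A ∈ F) (hB : B ∈ F) (hC : C ∈ F)
    (hli : LinearIndependent ℝ ![A - B, C - B]) {u w v : Space} (hu : u = ‖A - B‖⁻¹ • (A - B))
    (hw : w = C - B - (inner ℝ (C - B) u : ℝ) • u) (hv : v = ‖w‖⁻¹ • w) : IsFrame F B u v := by
  have hli' := LinearIndependent.pair_iff.1 hli
  have ha : A - B ≠ 0 := fun h => by simpa using hli' 1 0 (by simp [h])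
  have hna : ‖A - B‖ ≠ 0 := norm_ne_zero_iff.2 ha
  have huu : inner ℝ u u = (1 : ℝ) := by
    rw [hu, real_inner_smul_left, real_inner_smul_right, real_inner_self_eq_norm_sq]
    field_simp
  have hw0 : w ≠ 0 := by
    intro h0
    rw [h0, hu, smul_smul] at hw
    have := hli' (-(inner ℝ (C - B) (‖A - B‖⁻¹ • (A - B)) * ‖A - B‖⁻¹)) 1 (by
      rw [neg_smul, one_smul, neg_add_eq_sub]; exact hw.symm)
    exact one_ne_zero this.2
  have hnw : ‖w‖ ≠ 0 := norm_ne_zero_iff.2 hw0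
  have hvv : inner ℝ v v = (1 : ℝ) := by
    rw [hv, real_inner_smul_left, real_inner_smul_right, real_inner_self_eq_norm_sq]
    field_simp
  have huv : inner ℝ u v = (0 : ℝ) := by
    rw [hv, real_inner_smul_right, hw, inner_sub_right, real_inner_smul_right, huu,
      real_inner_comm]
    ring
  have hvu : inner ℝ v u = (0 : ℝ) := by rw [real_inner_comm, huv]
  have hum : u ∈ F.direction := by
    rw [hu]; exact F.direction.smul_mem _ (AffineSubspace.vsub_mem_direction hA hB)
  have hwm : w ∈ F.direction := by
    rw [hw]
    exact F.direction.sub_mem (AffineSubspace.vsub_mem_direction hC hB)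
      (F.direction.smul_mem _ hum)
  have hvm : v ∈ F.direction := by rw [hv]; exact F.direction.smul_mem _ hwm
  have hind : LinearIndependent ℝ ![u, v] := by
    rw [LinearIndependent.pair_iff]
    intro s t hst
    have h1 : inner ℝ (s • u + t • v) u = (0 : ℝ) := by rw [hst, inner_zero_left]
    have h2 : inner ℝ (s • u + t • v) v = (0 : ℝ) := by rw [hst, inner_zero_left]
    rw [inner_add_left, real_inner_smul_left, real_inner_smul_left, huu, hvu] at h1
    rw [inner_add_left, real_inner_smul_left, real_inner_smul_left, huv, hvv] at h2
    constructor <;> linarith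
  have hspan := finrank_span_eq_card hind
  rw [Matrix.range_cons, Matrix.range_cons, Matrix.range_empty, Set.union_empty,
    Set.singleton_union, Fintype.card_fin] at hspan
  refine ⟨hB, huu, hvv, huv, (Submodule.eq_of_le_of_finrank_eq ?_ (by rw [hspan, hF])).symm⟩
  rw [Submodule.span_le]
  rintro x (rfl | rfl)
  · exact hum
  · exact hvm

lemma subSmul_cost (a : Space) (t : ℝ) (b : Space) : (subSmul a t b).cost = 15 := rfl

lemma normalize_cost (a : Space) : (normalize a).cost = 21 := rfl

lemma dot3_ops (a b : Space) : (dot3 a b).ops = 11 := rfl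

lemma frameCoords_cost (O u v Q : Space) : (frameCoords O u v Q).cost = 37 := rfl

lemma reflect_cost (Q : Plane) : (reflect Q).cost = 3 := rfl

lemma tabulate_cost {α : Type} {n : ℕ} {f : Fin n → Timed α} {k : ℕ} (h : ∀ i, (f i).cost = k) :
    (tabulate f).cost = (k + 1) * n := by
  simp [tabulate, h, mul_comm]

lemma signedArea_reflect {n : ℕ} [NeZero n] {S S' : Fin n → Plane} (h0 : ∀ i, S' i 0 = S i 0)
    (h1 : ∀ i, S' i 1 = -S i 1) : signedArea S' = -signedArea S := by
  rw [signedArea, signedArea, ← Finset.sum_neg_distrib]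
  refine Finset.sum_congr rfl fun i _ => ?_
  unfold shoelace
  rw [h0, h0, h1, h1]; ring

section
variable {n : ℕ} [NeZero n] {F : AffineSubspace ℝ Space} {V : Fin n → Space}
  {sort : List Mark → RandTimed (List Mark)}

/-- The first axis that the algorithm computes. -/
def firstAxis (V : Fin n → Space) : Space := (normalize (subSmul (V 0) 1 (V 1)).val).val

/-- The second axis that the algorithm computes. -/
def secondAxis (V : Fin n → Space) : Space :=
  (normalize (subSmul (subSmul (V 2) 1 (V 1)).val
    (inner ℝ (subSmul (V 2) 1 (V 1)).val (firstAxis V)) (firstAxis V)).val).val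

lemma isFrame_axes (hF : Module.finrank ℝ F.direction = 2) (hV : ∀ i, V i ∈ F)
    (hli : LinearIndependent ℝ ![V 0 - V 1, V 2 - V 1]) :
    IsFrame F (V 1) (firstAxis V) (secondAxis V) :=
  isFrame_gramSchmidt (u := firstAxis V) hF (hV 0) (hV 1) (hV 2) hli
    (by rw [firstAxis, normalize_val, subSmul_val, one_smul]) rfl
    (by rw [secondAxis, normalize_val, subSmul_val, subSmul_val, one_smul])

lemma isSimplePolygon_coordsIn {O u v : Space} (h : IsFrame F O u v) (hV : ∀ i, V i ∈ F)
    (hS : IsSimplePolygon V) : IsSimplePolygon fun i => coordsIn O u v (V i) := by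
  refine h.isSimplePolygon ?_
  simpa only [h.framePoint_coordsIn (hV _)] using hS

/-- In a frame in which the polygon runs counterclockwise, areas are computed in the plane. -/
lemma space_areas {O u v : Space} (h : IsFrame F O u v) (hV : ∀ i, V i ∈ F) {P : Space} {d : ℝ}
    (hd : 0 ≤ d) (hle : dist P (framePoint O u v (coordsIn O u v P)) ^ 2 ≤ d ^ 2) :
    (μHE[2] : Measure Space).real (region (F : Set Space) V) =
        volume.real (planeRegion fun i => coordsIn O u v (V i)) ∧
      (μHE[2] : Measure Space).real (region (F : Set Space) V ∩ Metric.closedBall P d) =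
        volume.real ((planeRegion fun i => coordsIn O u v (V i)) ∩
          Metric.closedBall (coordsIn O u v P)
            (Real.sqrt (d ^ 2 - dist P (framePoint O u v (coordsIn O u v P)) ^ 2))) := by
  have e := h.image_planeRegion (S := fun i => coordsIn O u v (V i))
  simp only [h.framePoint_coordsIn (hV _)] at e
  rw [← e, h.image_inter_closedBall _ P hd hle, measureReal_def, h.area_image]
  refine ⟨rfl, ?_⟩
  rw [measureReal_def, h.area_image]
  rfl

lemma space_volume {O u v : Space} (h : IsFrame F O u v) (hV : ∀ i, V i ∈ F)
    (hS : IsSimplePolygon V) : (μHE[2] : Measure Space) (region (F : Set Space) V) ≠ 0 ∧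
      (μHE[2] : Measure Space) (region (F : Set Space) V) ≠ ∞ := by
  have hS' := isSimplePolygon_coordsIn h hV hS
  have e := h.image_planeRegion (S := fun i => coordsIn O u v (V i))
  simp only [h.framePoint_coordsIn (hV _)] at e
  rw [← e, h.area_image]
  refine ⟨volume_planeRegion_ne_zero hS', fun ht => ?_⟩
  have := hS'.volume_pos
  rw [measureReal_def, ht] at this
  simp at this

/-- The part of the algorithm that follows the computation of coordinates. -/
def spaceTail (sort : List Mark → RandTimed (List Mark)) (S : Fin n → Plane) (p : Plane)
    (h2 d : ℝ) : RandTimed Output := do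
  if ← testLt (RExpr.lit d * RExpr.lit d) (RExpr.lit h2) then
    pure ⟨0, 0⟩
  else
    let R ← (RExpr.sqrt (RExpr.lit d * RExpr.lit d - RExpr.lit h2)).run
    let D ← algorithm2 p S
    if ← testLt (RExpr.lit D.area) 0 then
      let S' ← tabulate fun i => reflect (S i)
      let p' ← reflect p
      planeAlgorithm sort p' S' R
    else
      algorithm4 sort p S D.crossingNumber D.area R

/-- The square of the distance from the plane that the algorithm computes. -/
def heightSq (P : Space) (V : Fin n → Space) : ℝ :=
  dist P (framePoint (V 1) (firstAxis V) (secondAxis V)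
    (coordsIn (V 1) (firstAxis V) (secondAxis V) P)) ^ 2

lemma heightSq_eq (P O u v : Space) (p : Plane) :
    inner ℝ (P - (1 : ℝ) • O - p 0 • u - p 1 • v) (P - (1 : ℝ) • O - p 0 • u - p 1 • v) =
      dist P (framePoint O u v p) ^ 2 := by
  rw [real_inner_self_eq_norm_sq, dist_eq_norm]
  congr 2
  unfold framePoint
  module

/-- The computation `p` after `k` further steps. -/
def delay {α : Type} (k : ℕ) (p : RandTimed α) : RandTimed α :=
  RandTimed.lift (⟨(), k⟩ : Timed Unit) >>= fun _ => p

lemma lift_bind_eq_delay {α β : Type} (t : Timed α) (f : α → RandTimed β) :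
    RandTimed.lift t >>= f = delay t.cost (f t.val) :=
  (PMF.pure_bind _ _).trans (PMF.pure_bind (⟨(), t.cost⟩ : Timed Unit)
    fun a => PMF.map (fun b : Timed β => (⟨b.val, a.cost + b.cost⟩ : Timed β)) (f t.val)).symm

lemma delay_delay {α : Type} (a b : ℕ) (p : RandTimed α) :
    delay a (delay b p) = delay (a + b) p := by
  have e (k : ℕ) (p : RandTimed α) : delay k p =
      PMF.map (fun b : Timed α => (⟨b.val, k + b.cost⟩ : Timed α)) p := PMF.pure_bind _ _
  rw [e, e, e]
  refine (PMF.map_comp _ _ _).trans ?_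
  congr 1
  funext r
  simp [add_assoc]

/-- The coordinates of the vertices that the algorithm computes. -/
def coordsOf (V : Fin n → Space) (i : Fin n) : Plane :=
  coordsIn (V 1) (firstAxis V) (secondAxis V) (V i)

/-- All steps up to the comparison with the height are deterministic. Each vertex takes `37` steps
for its coordinates and one for storing them; the remaining `191` steps compute the frame, the
projection of `P` and the height. -/
lemma spaceAlgorithm_eq (sort : List Mark → RandTimed (List Mark)) (P : Space) (V : Fin n → Space)
    (d : ℝ) : spaceAlgorithm sort P V d = delay (38 * n + 191) (spaceTail sort (coordsOf V)
      (coordsIn (V 1) (firstAxis V) (secondAxis V) P) (heightSq P V) d) := by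
  have hS : (tabulate fun i => frameCoords (V 1) (firstAxis V) (secondAxis V) (V i)).val =
      coordsOf V := by
    funext i
    exact frameCoords_val _ _ _ _
  have hc : (tabulate fun i => frameCoords (V 1) (firstAxis V) (secondAxis V) (V i)).cost =
      38 * n := tabulate_cost fun i => frameCoords_cost _ _ _ _
  have hw : (normalize (subSmul (subSmul (V 2) 1 (V 1)).val
    (inner ℝ (subSmul (V 2) 1 (V 1)).val (firstAxis V)) (firstAxis V)).val).val = secondAxis V := rfl
  have hu : (normalize (subSmul (V 0) 1 (V 1)).val).val = firstAxis V := rfl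
  rw [spaceAlgorithm, spaceTail]
  simp only [RandTimed.liftM_eq, lift_bind_eq_delay, delay_delay, hu, RExpr.val_run, dot3_eval, hw,
    hS, hc, frameCoords_val]
  simp only [subSmul_val, heightSq_eq, ← heightSq.eq_def, subSmul_cost, normalize_cost,
    frameCoords_cost, RExpr.cost_run, dot3_ops]
  congr 1
  omega

lemma mem_runs_delay {α : Type} {k : ℕ} {p : RandTimed α} {r : Timed α} :
    r ∈ (delay k p).runs ↔ ∃ b ∈ p.runs, r = ⟨b.val, k + b.cost⟩ :=
  RandTimed.mem_runs_lift_bind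

lemma expectedCost_delay {α : Type} (k : ℕ) (p : RandTimed α) :
    (delay k p).expectedCost = k + p.expectedCost :=
  RandTimed.expectedCost_lift_bind _ _

lemma planeAlgorithm_eq_delay (sort : List Mark → RandTimed (List Mark)) (P : Plane)
    (S : Fin n → Plane) (d : ℝ) : planeAlgorithm sort P S d = delay (algorithm2 P S).cost
      (algorithm4 sort P S (algorithm2 P S).val.crossingNumber (algorithm2 P S).val.area d) := by
  rw [planeAlgorithm]
  simp only [RandTimed.liftM_eq, lift_bind_eq_delay]

lemma spaceAlgorithm_of_lt (hn : 3 ≤ n) {P : Space} {d : ℝ} (hlt : d ^ 2 < heightSq P V) :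
    ∃ k ≤ 1300 * n, spaceAlgorithm sort P V d = delay k (pure ⟨0, 0⟩) := by
  refine ⟨38 * n + 191 + 5, by omega, ?_⟩
  rw [spaceAlgorithm_eq, spaceTail]
  have ht : (testLt (RExpr.lit d * RExpr.lit d) (RExpr.lit (heightSq P V))).val = true :=
    decide_eq_true (by simpa [pow_two] using hlt)
  simp only [RandTimed.liftM_eq, lift_bind_eq_delay, delay_delay, ht, if_true]
  rfl

/-- If the ball meets the plane, then Algorithm 4 is called in a frame in which the polygon runs
counterclockwise. -/
lemma spaceAlgorithm_of_le (hF : Module.finrank ℝ F.direction = 2) (hV : ∀ i, V i ∈ F)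
    (hS : IsSimplePolygon V) (hli : LinearIndependent ℝ ![V 0 - V 1, V 2 - V 1]) {P : Space} {d : ℝ}
    (hle : heightSq P V ≤ d ^ 2) : ∃ v, IsFrame F (V 1) (firstAxis V) v ∧
      dist P (framePoint (V 1) (firstAxis V) v (coordsIn (V 1) (firstAxis V) v P)) ^ 2 =
        heightSq P V ∧
      ∃ (S : Fin n → Plane) (p : Plane), S = (fun i => coordsIn (V 1) (firstAxis V) v (V i)) ∧
        p = coordsIn (V 1) (firstAxis V) v P ∧ PositivelyOriented S ∧
        ∃ k ≤ 1300 * n, spaceAlgorithm sort P V d = delay k (algorithm4 sort p S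
          (algorithm2 p S).val.crossingNumber (algorithm2 p S).val.area
          (Real.sqrt (d ^ 2 - heightSq P V))) := by
  have hn := hS.three_le
  have h := isFrame_axes hF hV hli
  have hS' : IsSimplePolygon (coordsOf V) := isSimplePolygon_coordsIn h hV hS
  have hS'' := isSimplePolygon_coordsIn h.neg_right hV hS
  set p := coordsIn (V 1) (firstAxis V) (secondAxis V) P with hp
  have ht : (testLt (RExpr.lit d * RExpr.lit d) (RExpr.lit (heightSq P V))).val = false :=
    decide_eq_false (by simpa [pow_two] using hle)
  have harea := algorithm2_area hS' p
  have hcost := algorithm2_cost_le p (coordsOf V)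
  have hR : (RExpr.lit d * RExpr.lit d - RExpr.lit (heightSq P V)).sqrt.eval =
      Real.sqrt (d ^ 2 - heightSq P V) := by simp [pow_two]
  have htab : (tabulate fun i => reflect (coordsOf V i)).val =
      fun i => coordsIn (V 1) (firstAxis V) (-secondAxis V) (V i) := by
    funext i
    exact reflect_coordsIn _ _ _ _
  have htabc : (tabulate fun i => reflect (coordsOf V i)).cost = 4 * n :=
    tabulate_cost fun i => reflect_cost _
  have hc1 : (testLt (RExpr.lit d * RExpr.lit d) (RExpr.lit (heightSq P V))).cost = 5 := rfl
  have hc2 (x : ℝ) : (testLt (RExpr.lit x) 0).cost = 3 := rfl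
  have hc3 : (RExpr.lit d * RExpr.lit d - RExpr.lit (heightSq P V)).sqrt.ops = 6 := rfl
  by_cases hneg : signedArea (coordsOf V) < 0
  · have ht2 : (testLt (RExpr.lit (algorithm2 p (coordsOf V)).val.area) 0).val = true :=
      decide_eq_true (by simpa [harea] using hneg)
    have hcost' := algorithm2_cost_le (coordsIn (V 1) (firstAxis V) (-secondAxis V) P)
      fun i => coordsIn (V 1) (firstAxis V) (-secondAxis V) (V i)
    -- The reflected coordinates are those in the frame with the second axis reversed; there the
    -- signed area has the opposite sign and the projection of `P` is the same point.
    refine ⟨-secondAxis V, h.neg_right, ?_, _, _, rfl, rfl,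
      hS''.positivelyOriented_of_signedArea ?_, ?_⟩
    · simp [heightSq, framePoint, coordsIn]
    · have := signedArea_reflect (S := coordsOf V)
        (S' := fun i => coordsIn (V 1) (firstAxis V) (-secondAxis V) (V i)) (fun i => rfl)
        fun i => by simp [coordsOf, coordsIn]
      linarith
    · refine ⟨38 * n + 191 + (5 + (6 + ((algorithm2 p (coordsOf V)).cost + (3 + (4 * n + (3 +
        (algorithm2 (coordsIn (V 1) (firstAxis V) (-secondAxis V) P)
          fun i => coordsIn (V 1) (firstAxis V) (-secondAxis V) (V i)).cost)))))), by omega, ?_⟩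
      rw [spaceAlgorithm_eq, spaceTail]
      simp only [RandTimed.liftM_eq, lift_bind_eq_delay, delay_delay, ht, Bool.false_eq_true,
        if_false, ht2, if_true, planeAlgorithm_eq_delay, htab, ← hp, hR, RExpr.val_run]
      rw [htabc, hc1, hc2, reflect_cost, RExpr.cost_run, hc3, hp, reflect_coordsIn]
  · have ht2 : (testLt (RExpr.lit (algorithm2 p (coordsOf V)).val.area) 0).val = false :=
      decide_eq_false (by simpa [harea] using hneg)
    refine ⟨secondAxis V, h, rfl, _, _, rfl, rfl,
      hS'.positivelyOriented_of_signedArea (not_lt.1 hneg), ?_⟩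
    refine ⟨38 * n + 191 + (5 + (6 + ((algorithm2 p (coordsOf V)).cost + 3))), by omega, ?_⟩
    rw [spaceAlgorithm_eq, spaceTail]
    simp only [RandTimed.liftM_eq, lift_bind_eq_delay, delay_delay, ht, Bool.false_eq_true,
      if_false, ht2, ← hp, hR, RExpr.val_run]
    rw [hc1, hc2, RExpr.cost_run, hc3]
    rfl

lemma spaceAlgorithm_runs (hF : Module.finrank ℝ F.direction = 2) (hV : ∀ i, V i ∈ F)
    (hS : IsSimplePolygon V) (hli : LinearIndependent ℝ ![V 0 - V 1, V 2 - V 1]) (P : Space) {d : ℝ}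
    (hd : 0 ≤ d) (hsort : CorrectSort sort) {r : Timed Output}
    (hr : r ∈ (spaceAlgorithm sort P V d).runs) :
    r.val.area = (μHE[2] : Measure Space).real (region (F : Set Space) V ∩ Metric.closedBall P d) ∧
      r.val.cdf = r.val.area / (μHE[2] : Measure Space).real (region (F : Set Space) V) ∧
      ∀ T, (∀ l, l.length ≤ 2 * n → ∀ q ∈ (sort l).runs, q.cost ≤ T) → r.cost ≤ 2000 * n + T := by
  rcases lt_or_ge (d ^ 2) (heightSq P V) with hlt | hle
  · obtain ⟨k, hk, e⟩ := spaceAlgorithm_of_lt (sort := sort) hS.three_le hlt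
    rw [e, mem_runs_delay] at hr
    obtain ⟨b, hb, rfl⟩ := hr
    rw [RandTimed.mem_runs_pure] at hb
    subst hb
    rw [(isFrame_axes hF hV hli).inter_closedBall_eq_empty (region_subset hV) P hd hlt]
    refine ⟨by simp, by simp, fun T _ => ?_⟩
    simp only [Timed.cost_pure]
    omega
  · obtain ⟨v, h, hh, S, p, rfl, rfl, hw, k, hk, e⟩ :=
      spaceAlgorithm_of_le (sort := sort) hF hV hS hli hle
    rw [e, mem_runs_delay] at hr
    obtain ⟨b, hb, rfl⟩ := hr
    have hS' := isSimplePolygon_coordsIn h hV hS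
    obtain ⟨h1, h2, h3⟩ := algorithm4_runs hS' hw (Real.sqrt_nonneg _) hsort
      (odd_crossingNumber_iff hS' hw _) (algorithm2_area hS' _) hb
    have ha := space_areas h hV hd (hh.le.trans hle)
    rw [hh] at ha
    rw [ha.1, ha.2]
    refine ⟨h1, h2, fun T hT => ?_⟩
    have := h3 T hT
    dsimp only
    omega

lemma spaceAlgorithm_expectedCost_le (hF : Module.finrank ℝ F.direction = 2) (hV : ∀ i, V i ∈ F)
    (hS : IsSimplePolygon V) (hli : LinearIndependent ℝ ![V 0 - V 1, V 2 - V 1]) (P : Space) (d : ℝ)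
    (hsort : CorrectSort sort) {T : ℝ≥0∞}
    (hT : ∀ l, l.length ≤ 2 * n → (sort l).expectedCost ≤ T) :
    (spaceAlgorithm sort P V d).expectedCost ≤ (2000 * n : ℕ) + T := by
  rcases lt_or_ge (d ^ 2) (heightSq P V) with hlt | hle
  · obtain ⟨k, hk, e⟩ := spaceAlgorithm_of_lt (sort := sort) hS.three_le hlt
    rw [e, expectedCost_delay, RandTimed.expectedCost_pure, add_zero]
    exact le_add_right (Nat.cast_le.2 (by omega))
  · obtain ⟨v, h, hh, S, p, rfl, rfl, hw, k, hk, e⟩ :=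
      spaceAlgorithm_of_le (sort := sort) hF hV hS hli hle
    rw [e, expectedCost_delay]
    have hk' : (k : ℝ≥0∞) ≤ (1300 * n : ℕ) := Nat.cast_le.2 hk
    refine (add_le_add hk' (algorithm4_expectedCost_le (isSimplePolygon_coordsIn h hV hS)
      (Real.sqrt_nonneg _) _ _ hT hsort)).trans_eq ?_
    push_cast
    ring

/-- A ball meets the plane of the polygon in a disk about the projection of its center. -/
lemma IsFrame.region_inter_closedBall {O u v : Space} (h : IsFrame F O u v) [Nonempty F]
    (hV : ∀ i, V i ∈ F) (P : Space) {d : ℝ} (hd : 0 ≤ d)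
    (hle : dist P (EuclideanGeometry.orthogonalProjection F P : Space) ≤ d) :
    region (F : Set Space) V ∩ Metric.closedBall P d = region (F : Set Space) V ∩
      Metric.closedBall (EuclideanGeometry.orthogonalProjection F P : Space)
        (Real.sqrt (d ^ 2 - dist P (EuclideanGeometry.orthogonalProjection F P : Space) ^ 2)) := by
  rw [h.orthogonalProjection_eq] at hle ⊢
  have hsq := pow_le_pow_left₀ dist_nonneg hle 2
  ext Q
  refine and_congr_right fun hQ => ?_
  obtain ⟨p, rfl⟩ := (h.mem_iff Q).1 (region_subset hV hQ)
  rw [Metric.mem_closedBall, Metric.mem_closedBall, h.isometry.dist_eq,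
    Real.le_sqrt dist_nonneg (by linarith), ← sq_le_sq₀ dist_nonneg hd, h.dist_framePoint_sq]
  constructor <;> intro <;> linarith

lemma IsFrame.region_inter_closedBall_eq_empty {O u v : Space} (h : IsFrame F O u v) [Nonempty F]
    (hV : ∀ i, V i ∈ F) (P : Space) {d : ℝ} (hd : 0 ≤ d)
    (hlt : d < dist P (EuclideanGeometry.orthogonalProjection F P : Space)) :
    region (F : Set Space) V ∩ Metric.closedBall P d = ∅ := by
  rw [h.orthogonalProjection_eq] at hlt
  exact h.inter_closedBall_eq_empty (region_subset hV) P hd (pow_lt_pow_left₀ hlt hd two_ne_zero)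

end

end PolygonDistance
end

/-! ### The main theorem -/

open PolygonDistance in
theorem mainTheorem4 :
    ∃ C : ℝ,
      (∀ (n : ℕ) [NeZero n] (S : Fin n → Plane), IsSimplePolygon S → InteriorOnLeft S →
        ∀ P : Plane,
          (0 < volume.real (planeRegion S) ∧
            (algorithm2 P S).val.area = volume.real (planeRegion S) ∧
            (algorithm2 P S).val.dMin = ((Metric.infDist P (boundary S) : ℝ) : EReal) ∧
            IsGreatest ((fun Q => dist P Q) '' boundary S) (algorithm2 P S).val.dMax ∧
            (P ∈ boundary S ↔ (algorithm2 P S).val.dMin = 0) ∧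
            (P ∉ boundary S →
              (P ∈ interior (planeRegion S) ↔ Odd (algorithm2 P S).val.crossingNumber)) ∧
            (P ∈ planeRegion S ↔
              Odd (algorithm2 P S).val.crossingNumber ∨ (algorithm2 P S).val.dMin = 0)) ∧
          ∀ d : ℝ, 0 ≤ d →
            (∀ r ∈ (planeAlgorithm (fun l => RandTimed.lift (mergeSort l)) P S d).runs,
              r.val.area = volume.real (planeRegion S ∩ Metric.closedBall P d) ∧
              r.val.cdf = distanceCDF volume (planeRegion S) P d ∧
              r.val.cdf = r.val.area / volume.real (planeRegion S) ∧
              (r.cost : ℝ) ≤ C * (n * Real.log n)) ∧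
            (∀ r ∈ (planeAlgorithm quickSort P S d).runs,
              r.val.area = volume.real (planeRegion S ∩ Metric.closedBall P d) ∧
              r.val.cdf = distanceCDF volume (planeRegion S) P d) ∧
            (planeAlgorithm quickSort P S d).expectedCost ≤
              ENNReal.ofReal (C * (n * Real.log n))) ∧
      (∀ (n : ℕ) [NeZero n] (F : AffineSubspace ℝ Space) [Nonempty F] (V : Fin n → Space),
        Module.finrank ℝ F.direction = 2 → (∀ i, V i ∈ F) → IsSimplePolygon V →
        LinearIndependent ℝ ![V 0 - V 1, V 2 - V 1] →
        ∀ (P : Space) (d : ℝ), 0 ≤ d →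
          (∀ P₀ : Space, P₀ = (EuclideanGeometry.orthogonalProjection F P : Space) →
            (dist P P₀ ≤ d →
              region (F : Set Space) V ∩ Metric.closedBall P d =
                region (F : Set Space) V ∩
                  Metric.closedBall P₀ (Real.sqrt (d ^ 2 - dist P P₀ ^ 2))) ∧
            (d < dist P P₀ → region (F : Set Space) V ∩ Metric.closedBall P d = ∅)) ∧
          0 < (μHE[2] : Measure Space).real (region (F : Set Space) V) ∧
          (∀ r ∈ (spaceAlgorithm (fun l => RandTimed.lift (mergeSort l)) P V d).runs,
            r.val.area =
              (μHE[2] : Measure Space).real (region (F : Set Space) V ∩ Metric.closedBall P d) ∧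
            r.val.cdf = distanceCDF μHE[2] (region (F : Set Space) V) P d ∧
            r.val.cdf = r.val.area / (μHE[2] : Measure Space).real (region (F : Set Space) V) ∧
            (r.cost : ℝ) ≤ C * (n * Real.log n)) ∧
          (∀ r ∈ (spaceAlgorithm quickSort P V d).runs,
            r.val.area =
              (μHE[2] : Measure Space).real (region (F : Set Space) V ∩ Metric.closedBall P d) ∧
            r.val.cdf = distanceCDF μHE[2] (region (F : Set Space) V) P d) ∧
          (spaceAlgorithm quickSort P V d).expectedCost ≤
            ENNReal.ofReal (C * (n * Real.log n))) := by
  -- All deterministic loops, in the plane and in space, take at most `2000 * n` steps; the rest of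
  -- the constant covers both sorting procedures.
  refine ⟨3000, ?_, ?_⟩
  · intro n _ S hS hleft P
    have hw := hS.positivelyOriented_of_interiorOnLeft hleft
    have hn := hS.three_le
    refine ⟨algorithm2_correct hS hw P, fun d hd => ⟨fun r hr => ?_, fun r hr => ?_, ?_⟩⟩
    · obtain ⟨h1, h2, h3⟩ := planeAlgorithm_runs hS hw P hd correctSort_mergeSort hr
      refine ⟨h1, ?_, h2, ?_⟩
      · rw [distanceCDF_eq (volume_planeRegion_ne_zero hS) (volume_planeRegion_ne_top hw), h2, h1]
      · have := h3 (7 * (2 * n * Nat.clog 2 (2 * n)) + 1) fun l hl q hq => by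
          rw [RandTimed.mem_runs_lift] at hq
          rw [hq]
          exact mergeSort_cost_le_of_length_le l hl
        exact mergeSort_total_le hn (by omega)
    · obtain ⟨h1, h2, -⟩ := planeAlgorithm_runs hS hw P hd correctSort_quickSort hr
      refine ⟨h1, ?_⟩
      rw [distanceCDF_eq (volume_planeRegion_ne_zero hS) (volume_planeRegion_ne_top hw), h2, h1]
    · exact quickSort_total_le hn (k := 920 * n) (by omega)
        (planeAlgorithm_expectedCost_le hS P hd correctSort_quickSort quickSort_expectedCost_le)
  · intro n _ F _ V hF hV hS hli P d hd
    have hn := hS.three_le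
    have h := isFrame_axes hF hV hli
    obtain ⟨h0, ht⟩ := space_volume h hV hS
    refine ⟨?_, ENNReal.toReal_pos h0 ht, fun r hr => ?_, fun r hr => ?_, ?_⟩
    · rintro P₀ rfl
      exact ⟨h.region_inter_closedBall hV P hd, h.region_inter_closedBall_eq_empty hV P hd⟩
    · obtain ⟨h1, h2, h3⟩ := spaceAlgorithm_runs hF hV hS hli P hd correctSort_mergeSort hr
      refine ⟨h1, ?_, h2, ?_⟩
      · rw [distanceCDF_eq h0 ht, h2, h1]
      · have := h3 (7 * (2 * n * Nat.clog 2 (2 * n)) + 1) fun l hl q hq => by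
          rw [RandTimed.mem_runs_lift] at hq
          rw [hq]
          exact mergeSort_cost_le_of_length_le l hl
        exact mergeSort_total_le hn this
    · obtain ⟨h1, h2, -⟩ := spaceAlgorithm_runs hF hV hS hli P hd correctSort_quickSort hr
      exact ⟨h1, by rw [distanceCDF_eq h0 ht, h2, h1]⟩
    · exact quickSort_total_le hn (k := 2000 * n) le_rfl
        (spaceAlgorithm_expectedCost_le hF hV hS hli P d correctSort_quickSort
          quickSort_expectedCost_le)
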